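/- **Definitions.** Let $\Gamma=\mathrm{SL}_2(\mathbb Z)$, let $\mathfrak H^{+},\mathfrak H^-$ be the upper and lower half-plane, and let powers be principal, with $\arg\in(-\pi,\pi]$. For $p\in\mathbb R$ let $\eta^{2p}(z)=e^{\pi i p z/6}\prod_{n\ge1}(1-e^{2\pi i n z})^{2p}$, and for $\gamma=\begin{pmatrix}a&b\\c&d\end{pmatrix}\in\Gamma$ let $v[p](\gamma)=\dfrac{\eta^{2p}(\gamma z)}{(cz+d)^p\,\eta^{2p}(z)}$, which does not depend on $z\in\mathfrak H^+$. $A_r(v)$ is the space of holomorphic $f:\mathfrak H^+\to\mathbb C$ with $f(\gamma z)=v(\gamma)(cz+d)^rf(z)$ for all $\gamma\in\Gamma$; $M_r(v)$ is its subspace given by $f(z)=O(1)$ as $\operatorname{Im}z\to\infty$, and $S_r(v)$ the subspace given by $f(z)=O((\operatorname{Im}z)^{-a})$ for all $a$. For a function $f$ on $\mathfrak H^-$ put $f^-(t)=(i-t)^rf(t)$, and for $h$ holomorphic on $\mathfrak H^+$ put $h^+(z)=(-i-z)^rh(z)$. Let $\mathcal D_r^{\omega}$ (respectively $\mathcal D_r^\infty$)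 be the space of holomorphic $f$ on $\mathfrak H^-$ for which $f^-$ extends holomorphically to a neighbourhood of $\mathfrak H^-\cup\mathbb P^1(\mathbb R)$ (respectively extends to a $C^\infty$ function on $\mathfrak H^-\cup\mathbb P^1(\mathbb R)$, smoothness at $\infty$ being understood in the coordinate $-1/t$). The topology of $\mathcal D_r^\infty$ is that of uniform convergence on the circle $\mathbb P^1(\mathbb R)$ of all derivatives, with respect to the angle, of the extension of $f^-$. For $r>0$ and $f\in\mathcal D^\omega_r$ let $$\sigma_rf^-(z)=\frac1\pi\,\frac{z+i}{z-i}\int_{C_1}f^-(\tau)\;{}_2F_1\Bigl(1,1;r;\tfrac{(\tau-i)(z+i)}{(\tau+i)(z-i)}\Bigr)\frac{d\tau}{\tau^2+1},\qquad [h,f]_r=\frac1\pi\int_{C_2}h^+(z)\,\sigma_rf^-(z)\,\frac{dz}{(z+i)^2},$$ where $C_j$ is the positively oriented circle $\bigl|\frac{z-i}{z+i}\bigr|=c_j$ with $c_1<c_2<1$, and $c_1$ is so close to $1$ that $f^-$ extends holomorphically to $\bigl|\frac{z-i}{z+i}\bigr|>c$ in $\mathbb P^1(\mathbb C)$ for some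 $c<c_1$. For $h\in M_r(v)$ let $[h,f]_r$ for $f\in\mathcal D^\infty_r$ be given by the continuous extension of $f\mapsto[h,f]_r$ from $\mathcal D_r^\omega$ to $\mathcal D^\infty_r$. Finally, with $\rho=e^{\pi i/3}$, let $$\mathrm T(f_1,f_2,f_3)=\bigl[f_3,\;c_{f_1}(\rho-1,\rho)\cdot c_{f_2}(i,\infty)\bigr]_{r_3},\qquad c_{f_j}(z_1,z_2)(t)=\int_{z_1}^{z_2}f_j(z)\,(z-t)^{r_j-2}\,dz\quad(t\in\mathfrak H^-).$$ **Proposition.** Let $r_1,r_2,r_3,p_1,p_2,p_3\in\mathbb R$ satisfy $$r_1<2,\quad 0<r_2<2,\quad r_3>0,\quad r_1+r_2+r_3=4,\qquad p_j\equiv r_j\bmod 2,\quad p_1+p_2+p_3=0.$$ Let $f_1\in A_{r_1}(v[p_1])$, $f_2\in S_{r_2}(v[p_2])$, $f_3\in M_{r_3}(v[p_3])$ be given on $\mathfrak H^+$ by Fourier expansions $f_j(z)=\sum_{m\ge0}a_j(m)\,e^{2\pi i(m+p_j/12)z}$. Then $$\mathrm T(f_1,f_2,f_3)=\frac{(-2i)^{r_3}}{B(2-r_1,2-r_2)}\sum_{m_1,m_2,m_3\ge0}a_1(m_1)\,a_2(m_2)\,a_3(m_3)\;\Psi_{r_1,r_2}\Bigl(\tfrac{12m_1+p_1}{12},\tfrac{12m_2+p_2}{12},\tfrac{12m_3+p_3}{12}\Bigr),$$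 with an absolutely convergent triple sum (terms with $a_1(m_1)a_2(m_2)a_3(m_3)=0$ are read as $0$), where $B(a,b)=\Gamma(a)\Gamma(b)/\Gamma(a+b)$, and, with $S(x)=\frac{\sin x}x$, $S(0)=1$, for $\mu_1\in\mathbb R$, $\mu_2>0$, $\mu_3\ge0$, $$\Psi_{r_1,r_2}(\mu_1,\mu_2,\mu_3)=-\frac{e^{-2\pi\mu_2-\pi\sqrt3(\mu_1+\mu_3)}}{2\pi i}\int_0^1u^{1-r_2}(1-u)^{1-r_1}\,\frac{e^{-\pi(2-\sqrt3)\mu_3u}}{\mu_2+\mu_3u}\,S\bigl(\pi(\mu_1+(1-u)\mu_3)\bigr)\,du ,$$ the integral being absolutely convergent. If $\mu_3>0$, then also $$\Psi_{r_1,r_2}(\mu_1,\mu_2,\mu_3)=-\frac{e^{-2\pi\mu_2-\pi\sqrt3(\mu_1+\mu_3)}}{2\pi i}\,\mu_3^{1-r_3}\int_0^{\mu_3}u^{1-r_2}(\mu_3-u)^{1-r_1}\,\frac{e^{-\pi(2-\sqrt3)u}}{\mu_2+u}\,S\bigl(\pi(\mu_1+\mu_3-u)\bigr)\,du ,$$ again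 with an absolutely convergent integral. -/

import Mathlib

open scoped Real Topology MatrixGroups
open Complex (I)

noncomputable section

namespace CupProduct

/-! ### Modular forms of real weight on the full modular group -/

/-- The branch `log η(z) = π i z / 12 + ∑_{n ≥ 1} log (1 - e^{2π i n z})` of the logarithm of the
Dedekind eta function on the upper half-plane (`ModularForm.eta_q n z = e^{2π i (n + 1) z}`). -/
def logEta (z : ℂ) : ℂ :=
  π * I * z / 12 + ∑' n : ℕ, Complex.log (1 - ModularForm.eta_q n z)

/-- The power `η^{2p}` of the Dedekind eta function, for real `p`. -/
def etaPow (p : ℝ) (z : ℂ) : ℂ := Complex.exp (2 * p * logEta z)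

/-- The automorphy factor `(c z + d)^r`, with `arg (c z + d) ∈ (-π, π]`. -/
def autFactor (r : ℝ) (γ : SL(2, ℤ)) (z : ℂ) : ℂ :=
  (((γ 1 0 : ℤ) : ℂ) * z + ((γ 1 1 : ℤ) : ℂ)) ^ (r : ℂ)

/-- The multiplier system `v[p]` of `η^{2p}`, that is
`v[p](γ) = η^{2p}(γ z) / ((c z + d)^p η^{2p}(z))`. The quotient does not depend on `z` in the upper
half-plane; it is evaluated here at `z = i`. -/
def etaMultiplier (p : ℝ) (γ : SL(2, ℤ)) : ℂ :=
  etaPow p ((γ • UpperHalfPlane.I : UpperHalfPlane) : ℂ) /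
    (autFactor p γ I * etaPow p I)

/-- The space `A_r(v[p])` of all holomorphic `f` on the upper half-plane with
`f(γ z) = v[p](γ) (c z + d)^r f(z)`. Functions on the upper half-plane are represented by
functions on `ℂ` of which only the values on the upper half-plane matter. -/
structure IsAutomorphicForm (r p : ℝ) (f : ℂ → ℂ) : Prop where
  holo : DifferentiableOn ℂ f {z : ℂ | 0 < z.im}
  transf : ∀ (γ : SL(2, ℤ)) (z : UpperHalfPlane),
    f ((γ • z : UpperHalfPlane) : ℂ) = etaMultiplier p γ * autFactor r γ z * f z

/-- The space `M_r(v[p])` of entire modular forms: `f(z) = O(1)` as `Im z → ∞`. -/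
structure IsEntireForm (r p : ℝ) (f : ℂ → ℂ) : Prop extends IsAutomorphicForm r p f where
  bounded : UpperHalfPlane.IsBoundedAtImInfty fun z : UpperHalfPlane => f z

/-- The space `S_r(v[p])` of cusp forms: `f(z) = O((Im z)^{-a})` as `Im z → ∞`, for each `a`. -/
structure IsCuspForm (r p : ℝ) (f : ℂ → ℂ) : Prop extends IsAutomorphicForm r p f where
  decay : ∀ a : ℝ, (fun z : UpperHalfPlane => f z) =O[UpperHalfPlane.atImInfty]
    fun z : UpperHalfPlane => z.im ^ (-a)

/-! ### Eichler integrals -/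

/-- `c_f(z₁, z₂; t) = ∫_{z₁}^{z₂} f(z) (z - t)^{r - 2} dz` along the segment from `z₁` to `z₂` in the
upper half-plane, for `t` in the lower half-plane. Here `Im (z - t) > 0`, so the power is the
principal one. -/
def eichler (r : ℝ) (f : ℂ → ℂ) (z₁ z₂ t : ℂ) : ℂ :=
  ∫ s in (0 : ℝ)..1,
    f (z₁ + s * (z₂ - z₁)) * (z₁ + s * (z₂ - z₁) - t) ^ ((r - 2 : ℝ) : ℂ) * (z₂ - z₁)

/-- `c_f(i, ∞; t) = ∫_i^{i∞} f(z) (z - t)^{r - 2} dz`, with `z = i y`. -/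
def eichlerCusp (r : ℝ) (f : ℂ → ℂ) (t : ℂ) : ℂ :=
  ∫ y in Set.Ioi (1 : ℝ), f (I * y) * (I * y - t) ^ ((r - 2 : ℝ) : ℂ) * I

/-- The vertex `ρ = e^{π i / 3}` of the standard fundamental domain. -/
def rho : ℂ := Complex.exp (π * I / 3)

/-- `cp(f₁, f₂) = c_{f₁}(ρ - 1, ρ) · c_{f₂}(i, ∞)`, the function on the lower half-plane that
represents the cup product of the Eichler cocycles of `f₁` and `f₂`. -/
def cupRep (r₁ r₂ : ℝ) (f₁ f₂ : ℂ → ℂ) (t : ℂ) : ℂ :=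
  eichler r₁ f₁ (rho - 1) rho t * eichlerCusp r₂ f₂ t

/-! ### The duality between functions on the upper and on the lower half-plane -/

/-- The inverse `x ↦ t` of the Cayley transform `t ↦ x = (t + i) / (t - i)`, which maps the lower
half-plane to the open unit disk, and `ℝ ∪ {∞}` to the unit circle. -/
def cayleyInv (x : ℂ) : ℂ := -I * (1 + x) / (1 - x)

/-- The function `f⁻(t) = (i - t)^r f(t)` in terms of the disk coordinate `x = (t + i) / (t - i)`. -/
def diskModel (r : ℝ) (f : ℂ → ℂ) (x : ℂ) : ℂ :=
  (I - cayleyInv x) ^ (r : ℂ) * f (cayleyInv x)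

/-- `F` is a holomorphic extension of `f⁻`, in the disk coordinate, to the disk `|x| < 1 / c`. -/
def IsHoloExtension (r : ℝ) (f F : ℂ → ℂ) (c : ℝ) : Prop :=
  DifferentiableOn ℂ F (Metric.ball 0 c⁻¹) ∧ ∀ x ∈ Metric.ball (0 : ℂ) 1, F x = diskModel r f x

/-- The module `D^ω` in weight `r`: the functions `f` on the lower half-plane for which `f⁻` extends
holomorphically to a neighborhood of the union of the lower half-plane and `ℝ ∪ {∞}`. -/
def IsAnalyticVector (r : ℝ) (f : ℂ → ℂ) : Prop :=
  ∃ (F : ℂ → ℂ) (c : ℝ), 0 < c ∧ c < 1 ∧ IsHoloExtension r f F c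

/-- The integral of `g` over the circle `|(z - i) / (z + i)| = c` in the upper half-plane, with
`0 < c < 1`, positively oriented. -/
def hypCircleIntegral (c : ℝ) (g : ℂ → ℂ) : ℂ :=
  ∮ z in C(I * (((1 + c ^ 2) / (1 - c ^ 2) : ℝ) : ℂ), 2 * c / (1 - c ^ 2)), g z

/-- The operator `σ_r`:
`σ_r f⁻(z) = (1/π) (z+i)/(z-i) ∫_C f⁻(τ) ₂F₁(1, 1; r; (τ-i)(z+i)/((τ+i)(z-i))) dτ/(τ²+1)`,
where `F` is `f⁻` in the disk coordinate and `C` is the circle `|(τ - i) / (τ + i)| = c`. -/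
def sigmaOp (r : ℝ) (F : ℂ → ℂ) (c : ℝ) (z : ℂ) : ℂ :=
  1 / π * ((z + I) / (z - I)) * hypCircleIntegral c fun τ =>
    F ((τ + I) / (τ - I)) *
      ordinaryHypergeometric (1 : ℂ) 1 (r : ℂ) ((τ - I) * (z + I) / ((τ + I) * (z - I))) /
        (τ ^ 2 + 1)

/-- The contour integral `(1/π) ∫_C h⁺(z) σ_r f⁻(z) dz/(z+i)²` with `h⁺(z) = (-i-z)^r h(z)`, where
`C` is the circle `|(z - i) / (z + i)| = c₂`, and `σ_r f⁻` is computed with the smaller circle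
`|(τ - i) / (τ + i)| = c₁`. -/
def dualityIntegral (r : ℝ) (h F : ℂ → ℂ) (c₁ c₂ : ℝ) : ℂ :=
  1 / π * hypCircleIntegral c₂ fun z =>
    (-I - z) ^ (r : ℂ) * h z * sigmaOp r F c₁ z / (z + I) ^ 2

/-- The bilinear form `[h, f]_r` for a holomorphic function `h` on the upper half-plane and `f` in
`D^ω`: the value of the contour integral for any choice of the holomorphic extension of `f⁻`, to a
disk `|x| < 1 / c`, and of circles with `c < c₁ < c₂ < 1`. -/
def dualityAnalytic (r : ℝ) (h f : ℂ → ℂ) : ℂ :=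
  Classical.epsilon fun v : ℂ => ∃ (F : ℂ → ℂ) (c c₁ c₂ : ℝ),
    0 < c ∧ c < c₁ ∧ c₁ < c₂ ∧ c₂ < 1 ∧ IsHoloExtension r f F c ∧
      v = dualityIntegral r h F c₁ c₂

/-- The extension of `f⁻` to the boundary `ℝ ∪ {∞}` of the lower half-plane, as a function of the
angle in the disk coordinate. -/
def boundaryValue (r : ℝ) (f : ℂ → ℂ) (θ : ℝ) : ℂ :=
  Filter.limUnder (𝓝[Metric.ball 0 1] Complex.exp (θ * I)) (diskModel r f)

/-- The natural topology of `D^∞` in weight `r`, the space of those holomorphic functions `f` on the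
lower half-plane for which `f⁻` extends as a `C^∞` function to the union of the lower half-plane and
`ℝ ∪ {∞}`: uniform convergence on `ℝ ∪ {∞}` of all derivatives of the extension of `f⁻`. -/
@[reducible]
def smoothTopology (r : ℝ) : TopologicalSpace (ℂ → ℂ) :=
  ⨅ N : ℕ, TopologicalSpace.induced
    (fun f => UniformFun.ofFun (iteratedDeriv N (boundaryValue r f)))
    (inferInstance : TopologicalSpace (UniformFun ℝ ℂ))

/-- The bilinear form `[h, f]_r` for `f` in `D^∞`: the extension by continuity of the linear form
`f ↦ [h, f]_r` on `D^ω`, for the natural topology of `D^∞`. -/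
def dualitySmooth (r : ℝ) (h : ℂ → ℂ) : (ℂ → ℂ) → ℂ :=
  @extendFrom (ℂ → ℂ) ℂ (smoothTopology r) _ {f | IsAnalyticVector r f} (dualityAnalytic r h)

/-- The trilinear form `T(f₁, f₂, f₃) = [f₃, cp(f₁, f₂)]_{r₃}`. -/
def trilinearForm (r₁ r₂ r₃ : ℝ) (f₁ f₂ f₃ : ℂ → ℂ) : ℂ :=
  dualitySmooth r₃ f₃ (cupRep r₁ r₂ f₁ f₂)

/-! ### The Fourier expansion of the trilinear form -/

/-- `f(z) = ∑_{m ≥ 0} a(m) e^{2π i (m + p/12) z}` on the upper half-plane. -/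
def HasFourierExpansion (p : ℝ) (f : ℂ → ℂ) (a : ℕ → ℂ) : Prop :=
  ∀ z : ℂ, 0 < z.im →
    HasSum (fun m : ℕ => a m * Complex.exp (2 * π * I * ((m : ℂ) + (p : ℂ) / 12) * z)) (f z)

/-- The integrand of `psi`; `Real.sinc x = sin x / x`, with value `1` at `x = 0`. -/
def psiIntegrand (r₁ r₂ μ₁ μ₂ μ₃ u : ℝ) : ℝ :=
  u ^ (1 - r₂) * (1 - u) ^ (1 - r₁) *
    (Real.exp (-π * (2 - √3) * μ₃ * u) / (μ₂ + μ₃ * u)) * Real.sinc (π * (μ₁ + (1 - u) * μ₃))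

/-- The function `Ψ_{r₁,r₂}(μ₁, μ₂, μ₃)`, the factor `-1/(2πi)` times `e^{-2πμ₂ - π√3(μ₁+μ₃)}` times
the integral over `u` from `0` to `1` of `psiIntegrand`. -/
def psi (r₁ r₂ μ₁ μ₂ μ₃ : ℝ) : ℂ :=
  -((Real.exp (-2 * π * μ₂ - π * √3 * (μ₁ + μ₃)) : ℝ) : ℂ) / (2 * π * I) *
    ((∫ u in (0 : ℝ)..1, psiIntegrand r₁ r₂ μ₁ μ₂ μ₃ u : ℝ) : ℂ)

/-- The integrand in the second expression for `Ψ_{r₁,r₂}`. -/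
def psiIntegrand' (r₁ r₂ μ₁ μ₂ μ₃ u : ℝ) : ℝ :=
  u ^ (1 - r₂) * (μ₃ - u) ^ (1 - r₁) *
    (Real.exp (-π * (2 - √3) * u) / (μ₂ + u)) * Real.sinc (π * (μ₁ + μ₃ - u))

end CupProduct

end

/-! The form `[·,·]_r` is diagonal in Cayley coordinates. Put `Z = (z-i)/(z+i)` on the upper and `x
= (t+i)/(t-i)` on the lower half-plane, and expand `h⁺ = ∑ H_n Z^n`, `f⁻ = ∑ b_n x^n`. The kernel
`₂F₁(1,1;r;·)` has Taylor coefficients `n!/(r)_n`, and powers of `Z` are orthogonal on hyperbolic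
circles, so both contour integrals collapse to `[h,f]_r = ∑ H_n b_n n!/(r)_n`
(`dualityAnalytic_eq_tsum`). The series still converges when `b` decays rapidly and `H` grows
polynomially. It is continuous for the topology of `D^∞`, in which the polynomial truncations of
`f⁻` tend to `f`, so it is also the value of the extended form (`dualitySmooth_eq_tsum`). Polynomial
growth of `H` for the modular form `f₃` comes from the invariant function `|f₃| y^{r₃/2}` and
Cauchy's estimates.

The binomial series of `(1-w)^{-r}` has coefficients `(r)_n/n!`, which cancel the weights. Hence `t
↦ (z-t)^{-r}` is a reproducing kernel: pairing it with `h` gives `(-2i)^r h(z)`, and the same holds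
under suitable integrals over `z` (`dualitySmooth_integral`).

The cup product representative is an integral over `z₁` on the segment from `ρ-1` to `ρ` and `z₂` on
`(i, i∞)` of `f₁(z₁) f₂(z₂) (z₁-t)^{r₁-2} (z₂-t)^{r₂-2}`. Since `(2-r₁) + (2-r₂) = r₃`, Feynman's
parametrization (`feynman`) writes the product of the two powers as a beta average over `u ∈ (0,1)`
of `((1-u)z₁ + u z₂ - t)^{-r₃}`. The reproducing property then gives `T = (-2i)^{r₃}/B · ∫∫∫
u^{1-r₂}(1-u)^{1-r₁} f₁(z₁) f₂(z₂) f₃((1-u)z₁ + u z₂)`, where `B = B(2-r₁, 2-r₂)`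
(`trilinearForm_eq_integral`).

Finally the Fourier series are inserted and integrated termwise (`hasSum_integral_paramDensity`).
For fixed `u` the exponentials separate: the horizontal integral over a period gives the `sinc`
factor, the vertical one gives `1/(2π(μ₂+μ₃u))`, and the remaining `u`-integral is `Ψ`. Absolute
convergence holds because `z₁` and `(1-u)z₁+uz₂` stay at height at least `√3/2`, while `f₂` decays
exponentially along the vertical ray. -/

noncomputable section

namespace CupProduct

/-! ### Contour integrals over hyperbolic circles -/

/-- The disk coordinate `Z = (z - i) / (z + i)` on the upper half-plane. -/
def toDisk (z : ℂ) : ℂ := (z - I) / (z + I)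

/-- With Euclidean centre `iA` and radius squared `A² - 1`, the circle has the equation `|z|² + 1 =
2A Im z`. This forces `Im z > 0`, and it is `|z-i|² = c²|z+i|²` rearranged. -/
lemma hypCircle_spec {c : ℝ} (hc : 0 < c) (hc1 : c < 1) {z : ℂ}
    (hz : z ∈ Metric.sphere (I * (((1 + c ^ 2) / (1 - c ^ 2) : ℝ) : ℂ)) (2 * c / (1 - c ^ 2))) :
    0 < z.im ∧ ‖toDisk z‖ = c := by
  have h1 : 0 < 1 - c ^ 2 := by nlinarith
  set A : ℝ := (1 + c ^ 2) / (1 - c ^ 2) with hA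
  have hA1 : A * (1 - c ^ 2) = 1 + c ^ 2 := by rw [hA]; field_simp
  have hAR : (2 * c / (1 - c ^ 2)) ^ 2 = A ^ 2 - 1 := by rw [hA]; field_simp; ring
  have hApos : 0 < A := by positivity
  rw [mem_sphere_iff_norm] at hz
  have h2 : ‖z - I * (A : ℂ)‖ ^ 2 = A ^ 2 - 1 := by rw [hz, hAR]
  rw [← Complex.normSq_eq_norm_sq, Complex.normSq_apply] at h2
  simp only [Complex.sub_re, Complex.mul_re, Complex.I_re, Complex.I_im, Complex.ofReal_re,
    Complex.ofReal_im, Complex.sub_im, Complex.mul_im] at h2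
  have him : 0 < z.im := by
    by_contra hneg
    nlinarith [mul_nonneg hApos.le (not_lt.mp hneg |> neg_nonneg.mpr), sq_nonneg z.re,
      sq_nonneg z.im]
  refine ⟨him, ?_⟩
  have h3 : ‖z - I‖ ^ 2 = c ^ 2 * ‖z + I‖ ^ 2 := by
    rw [← Complex.normSq_eq_norm_sq, ← Complex.normSq_eq_norm_sq, Complex.normSq_apply,
      Complex.normSq_apply]
    simp only [Complex.sub_re, Complex.I_re, Complex.I_im, Complex.sub_im, Complex.add_re,
      Complex.add_im]
    have : z.re ^ 2 + z.im ^ 2 + 1 = 2 * A * z.im := by nlinarith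
    nlinarith
  have h4 : z + I ≠ 0 := by
    intro h
    have := congrArg Complex.im h
    simp at this
    linarith
  rw [toDisk, norm_div, div_eq_iff (norm_ne_zero_iff.mpr h4)]
  rw [← mul_pow] at h3
  exact (pow_left_inj₀ (norm_nonneg _) (by positivity) two_ne_zero).mp h3

lemma add_I_ne_zero {z : ℂ} (hz : 0 < z.im) : z + I ≠ 0 := by
  intro h
  have := congrArg Complex.im h
  simp at this
  linarith

/-- Thus `dz/(z+i)²` is `dZ/(2i)`, the reason for this differential in all the contour integrals. -/
lemma hasDerivAt_toDisk {z : ℂ} (hz : z + I ≠ 0) :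
    HasDerivAt toDisk (2 * I / (z + I) ^ 2) z := by
  have := ((hasDerivAt_id z).sub_const I).div ((hasDerivAt_id z).add_const I) hz
  refine this.congr_deriv ?_
  simp only [id]
  ring

lemma hypCircleIntegral_congr {c : ℝ} (hc : 0 < c) (hc1 : c < 1) {f g : ℂ → ℂ}
    (h : ∀ z : ℂ, 0 < z.im → ‖toDisk z‖ = c → f z = g z) :
    hypCircleIntegral c f = hypCircleIntegral c g := by
  have h1 : 0 < 1 - c ^ 2 := by nlinarith
  refine circleIntegral.integral_congr (by positivity) fun z hz => ?_
  obtain ⟨h2, h3⟩ := hypCircle_spec hc hc1 hz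
  exact h z h2 h3

/-- This is `∮ Z^m dZ/(2i)` around `Z = 0`. For `m ≠ -1` there is the primitive `Z^{m+1}/(2i(m+1))`.
For `m = -1` partial fractions leave the poles `i`, inside the circle, and `-i`, outside. -/
lemma hypCircleIntegral_zpow {c : ℝ} (hc : 0 < c) (hc1 : c < 1) (m : ℤ) :
    hypCircleIntegral c (fun z => toDisk z ^ m / (z + I) ^ 2) = if m = -1 then (π : ℂ) else 0 := by
  have h1 : 0 < 1 - c ^ 2 := by nlinarith
  split_ifs with hm
  · subst hm
    have hcong : hypCircleIntegral c (fun z => toDisk z ^ (-1 : ℤ) / (z + I) ^ 2) =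
        hypCircleIntegral c (fun z => (2 * I)⁻¹ * ((z - I)⁻¹ - (z + I)⁻¹)) := by
      refine hypCircleIntegral_congr hc hc1 fun z hz hzc => ?_
      have h4 := add_I_ne_zero hz
      have h5 : z - I ≠ 0 := by
        intro h
        rw [toDisk, h] at hzc
        simp at hzc
        exact hc.ne hzc
      rw [zpow_neg_one, toDisk]
      field_simp
      ring
    rw [hcong, hypCircleIntegral, circleIntegral.integral_const_mul]
    have hI : I ∈ Metric.ball (I * (((1 + c ^ 2) / (1 - c ^ 2) : ℝ) : ℂ)) (2 * c / (1 - c ^ 2)) := by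
      rw [mem_ball_iff_norm]
      have : I - I * (((1 + c ^ 2) / (1 - c ^ 2) : ℝ) : ℂ) =
          I * ((1 - (1 + c ^ 2) / (1 - c ^ 2) : ℝ) : ℂ) := by push_cast; ring
      rw [this, norm_mul, Complex.norm_I, one_mul, Complex.norm_real, Real.norm_eq_abs, abs_lt]
      have e : 1 - (1 + c ^ 2) / (1 - c ^ 2) = -(2 * c ^ 2) / (1 - c ^ 2) := by field_simp; ring
      rw [e, ← neg_div]
      constructor
      · apply div_lt_div_of_pos_right _ h1; nlinarith
      · apply div_lt_div_of_pos_right _ h1; nlinarith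
    have hd : DiffContOnCl ℂ (fun z => (z + I)⁻¹)
        (Metric.ball (I * (((1 + c ^ 2) / (1 - c ^ 2) : ℝ) : ℂ)) (2 * c / (1 - c ^ 2))) := by
      apply DifferentiableOn.diffContOnCl
      intro z hz
      have hz' := Metric.closure_ball_subset_closedBall hz
      have : z + I ≠ 0 := by
        intro h
        have hzI : z = -I := by linear_combination h
        rw [mem_closedBall_iff_norm, hzI] at hz'
        have e : -I - I * (((1 + c ^ 2) / (1 - c ^ 2) : ℝ) : ℂ) =
          -I * ((1 + (1 + c ^ 2) / (1 - c ^ 2) : ℝ) : ℂ) := by push_cast; ring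
        have e2 : 1 + (1 + c ^ 2) / (1 - c ^ 2) = 2 / (1 - c ^ 2) := by field_simp; ring
        rw [e, norm_mul, norm_neg, Complex.norm_I, one_mul, Complex.norm_real, e2,
          Real.norm_of_nonneg (by positivity), div_le_div_iff_of_pos_right h1] at hz'
        linarith
      exact (((differentiableAt_id).add_const I).inv this).differentiableWithinAt
    have hne : ∀ z ∈ Metric.sphere (I * (((1 + c ^ 2) / (1 - c ^ 2) : ℝ) : ℂ))
        (2 * c / (1 - c ^ 2)), z - I ≠ 0 ∧ z + I ≠ 0 := by
      intro z hz
      obtain ⟨h2, h3⟩ := hypCircle_spec hc hc1 hz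
      refine ⟨fun h => ?_, add_I_ne_zero h2⟩
      rw [toDisk, h] at h3
      simp at h3
      exact hc.ne h3
    rw [circleIntegral.integral_sub, circleIntegral.integral_sub_inv_of_mem_ball hI,
      hd.circleIntegral_eq_zero (by positivity)]
    · field_simp; simp
    · apply ContinuousOn.circleIntegrable (by positivity)
      exact (continuousOn_id.sub continuousOn_const).inv₀ fun z hz => (hne z hz).1
    · apply ContinuousOn.circleIntegrable (by positivity)
      exact (continuousOn_id.add continuousOn_const).inv₀ fun z hz => (hne z hz).2
  · have hm' : ((m : ℂ) + 1) ≠ 0 := by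
      intro h
      apply hm
      have : ((m + 1 : ℤ) : ℂ) = 0 := by push_cast; exact h
      have := Int.cast_eq_zero.mp this
      omega
    refine circleIntegral.integral_eq_zero_of_hasDerivWithinAt
      (f := fun z => ((m : ℂ) + 1)⁻¹ * (2 * I)⁻¹ * toDisk z ^ (m + 1)) (by positivity) fun z hz => ?_
    obtain ⟨h2, h3⟩ := hypCircle_spec hc hc1 hz
    have hz0 : toDisk z ≠ 0 := by
      rw [← norm_pos_iff, h3]; exact hc
    have := ((hasDerivAt_zpow (m + 1) (toDisk z) (Or.inl hz0)).comp z
      (hasDerivAt_toDisk (add_I_ne_zero h2))).const_mul (((m : ℂ) + 1)⁻¹ * (2 * I)⁻¹)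
    refine (this.congr_deriv ?_).hasDerivWithinAt
    have h4 := add_I_ne_zero h2
    push_cast
    rw [add_sub_cancel_right]
    field_simp [Complex.I_ne_zero]

lemma hasSum_mul_of_summable_norm {ι κ : Type*} {f : ι → ℂ} {g : κ → ℂ}
    (hf : Summable fun i => ‖f i‖) (hg : Summable fun k => ‖g k‖) :
    HasSum (fun p : ι × κ => f p.1 * g p.2) ((∑' i, f i) * ∑' k, g k) := by
  have hs : Summable (fun p : ι × κ => f p.1 * g p.2) := summable_mul_of_summable_norm hf hg
  have hf' : HasSum f (∑' i, f i) := hf.of_norm.hasSum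
  have hg' : HasSum g (∑' i, g i) := hg.of_norm.hasSum
  exact hf'.mul hg' hs

/-- Orthogonality: the contour integral of a product of power series in `Z` and in `Z⁻¹`. -/
lemma hypCircleIntegral_mul_tsum {c : ℝ} (hc : 0 < c) (hc1 : c < 1) {A B : ℕ → ℂ}
    (hA : Summable fun n => ‖A n‖ * c ^ n) (hB : Summable fun n => ‖B n‖ * (c⁻¹) ^ n) :
    hypCircleIntegral c (fun z => (∑' n, A n * toDisk z ^ n) * (∑' n, B n * (toDisk z)⁻¹ ^ n) *
      (toDisk z)⁻¹ / (z + I) ^ 2) = π * ∑' n, A n * B n := by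
  have h1 : 0 < 1 - c ^ 2 := by nlinarith
  set z₀ : ℂ := I * (((1 + c ^ 2) / (1 - c ^ 2) : ℝ) : ℂ) with hz₀
  set R : ℝ := 2 * c / (1 - c ^ 2) with hR
  have hR0 : 0 ≤ R := by positivity
  have hAB : Summable fun p : ℕ × ℕ => (‖A p.1‖ * c ^ p.1) * (‖B p.2‖ * (c⁻¹) ^ p.2) :=
    hA.mul_of_nonneg hB (fun _ => by positivity) (fun _ => by positivity)
  have hspec : ∀ θ, 0 < (circleMap z₀ R θ).im ∧ ‖toDisk (circleMap z₀ R θ)‖ = c := fun θ =>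
    hypCircle_spec hc hc1 (circleMap_mem_sphere z₀ hR0 θ)
  have hcont : Continuous fun θ => toDisk (circleMap z₀ R θ) := by
    unfold toDisk
    refine ((continuous_circleMap z₀ R).sub continuous_const).div
      ((continuous_circleMap z₀ R).add continuous_const) fun θ => add_I_ne_zero (hspec θ).1
  have hne : ∀ θ, toDisk (circleMap z₀ R θ) ≠ 0 := fun θ => by
    rw [← norm_pos_iff, (hspec θ).2]; exact hc
  -- The product of the two series is integrated termwise over pairs of indices; only the diagonal
  -- pairs have residue exponent `-1` and survive.
  have hsum := intervalIntegral.hasSum_integral_of_dominated_convergence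
    (μ := MeasureTheory.volume) (a := 0) (b := 2 * π)
    (F := fun (p : ℕ × ℕ) θ => deriv (circleMap z₀ R) θ •
      ((A p.1 * toDisk (circleMap z₀ R θ) ^ p.1) * (B p.2 * (toDisk (circleMap z₀ R θ))⁻¹ ^ p.2) *
      (toDisk (circleMap z₀ R θ))⁻¹ / (circleMap z₀ R θ + I) ^ 2))
    (f := fun θ => deriv (circleMap z₀ R) θ •
      ((∑' n, A n * toDisk (circleMap z₀ R θ) ^ n) *
        (∑' n, B n * (toDisk (circleMap z₀ R θ))⁻¹ ^ n) *
      (toDisk (circleMap z₀ R θ))⁻¹ / (circleMap z₀ R θ + I) ^ 2))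
    (fun p _ => R * ((‖A p.1‖ * c ^ p.1) * (‖B p.2‖ * (c⁻¹) ^ p.2) * c⁻¹)) ?_ ?_ ?_ ?_ ?_
  · have hint : ∀ p : ℕ × ℕ, (∫ θ in (0 : ℝ)..2 * π, deriv (circleMap z₀ R) θ •
      ((A p.1 * toDisk (circleMap z₀ R θ) ^ p.1) * (B p.2 * (toDisk (circleMap z₀ R θ))⁻¹ ^ p.2) *
      (toDisk (circleMap z₀ R θ))⁻¹ / (circleMap z₀ R θ + I) ^ 2)) =
        if p.1 = p.2 then π * (A p.1 * B p.2) else 0 := by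
      intro p
      have h2 := hypCircleIntegral_zpow hc hc1 ((p.1 : ℤ) - p.2 - 1)
      have h3 : (∫ θ in (0 : ℝ)..2 * π, deriv (circleMap z₀ R) θ •
        ((A p.1 * toDisk (circleMap z₀ R θ) ^ p.1) * (B p.2 * (toDisk (circleMap z₀ R θ))⁻¹ ^ p.2) *
        (toDisk (circleMap z₀ R θ))⁻¹ / (circleMap z₀ R θ + I) ^ 2)) =
        (A p.1 * B p.2) *
          hypCircleIntegral c (fun z => toDisk z ^ ((p.1 : ℤ) - p.2 - 1) / (z + I) ^ 2) := by
        rw [hypCircleIntegral, ← circleIntegral.integral_const_mul]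
        simp only [circleIntegral]
        congr 1
        ext θ
        rw [zpow_sub₀ (hne θ), zpow_sub₀ (hne θ)]
        simp only [smul_eq_mul, zpow_natCast, zpow_one, inv_pow]
        ring
      rw [h3, h2]
      have : ((p.1 : ℤ) - p.2 - 1 = -1) ↔ p.1 = p.2 := by omega
      simp only [this]
      split_ifs <;> ring
    simp only [hint] at hsum
    rw [hypCircleIntegral, circleIntegral, ← hsum.tsum_eq, hsum.summable.tsum_prod, ← tsum_mul_left]
    refine tsum_congr fun n => ?_
    rw [tsum_eq_single n]
    · simp
    · intro m hm
      simp [hm.symm]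
  · intro p
    apply Continuous.aestronglyMeasurable
    simp only [deriv_circleMap, smul_eq_mul]
    refine Continuous.mul (by fun_prop) (Continuous.div ?_ ?_ ?_)
    · exact ((continuous_const.mul (hcont.pow _)).mul
        (continuous_const.mul ((hcont.inv₀ hne).pow _))).mul (hcont.inv₀ hne)
    · exact ((continuous_circleMap z₀ R).add continuous_const).pow 2
    · exact fun θ => pow_ne_zero 2 (add_I_ne_zero (hspec θ).1)
  · refine fun p => Filter.Eventually.of_forall fun θ _ => ?_
    -- Lets the denominator `(z+i)²` be dropped from the majorant.
    have h5 : 1 ≤ ‖circleMap z₀ R θ + I‖ := by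
      have := Complex.abs_im_le_norm (circleMap z₀ R θ + I)
      simp only [Complex.add_im, Complex.I_im] at this
      have h6 := (hspec θ).1
      rw [abs_of_pos (by linarith)] at this
      linarith
    rw [norm_smul, norm_div, norm_mul, norm_mul, norm_mul, norm_mul, norm_pow, norm_pow, norm_inv,
      norm_pow, (hspec θ).2]
    have h6 : ‖deriv (circleMap z₀ R) θ‖ = R := by
      simp [deriv_circleMap, abs_of_nonneg hR0]
    rw [h6]
    refine mul_le_mul_of_nonneg_left ?_ hR0
    exact div_le_self (by positivity) (one_le_pow₀ h5)
  · exact Filter.Eventually.of_forall fun θ _ => (hAB.mul_right _).mul_left _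
  · exact intervalIntegrable_const
  · refine Filter.Eventually.of_forall fun θ _ => ?_
    have hA' : Summable fun n => ‖A n * toDisk (circleMap z₀ R θ) ^ n‖ := by
      simpa only [norm_mul, norm_pow, (hspec θ).2] using hA
    have hB' : Summable fun n => ‖B n * (toDisk (circleMap z₀ R θ))⁻¹ ^ n‖ := by
      simpa only [norm_mul, norm_pow, norm_inv, (hspec θ).2] using hB
    have := hasSum_mul_of_summable_norm hA' hB'
    simp only [smul_eq_mul]
    exact ((this.mul_right _).div_const _).mul_left _

/-! ### The duality in terms of Taylor coefficients -/

/-- The weights `n! / (r)_n` of the duality. -/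
def dualWeight (r : ℝ) (n : ℕ) : ℝ := n.factorial / (ascPochhammer ℝ n).eval r

lemma dualWeight_pos {r : ℝ} (hr : 0 < r) (n : ℕ) : 0 < dualWeight r n :=
  div_pos (by positivity) (ascPochhammer_pos n r hr)

lemma dualWeight_succ {r : ℝ} (hr : 0 < r) (n : ℕ) :
    dualWeight r (n + 1) = dualWeight r n * ((n + 1) / (r + n)) := by
  have h := (ascPochhammer_pos n r hr).ne'
  have h2 : r + n ≠ 0 := by positivity
  rw [dualWeight, dualWeight, ascPochhammer_succ_eval, Nat.factorial_succ]
  push_cast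
  field_simp

/-- The induction closes because `1 + n/r = (r+n)/r` cancels the denominator of the next ratio
`(n+1)/(r+n)`. -/
lemma dualWeight_le {r : ℝ} (hr : 0 < r) (n : ℕ) : dualWeight r n ≤ 1 + n / r := by
  induction n with
  | zero => simp [dualWeight]
  | succ n ih =>
    rw [dualWeight_succ hr]
    have h2 : 0 < r + n := by positivity
    calc dualWeight r n * ((n + 1) / (r + n)) ≤ (1 + n / r) * ((n + 1) / (r + n)) := by gcongr
      _ = (n + 1) / r := by field_simp
      _ ≤ 1 + ((n + 1 : ℕ) : ℝ) / r := by push_cast; linarith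

lemma dualWeight_le_mul {r : ℝ} (hr : 0 < r) (n : ℕ) :
    dualWeight r n ≤ (1 + 1 / r) * (n + 1) := by
  refine (dualWeight_le hr n).trans ?_
  have : 0 < 1 / r := by positivity
  have h2 : (0 : ℝ) ≤ n := by positivity
  have h3 : (n : ℝ) / r = 1 / r * n := by ring
  rw [h3]
  nlinarith

/-- By Bernoulli each ratio satisfies `(r+n)/(n+1) ≤ 1 + M/(n+1) ≤ ((n+2)/(n+1))^M`, and the last
bounds telescope. -/
lemma inv_dualWeight_le {r : ℝ} (hr : 0 < r) {M : ℕ} (hM : r ≤ M) (n : ℕ) :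
    (dualWeight r n)⁻¹ ≤ ((n : ℝ) + 1) ^ M := by
  induction n with
  | zero => simp [dualWeight]
  | succ n ih =>
    rw [dualWeight_succ hr, mul_inv, inv_div]
    have h1 : (0 : ℝ) < (n : ℝ) + 1 := by positivity
    have h0 : 0 < 1 / ((n : ℝ) + 1) := by positivity
    have hB := one_add_mul_le_pow (a := 1 / ((n : ℝ) + 1)) (by linarith) M
    have h3 : (r + n) / (n + 1) ≤ (1 + 1 / ((n : ℝ) + 1)) ^ M := by
      refine le_trans ?_ hB
      rw [div_le_iff₀ h1]
      have : (1 + (M : ℝ) * (1 / (n + 1))) * (n + 1) = n + 1 + M := by field_simp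
      rw [this]
      linarith
    calc (dualWeight r n)⁻¹ * ((r + n) / (n + 1))
        ≤ ((n : ℝ) + 1) ^ M * (1 + 1 / ((n : ℝ) + 1)) ^ M := by
          apply mul_le_mul ih h3 (by positivity) (by positivity)
      _ = (((n + 1 : ℕ) : ℝ) + 1) ^ M := by
          rw [← mul_pow]
          congr 1
          push_cast
          field_simp

/-- Both upper parameters contribute `(1)_n = n!`, one of which cancels the `n!` of the
hypergeometric series. -/
lemma ordinaryHypergeometric_one_one (r : ℝ) (x : ℂ) :
    ordinaryHypergeometric (1 : ℂ) 1 (r : ℂ) x = ∑' n, (dualWeight r n : ℂ) * x ^ n := by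
  rw [ordinaryHypergeometric_eq_tsum]
  refine tsum_congr fun n => ?_
  have h : (ascPochhammer ℂ n).eval (r : ℂ) = (((ascPochhammer ℝ n).eval r : ℝ) : ℂ) := by
    rw [← ascPochhammer_map (algebraMap ℝ ℂ), Polynomial.eval_map_algebraMap]
    exact Polynomial.aeval_algebraMap_apply_eq_algebraMap_eval r _
  have hn : (n.factorial : ℂ) ≠ 0 := by exact_mod_cast n.factorial_ne_zero
  rw [ascPochhammer_eval_one, h, dualWeight, smul_eq_mul]
  push_cast
  field_simp

lemma summable_dualWeight_mul_pow {r : ℝ} (hr : 0 < r) {q : ℝ} (hq0 : 0 ≤ q) (hq : q < 1) :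
    Summable fun n => dualWeight r n * q ^ n := by
  have h1 : Summable fun n : ℕ => (n : ℝ) ^ 1 * q ^ n :=
    summable_pow_mul_geometric_of_norm_lt_one 1 (by rwa [Real.norm_of_nonneg hq0])
  have h2 := ((summable_geometric_of_lt_one hq0 hq).add (h1.mul_left (1 / r)))
  refine Summable.of_nonneg_of_le (fun n => mul_nonneg (dualWeight_pos hr n).le (by positivity))
    (fun n => ?_) h2
  calc dualWeight r n * q ^ n ≤ (1 + n / r) * q ^ n := by
        have := dualWeight_le hr n; gcongr
    _ = q ^ n + 1 / r * ((n : ℝ) ^ 1 * q ^ n) := by ring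

/-- The inverse `Z ↦ i (1 + Z) / (1 - Z)` of `toDisk`. -/
def ofDisk (Z : ℂ) : ℂ := I * (1 + Z) / (1 - Z)

/-- The function `h⁺(z) = (-i - z)^r h(z)` in terms of the disk coordinate. -/
def upperModel (r : ℝ) (h : ℂ → ℂ) (Z : ℂ) : ℂ := (-I - ofDisk Z) ^ (r : ℂ) * h (ofDisk Z)

lemma ofDisk_toDisk {z : ℂ} (hz : z + I ≠ 0) : ofDisk (toDisk z) = z := by
  have h1 : 1 - toDisk z = 2 * I / (z + I) := by
    rw [toDisk]; field_simp; ring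
  have h2 : 1 + toDisk z = 2 * z / (z + I) := by
    rw [toDisk]; field_simp; ring
  rw [ofDisk, h1, h2]
  field_simp [Complex.I_ne_zero]

lemma toDisk_norm_lt_one {z : ℂ} (hz : 0 < z.im) : ‖toDisk z‖ < 1 := by
  have h := add_I_ne_zero hz
  rw [toDisk, norm_div, div_lt_one (norm_pos_iff.mpr h)]
  rw [← sq_lt_sq₀ (norm_nonneg _) (norm_nonneg _), ← Complex.normSq_eq_norm_sq,
    ← Complex.normSq_eq_norm_sq, Complex.normSq_apply, Complex.normSq_apply]
  simp only [Complex.sub_re, Complex.I_re, Complex.I_im, Complex.sub_im, Complex.add_re,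
    Complex.add_im]
  nlinarith

lemma summable_norm_of_hasSum_pow {b : ℕ → ℂ} {q : ℝ} (hq : 0 ≤ q) {s : ℂ}
    (h : HasSum (fun n => b n * (q : ℂ) ^ n) s) : Summable fun n => ‖b n‖ * q ^ n := by
  have := h.summable.norm
  simpa [norm_mul, norm_pow, abs_of_nonneg hq] using this

/-- On the inner circle the kernel is a power series in `Z(τ)/Z(z)`, convergent since `c₁ < |Z(z)|`,
and `F` is one in `x = Z(τ)⁻¹`, of modulus `1/c₁ < 1/c`. Orthogonality pairs them: `σ_r` multiplies
the `n`-th coefficient by `n!/(r)_n`. -/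
lemma sigmaOp_eq_tsum {r : ℝ} (hr : 0 < r) {F : ℂ → ℂ} {b : ℕ → ℂ} {c c₁ : ℝ} (hc : 0 < c)
    (hc₁ : c < c₁) (hF : ∀ x ∈ Metric.ball (0 : ℂ) c⁻¹, HasSum (fun n => b n * x ^ n) (F x))
    {z : ℂ} (hz : 0 < z.im) (hzc : c₁ < ‖toDisk z‖) :
    sigmaOp r F c₁ z = (toDisk z)⁻¹ * ∑' n, b n * dualWeight r n * (toDisk z)⁻¹ ^ n := by
  have hc₁0 : 0 < c₁ := hc.trans hc₁
  have hc₁1 : c₁ < 1 := hzc.trans (toDisk_norm_lt_one hz)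
  have hZ : 0 < ‖toDisk z‖ := hc₁0.trans hzc
  have hzI : z + I ≠ 0 := add_I_ne_zero hz
  have hzI' : z - I ≠ 0 := by
    intro h; rw [toDisk, h] at hZ; simp at hZ
  have hball : ∀ x : ℂ, ‖x‖ = c₁⁻¹ → x ∈ Metric.ball (0 : ℂ) c⁻¹ := by
    intro x hx
    rw [mem_ball_zero_iff, hx]
    exact inv_strictAnti₀ hc hc₁
  have hb : Summable fun n => ‖b n‖ * (c₁⁻¹) ^ n :=
    summable_norm_of_hasSum_pow (by positivity) (hF ((c₁⁻¹ : ℝ) : ℂ) (hball _ (by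
      rw [Complex.norm_real, Real.norm_of_nonneg (by positivity)])))
  have hw : Summable fun n => ‖(dualWeight r n : ℂ) * (toDisk z)⁻¹ ^ n‖ * c₁ ^ n := by
    have := summable_dualWeight_mul_pow hr (q := c₁ / ‖toDisk z‖) (by positivity)
      ((div_lt_one hZ).mpr hzc)
    refine this.congr fun n => ?_
    rw [norm_mul, norm_pow, norm_inv, Complex.norm_real,
      Real.norm_of_nonneg (dualWeight_pos hr n).le, div_pow, inv_pow]
    ring
  have key := hypCircleIntegral_mul_tsum hc₁0 hc₁1 hw hb
  have h1 : hypCircleIntegral c₁ (fun τ => F ((τ + I) / (τ - I)) *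
      ordinaryHypergeometric (1 : ℂ) 1 (r : ℂ) ((τ - I) * (z + I) / ((τ + I) * (z - I))) /
        (τ ^ 2 + 1)) = hypCircleIntegral c₁ (fun τ =>
      (∑' n, (dualWeight r n : ℂ) * (toDisk z)⁻¹ ^ n * toDisk τ ^ n) *
        (∑' n, b n * (toDisk τ)⁻¹ ^ n) * (toDisk τ)⁻¹ / (τ + I) ^ 2) := by
    refine hypCircleIntegral_congr hc₁0 hc₁1 fun τ hτ hτc => ?_
    have e1 : (τ + I) / (τ - I) = (toDisk τ)⁻¹ := by rw [toDisk, inv_div]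
    have e2 : (τ - I) * (z + I) / ((τ + I) * (z - I)) = (toDisk z)⁻¹ * toDisk τ := by
      rw [toDisk, toDisk, inv_div]
      field_simp
    have hτI := add_I_ne_zero hτ
    have hτI' : τ - I ≠ 0 := by
      intro h; rw [toDisk, h] at hτc; simp at hτc; exact hc₁0.ne hτc
    have e3 : (τ ^ 2 + 1) = (τ + I) * (τ - I) := by
      linear_combination Complex.I_sq
    rw [e1, e2, ordinaryHypergeometric_one_one, e3,
      (hF (toDisk τ)⁻¹ (hball _ (by rw [norm_inv, hτc]))).tsum_eq]
    simp only [mul_pow, mul_assoc]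
    rw [toDisk]
    field_simp
  rw [sigmaOp, h1, key, toDisk, inv_div]
  have hπ : (π : ℂ) ≠ 0 := by exact_mod_cast Real.pi_ne_zero
  rw [mul_assoc, mul_comm (1 / (π : ℂ)), mul_assoc]
  congr 1
  rw [mul_comm, ← mul_assoc, one_div, mul_assoc, mul_left_comm]
  field_simp
  refine tsum_congr fun n => ?_
  ring

lemma dualityIntegral_eq_tsum {r : ℝ} (hr : 0 < r) {h F : ℂ → ℂ} {H b : ℕ → ℂ} {c c₁ c₂ : ℝ}
    (hc : 0 < c) (hc₁ : c < c₁) (hc₂ : c₁ < c₂) (hc₂1 : c₂ < 1)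
    (hF : ∀ x ∈ Metric.ball (0 : ℂ) c⁻¹, HasSum (fun n => b n * x ^ n) (F x))
    (hH : ∀ Z ∈ Metric.ball (0 : ℂ) 1, HasSum (fun n => H n * Z ^ n) (upperModel r h Z)) :
    dualityIntegral r h F c₁ c₂ = ∑' n, H n * (b n * dualWeight r n) := by
  have hc₁0 : 0 < c₁ := hc.trans hc₁
  have hc₂0 : 0 < c₂ := hc₁0.trans hc₂
  have hHs : Summable fun n => ‖H n‖ * c₂ ^ n :=
    summable_norm_of_hasSum_pow hc₂0.le (hH (c₂ : ℂ) (by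
      rwa [mem_ball_zero_iff, Complex.norm_real, Real.norm_of_nonneg hc₂0.le]))
  have hbs : Summable fun n => ‖b n * dualWeight r n‖ * (c₂⁻¹) ^ n := by
    have hb : Summable fun n => ‖b n‖ * (c₁⁻¹) ^ n :=
      summable_norm_of_hasSum_pow (by positivity) (hF ((c₁⁻¹ : ℝ) : ℂ) (by
        rw [mem_ball_zero_iff, Complex.norm_real, Real.norm_of_nonneg (by positivity)]
        exact inv_strictAnti₀ hc hc₁))
    -- The weights are absorbed by the gap between the circles: `n!/(r)_n · (c₁/c₂)^n` is bounded,
    -- so summability at radius `1/c₁` passes to the weighted series at radius `1/c₂`.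
    have hw := summable_dualWeight_mul_pow hr (q := c₁ / c₂) (by positivity)
      ((div_lt_one hc₂0).mpr hc₂)
    have hbd := hw.tendsto_atTop_zero.bddAbove_range
    obtain ⟨C, hC⟩ := hbd
    refine Summable.of_nonneg_of_le (fun n => by positivity) (fun n => ?_) (hb.mul_left C)
    have h1 := hC (Set.mem_range_self n)
    rw [norm_mul, Complex.norm_real, Real.norm_of_nonneg (dualWeight_pos hr n).le]
    calc ‖b n‖ * dualWeight r n * c₂⁻¹ ^ n
        = (dualWeight r n * (c₁ / c₂) ^ n) * (‖b n‖ * c₁⁻¹ ^ n) := by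
          rw [div_pow, inv_pow, inv_pow]; field_simp
      _ ≤ C * (‖b n‖ * c₁⁻¹ ^ n) := by gcongr
  have key := hypCircleIntegral_mul_tsum hc₂0 hc₂1 hHs hbs
  have h1 : hypCircleIntegral c₂ (fun z => (-I - z) ^ (r : ℂ) * h z * sigmaOp r F c₁ z /
      (z + I) ^ 2) = hypCircleIntegral c₂ (fun z =>
      (∑' n, H n * toDisk z ^ n) * (∑' n, b n * dualWeight r n * (toDisk z)⁻¹ ^ n) *
        (toDisk z)⁻¹ / (z + I) ^ 2) := by
    refine hypCircleIntegral_congr hc₂0 hc₂1 fun z hz hzc => ?_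
    rw [sigmaOp_eq_tsum hr hc hc₁ hF hz (by rwa [hzc]),
      (hH (toDisk z) (by rw [mem_ball_zero_iff]; exact toDisk_norm_lt_one hz)).tsum_eq,
      upperModel, ofDisk_toDisk (add_I_ne_zero hz)]
    ring
  have hπ : (π : ℂ) ≠ 0 := by exact_mod_cast Real.pi_ne_zero
  rw [dualityIntegral, h1, key, one_div, inv_mul_cancel_left₀ hπ]

/-- The Taylor coefficients at `0` of `f⁻` in the disk coordinate. -/
def diskCoeff (r : ℝ) (f : ℂ → ℂ) (n : ℕ) : ℂ :=
  (n.factorial : ℂ)⁻¹ * iteratedDeriv n (diskModel r f) 0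

/-- The coefficients are derivatives of `f⁻` at `0`, hence the same for every choice of the
extension `F`. -/
lemma IsHoloExtension.hasSum {r c : ℝ} {f F : ℂ → ℂ} (hF : IsHoloExtension r f F c) {x : ℂ}
    (hx : x ∈ Metric.ball (0 : ℂ) c⁻¹) : HasSum (fun n => diskCoeff r f n * x ^ n) (F x) := by
  have h := Complex.hasSum_taylorSeries_on_ball hF.1 hx
  have hev : F =ᶠ[𝓝 0] diskModel r f :=
    Filter.eventually_of_mem (Metric.ball_mem_nhds 0 one_pos) hF.2
  have e : (fun n => diskCoeff r f n * x ^ n) =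
      fun n => (n.factorial : ℂ)⁻¹ • (x - 0) ^ n • iteratedDeriv n F 0 := by
    ext n
    rw [diskCoeff, hev.iteratedDeriv_eq, smul_eq_mul, smul_eq_mul, sub_zero]
    ring
  rw [e]
  exact h

/-- The coefficients `H` of the power series of `h⁺` in the disk coordinate. -/
def HasUpperExpansion (r : ℝ) (h : ℂ → ℂ) (H : ℕ → ℂ) : Prop :=
  ∀ Z ∈ Metric.ball (0 : ℂ) 1, HasSum (fun n => H n * Z ^ n) (upperModel r h Z)

/-- All admissible extensions and pairs of circles give this same sum, so the value chosen by
`epsilon` is determined. -/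
lemma dualityAnalytic_eq_tsum {r : ℝ} (hr : 0 < r) {h f : ℂ → ℂ} {H : ℕ → ℂ}
    (hH : HasUpperExpansion r h H) (hf : IsAnalyticVector r f) :
    dualityAnalytic r h f = ∑' n, H n * (diskCoeff r f n * dualWeight r n) := by
  obtain ⟨F₀, d, hd0, hd1, hF₀⟩ := hf
  have hex : ∃ v : ℂ, ∃ (F : ℂ → ℂ) (c c₁ c₂ : ℝ),
    0 < c ∧ c < c₁ ∧ c₁ < c₂ ∧ c₂ < 1 ∧ IsHoloExtension r f F c ∧
      v = dualityIntegral r h F c₁ c₂ :=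
    ⟨_, F₀, d, d + (1 - d) / 3, d + 2 * (1 - d) / 3, hd0, by linarith, by linarith, by linarith,
      hF₀, rfl⟩
  obtain ⟨F, c, c₁, c₂, hc, hc₁, hc₂, hc₂1, hF, hv⟩ := Classical.epsilon_spec hex
  rw [dualityAnalytic, hv]
  exact dualityIntegral_eq_tsum hr hc hc₁ hc₂ hc₂1 (fun x hx => hF.hasSum hx) hH

/-! ### Rapidly decaying expansions and smooth vectors -/

/-- Sequences that decay faster than every power of `n`. -/
def RapidDecay (b : ℕ → ℂ) : Prop := ∀ k : ℕ, Summable fun n => ‖b n‖ * ((n : ℝ) + 1) ^ k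

/-- The power series of `f⁻` in the disk coordinate has the rapidly decaying coefficients `b`. -/
def HasRapidExpansion (r : ℝ) (f : ℂ → ℂ) (b : ℕ → ℂ) : Prop :=
  RapidDecay b ∧ ∀ x ∈ Metric.ball (0 : ℂ) 1, HasSum (fun n => b n * x ^ n) (diskModel r f x)

/-- The series `∑ b(n) e^{i n θ}`. -/
def trigSeries (b : ℕ → ℂ) (θ : ℝ) : ℂ := ∑' n : ℕ, b n * Complex.exp (n * θ * I)

lemma RapidDecay.summable_norm {b : ℕ → ℂ} (hb : RapidDecay b) : Summable fun n => ‖b n‖ := by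
  simpa using hb 0

lemma RapidDecay.sub {a b : ℕ → ℂ} (ha : RapidDecay a) (hb : RapidDecay b) :
    RapidDecay fun n => a n - b n := fun k =>
  Summable.of_nonneg_of_le (fun _ => by positivity)
    (fun n => by
      rw [← add_mul]
      exact mul_le_mul_of_nonneg_right (norm_sub_le _ _) (by positivity)) ((ha k).add (hb k))

lemma RapidDecay.deriv {b : ℕ → ℂ} (hb : RapidDecay b) :
    RapidDecay fun n => ((n : ℂ) * I) * b n := fun k =>
  Summable.of_nonneg_of_le (fun _ => by positivity)
    (fun n => by
      rw [norm_mul, norm_mul, Complex.norm_I, mul_one, Complex.norm_natCast, pow_succ]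
      have : (n : ℝ) ≤ n + 1 := by linarith
      calc (n : ℝ) * ‖b n‖ * ((n : ℝ) + 1) ^ k ≤ (n + 1) * ‖b n‖ * ((n : ℝ) + 1) ^ k := by gcongr
        _ = ‖b n‖ * (((n : ℝ) + 1) ^ k * (n + 1)) := by ring) (hb (k + 1))

lemma RapidDecay.deriv_iterate {b : ℕ → ℂ} (hb : RapidDecay b) (N : ℕ) :
    RapidDecay fun n => ((n : ℂ) * I) ^ N * b n := by
  induction N with
  | zero => simpa using hb
  | succ N ih =>
    have := ih.deriv
    simpa only [pow_succ', mul_assoc] using this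

lemma norm_exp_nat_mul (n : ℕ) (θ : ℝ) : ‖Complex.exp (n * θ * I)‖ = 1 := by
  rw [← Complex.norm_exp_ofReal_mul_I (n * θ)]
  push_cast
  rfl

lemma summable_trigSeries {b : ℕ → ℂ} (hb : Summable fun n => ‖b n‖) (θ : ℝ) :
    Summable fun n : ℕ => b n * Complex.exp (n * θ * I) := by
  apply Summable.of_norm
  simpa only [norm_mul, norm_exp_nat_mul, mul_one] using hb

lemma hasDerivAt_trigSeries {b : ℕ → ℂ} (hb : RapidDecay b) (θ : ℝ) :
    HasDerivAt (trigSeries b) (trigSeries (fun n => ((n : ℂ) * I) * b n) θ) θ := by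
  refine hasDerivAt_tsum (𝕜 := ℝ) (y₀ := 0) hb.deriv.summable_norm
    (g := fun (n : ℕ) (θ : ℝ) => b n * Complex.exp (n * θ * I))
    (g' := fun (n : ℕ) (θ : ℝ) => ((n : ℂ) * I) * b n * Complex.exp (n * θ * I))
    (fun n y => ?_) (fun n y => ?_) (summable_trigSeries hb.summable_norm 0) θ
  · have h1 : HasDerivAt (fun y : ℝ => (n : ℂ) * (y : ℂ) * I) ((n : ℂ) * 1 * I) y :=
      ((Complex.ofRealCLM.hasDerivAt (x := y)).const_mul (n : ℂ)).mul_const I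
    refine (h1.cexp.const_mul (b n)).congr_deriv ?_
    ring
  · simp only [norm_mul, norm_exp_nat_mul, mul_one, le_refl]

lemma iteratedDeriv_trigSeries {b : ℕ → ℂ} (hb : RapidDecay b) (N : ℕ) :
    iteratedDeriv N (trigSeries b) = trigSeries fun n => ((n : ℂ) * I) ^ N * b n := by
  induction N with
  | zero => simp
  | succ N ih =>
    rw [iteratedDeriv_succ, ih]
    ext θ
    rw [(hasDerivAt_trigSeries (hb.deriv_iterate N) θ).deriv]
    simp only [pow_succ', mul_assoc]

lemma trigSeries_sub {a b : ℕ → ℂ} (ha : Summable fun n => ‖a n‖) (hb : Summable fun n => ‖b n‖)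
    (θ : ℝ) : trigSeries a θ - trigSeries b θ = trigSeries (fun n => a n - b n) θ := by
  rw [trigSeries, trigSeries, trigSeries,
    ← (summable_trigSeries ha θ).tsum_sub (summable_trigSeries hb θ)]
  simp only [sub_mul]

lemma norm_trigSeries_le {b : ℕ → ℂ} (hb : Summable fun n => ‖b n‖) (θ : ℝ) :
    ‖trigSeries b θ‖ ≤ ∑' n, ‖b n‖ := by
  have h : ∀ n : ℕ, ‖b n * Complex.exp (n * θ * I)‖ = ‖b n‖ := fun n => by
    rw [norm_mul, norm_exp_nat_mul, mul_one]
  have := norm_tsum_le_tsum_norm (f := fun n : ℕ => b n * Complex.exp (n * θ * I))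
    (by simpa only [h] using hb)
  simp only [h] at this
  exact this

/-- Since `∑ ‖b n‖` converges, the power series converges uniformly on the closed disk and is
continuous up to the circle. -/
lemma HasRapidExpansion.boundaryValue_eq {r : ℝ} {f : ℂ → ℂ} {b : ℕ → ℂ}
    (h : HasRapidExpansion r f b) : boundaryValue r f = trigSeries b := by
  ext θ
  have hmem : Complex.exp (θ * I) ∈ Metric.closedBall (0 : ℂ) 1 := by
    simp [Complex.norm_exp_ofReal_mul_I]
  have hcont : ContinuousOn (fun x : ℂ => ∑' n, b n * x ^ n) (Metric.closedBall 0 1) := by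
    refine continuousOn_tsum (u := fun n => ‖b n‖) (fun n => by fun_prop) h.1.summable_norm
      fun n x hx => ?_
    rw [norm_mul, norm_pow]
    exact mul_le_of_le_one_right (norm_nonneg _)
      (pow_le_one₀ (norm_nonneg _) (by simpa using hx))
  have ht := (hcont _ hmem).mono_left (nhdsWithin_mono _ Metric.ball_subset_closedBall)
  -- Uniqueness of the limit, needed to evaluate `limUnder`, requires the point to be in the closure
  -- of the open disk.
  have hne : (𝓝[Metric.ball 0 1] Complex.exp (θ * I)).NeBot := by
    rw [← mem_closure_iff_nhdsWithin_neBot, closure_ball _ one_ne_zero]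
    exact hmem
  have ht2 : Filter.Tendsto (diskModel r f) (𝓝[Metric.ball 0 1] Complex.exp (θ * I))
      (𝓝 (∑' n, b n * Complex.exp (θ * I) ^ n)) := by
    refine ht.congr' ?_
    filter_upwards [self_mem_nhdsWithin] with x hx
    exact (h.2 x hx).tsum_eq
  rw [boundaryValue, ht2.limUnder_eq, trigSeries]
  refine tsum_congr fun n => ?_
  rw [← Complex.exp_nat_mul, mul_assoc]

lemma integral_exp_nat_sub (m n : ℕ) :
    ∫ θ in (0 : ℝ)..2 * π, Complex.exp (n * θ * I) * Complex.exp (-(m * θ * I)) =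
      if n = m then 2 * (π : ℂ) else 0 := by
  have e : ∀ θ : ℝ, Complex.exp (n * θ * I) * Complex.exp (-(m * θ * I)) =
      Complex.exp ((((n : ℤ) - m : ℤ) : ℂ) * I * θ) := by
    intro θ
    rw [← Complex.exp_add]
    congr 1
    push_cast
    ring
  simp only [e]
  split_ifs with h
  · simp [h]
  · have h0 : ((((n : ℤ) - m : ℤ) : ℂ) * I) ≠ 0 := by
      refine mul_ne_zero ?_ Complex.I_ne_zero
      rw [Int.cast_ne_zero]
      omega
    rw [integral_exp_mul_complex h0]
    have : Complex.exp ((((n : ℤ) - m : ℤ) : ℂ) * I * ((2 * π : ℝ) : ℂ)) = 1 := by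
      rw [← Complex.exp_int_mul_two_pi_mul_I ((n : ℤ) - m)]
      congr 1
      push_cast
      ring
    rw [this]
    simp

/-- `b m` is a Fourier coefficient of the series, hence bounded by its supremum. Applied to
derivatives, this turns uniform closeness on the circle into weighted closeness of coefficients. -/
lemma norm_coeff_le_of_norm_trigSeries_le {b : ℕ → ℂ} (hb : Summable fun n => ‖b n‖) {ε : ℝ}
    (h : ∀ θ, ‖trigSeries b θ‖ ≤ ε) (m : ℕ) : ‖b m‖ ≤ ε := by
  have hs := intervalIntegral.hasSum_integral_of_dominated_convergence
    (μ := MeasureTheory.volume) (a := 0) (b := 2 * π)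
    (F := fun (n : ℕ) (θ : ℝ) => b n * Complex.exp (n * θ * I) * Complex.exp (-(m * θ * I)))
    (f := fun θ => trigSeries b θ * Complex.exp (-(m * θ * I)))
    (fun n _ => ‖b n‖) (fun n => by
      apply Continuous.aestronglyMeasurable
      fun_prop)
    (fun n => Filter.Eventually.of_forall fun θ _ => by
      have h1 : ‖Complex.exp (-(m * θ * I))‖ = 1 := by
        rw [Complex.exp_neg, norm_inv, norm_exp_nat_mul, inv_one]
      rw [norm_mul, norm_mul, norm_exp_nat_mul, h1, mul_one, mul_one])
    (Filter.Eventually.of_forall fun θ _ => hb) intervalIntegrable_const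
    (Filter.Eventually.of_forall fun θ _ => by
      have h1 : HasSum (fun n : ℕ => b n * Complex.exp (n * θ * I)) (trigSeries b θ) :=
        (summable_trigSeries hb θ).hasSum
      exact h1.mul_right _)
  have h2 : ∀ n : ℕ, ∫ θ in (0 : ℝ)..2 * π,
      b n * Complex.exp (n * θ * I) * Complex.exp (-(m * θ * I)) =
        if n = m then b n * (2 * (π : ℂ)) else 0 := by
    intro n
    simp only [mul_assoc (b n)]
    rw [intervalIntegral.integral_const_mul, integral_exp_nat_sub]
    split_ifs <;> simp
  simp only [h2] at hs
  have e : (fun n => if n = m then b n * (2 * (π : ℂ)) else 0) =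
      fun n => if n = m then b m * (2 * (π : ℂ)) else 0 := by
    ext n
    split_ifs with hn
    · rw [hn]
    · rfl
  rw [e] at hs
  have h3 := hs.unique (hasSum_ite_eq m (b m * (2 * (π : ℂ))))
  have h4 := intervalIntegral.norm_integral_le_of_norm_le_const (a := 0) (b := 2 * π) (C := ε)
    (f := fun θ : ℝ => trigSeries b θ * Complex.exp (-(m * θ * I))) (fun θ _ => by
      have h1 : ‖Complex.exp (-(m * θ * I))‖ = 1 := by
        rw [Complex.exp_neg, norm_inv, norm_exp_nat_mul, inv_one]
      rw [norm_mul, h1, mul_one]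
      exact h θ)
  rw [h3, norm_mul] at h4
  have h5 : ‖(2 * (π : ℂ))‖ = 2 * π := by
    rw [norm_mul, Complex.norm_real, Real.norm_of_nonneg Real.pi_pos.le]; simp
  rw [h5, sub_zero, abs_of_pos Real.two_pi_pos] at h4
  exact le_of_mul_le_mul_right h4 Real.two_pi_pos

/-- The radius of convergence is at least `1/c > 1`, so the coefficients decay geometrically; `1/d`,
with `d` halfway between `c` and `1`, is an intermediate radius. -/
lemma IsAnalyticVector.hasRapidExpansion {r : ℝ} {f : ℂ → ℂ} (hf : IsAnalyticVector r f) :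
    HasRapidExpansion r f (diskCoeff r f) := by
  obtain ⟨F, c, hc0, hc1, hF⟩ := hf
  have hcc : c < (c + 1) / 2 := by linarith
  set d := (c + 1) / 2 with hd
  have hd0 : 0 < d := hc0.trans hcc
  have hd1 : d < 1 := by linarith
  refine ⟨fun k => ?_, fun x hx => ?_⟩
  · have h1 : Summable fun n => ‖diskCoeff r f n‖ * (d⁻¹) ^ n :=
      summable_norm_of_hasSum_pow (by positivity) (hF.hasSum (x := ((d⁻¹ : ℝ) : ℂ)) (by
        rw [mem_ball_zero_iff, Complex.norm_real, Real.norm_of_nonneg (by positivity)]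
        exact inv_strictAnti₀ hc0 hcc))
    have h2 : Summable fun n : ℕ => ((n : ℝ) + 1) ^ k * d ^ (n + 1) := by
      have := (summable_nat_add_iff (f := fun n : ℕ => (n : ℝ) ^ k * d ^ n) 1).mpr
        (summable_pow_mul_geometric_of_norm_lt_one k (by rwa [Real.norm_of_nonneg hd0.le]))
      simpa using this
    obtain ⟨C, hC⟩ : ∃ C, ∀ n : ℕ, ((n : ℝ) + 1) ^ k * d ^ (n + 1) ≤ C :=
      ⟨_, fun n => h2.le_tsum n fun _ _ => by positivity⟩
    refine Summable.of_nonneg_of_le (fun n => by positivity) (fun n => ?_) (h1.mul_left (C * d⁻¹))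
    have h3 := hC n
    calc ‖diskCoeff r f n‖ * ((n : ℝ) + 1) ^ k
        = (((n : ℝ) + 1) ^ k * d ^ (n + 1)) * d⁻¹ * (‖diskCoeff r f n‖ * d⁻¹ ^ n) := by
          rw [inv_pow, pow_succ]; field_simp
      _ ≤ C * d⁻¹ * (‖diskCoeff r f n‖ * d⁻¹ ^ n) := by gcongr
  · have hx' : x ∈ Metric.ball (0 : ℂ) c⁻¹ :=
      Metric.ball_subset_ball ((one_lt_inv₀ hc0).mpr hc1).le hx
    rw [← hF.2 x hx]
    exact hF.hasSum hx'

/-! ### Convergence in the smooth topology and polynomial truncations -/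

lemma tendsto_nhds_smoothTopology_iff {r : ℝ} {ι : Type*} {l : Filter ι} {g : ι → ℂ → ℂ}
    {f : ℂ → ℂ} : Filter.Tendsto g l (@nhds (ℂ → ℂ) (smoothTopology r) f) ↔
      ∀ N, TendstoUniformly (fun i => iteratedDeriv N (boundaryValue r (g i)))
        (iteratedDeriv N (boundaryValue r f)) l := by
  rw [nhds_iInf, Filter.tendsto_iInf]
  refine forall_congr' fun N => ?_
  rw [nhds_induced, Filter.tendsto_comap_iff, UniformFun.tendsto_iff_tendstoUniformly]
  rfl

/-- The function on the lower half-plane for which `f⁻` is the polynomial `∑_{n < k} b(n) x^n` in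
the disk coordinate. -/
def truncatedVector (r : ℝ) (b : ℕ → ℂ) (k : ℕ) (t : ℂ) : ℂ :=
  ((I - t) ^ (r : ℂ))⁻¹ * ∑ n ∈ Finset.range k, b n * ((t + I) / (t - I)) ^ n

lemma I_sub_cayleyInv {x : ℂ} (hx : 1 - x ≠ 0) : I - cayleyInv x = 2 * I / (1 - x) := by
  rw [cayleyInv]; field_simp; ring

lemma one_sub_ne_zero {x : ℂ} (hx : x ∈ Metric.ball (0 : ℂ) 1) : 1 - x ≠ 0 := by
  intro h
  have : x = 1 := by linear_combination -h
  rw [this] at hx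
  simp at hx

lemma diskModel_truncatedVector (r : ℝ) (b : ℕ → ℂ) (k : ℕ) {x : ℂ}
    (hx : x ∈ Metric.ball (0 : ℂ) 1) :
    diskModel r (truncatedVector r b k) x = ∑ n ∈ Finset.range k, b n * x ^ n := by
  have h1 := one_sub_ne_zero hx
  have h2 := I_sub_cayleyInv h1
  have h3 : (I - cayleyInv x) ^ (r : ℂ) ≠ 0 := by
    rw [Complex.cpow_ne_zero_iff]
    left
    rw [h2]
    exact div_ne_zero (by simp) h1
  have h4 : (cayleyInv x + I) / (cayleyInv x - I) = x := by
    have e1 : cayleyInv x - I = -(2 * I / (1 - x)) := by rw [← h2]; ring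
    have e2 : cayleyInv x + I = -(2 * I * x / (1 - x)) := by rw [cayleyInv]; field_simp; ring
    rw [e1, e2]
    field_simp [Complex.I_ne_zero]
  rw [diskModel, truncatedVector, mul_inv_cancel_left₀ h3, h4]

lemma isAnalyticVector_truncatedVector (r : ℝ) (b : ℕ → ℂ) (k : ℕ) :
    IsAnalyticVector r (truncatedVector r b k) := by
  refine ⟨fun x => ∑ n ∈ Finset.range k, b n * x ^ n, 1 / 2, by norm_num, by norm_num, ?_, ?_⟩
  · fun_prop
  · exact fun x hx => (diskModel_truncatedVector r b k hx).symm

/-- The truncation of a sequence. -/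
def truncate (b : ℕ → ℂ) (k n : ℕ) : ℂ := if n < k then b n else 0

lemma rapidDecay_truncate {b : ℕ → ℂ} (hb : RapidDecay b) (k : ℕ) : RapidDecay (truncate b k) :=
  fun j => Summable.of_nonneg_of_le (fun _ => by positivity) (fun n => by
    unfold truncate
    split_ifs
    · exact le_rfl
    · rw [norm_zero, zero_mul]; positivity) (hb j)

lemma hasRapidExpansion_truncatedVector (r : ℝ) {b : ℕ → ℂ} (hb : RapidDecay b) (k : ℕ) :
    HasRapidExpansion r (truncatedVector r b k) (truncate b k) := by
  refine ⟨rapidDecay_truncate hb k, fun x hx => ?_⟩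
  rw [diskModel_truncatedVector r b k hx]
  have h : ∑ n ∈ Finset.range k, b n * x ^ n = ∑ n ∈ Finset.range k, truncate b k n * x ^ n :=
    Finset.sum_congr rfl fun n hn => by rw [truncate, if_pos (Finset.mem_range.mp hn)]
  rw [h]
  refine hasSum_sum_of_ne_finset_zero fun n hn => ?_
  rw [truncate, if_neg (by simpa using hn), zero_mul]

/-- The `N`-th angular derivative of the error is bounded by a tail of the convergent series `∑ n^N
‖b n‖`. As truncations are analytic vectors, `f` lies in the closure of `D^ω`. -/
lemma tendsto_truncatedVector {r : ℝ} {f : ℂ → ℂ} {b : ℕ → ℂ} (hf : HasRapidExpansion r f b) :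
    Filter.Tendsto (truncatedVector r b) Filter.atTop (@nhds (ℂ → ℂ) (smoothTopology r) f) := by
  rw [tendsto_nhds_smoothTopology_iff]
  intro N
  have hs := (hf.1.deriv_iterate N).summable_norm
  rw [Metric.tendstoUniformly_iff]
  intro ε hε
  have ht := tendsto_sum_nat_add fun n => ‖((n : ℂ) * I) ^ N * b n‖
  filter_upwards [ht.eventually (gt_mem_nhds hε)] with k hk θ
  rw [(hasRapidExpansion_truncatedVector r hf.1 k).boundaryValue_eq, hf.boundaryValue_eq,
    iteratedDeriv_trigSeries hf.1, iteratedDeriv_trigSeries (rapidDecay_truncate hf.1 k),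
    dist_eq_norm, trigSeries_sub hs ((rapidDecay_truncate hf.1 k).deriv_iterate N).summable_norm]
  have hsub := (hf.1.deriv_iterate N).sub ((rapidDecay_truncate hf.1 k).deriv_iterate N)
  refine (norm_trigSeries_le hsub.summable_norm θ).trans_lt ?_
  rw [← hsub.summable_norm.sum_add_tsum_nat_add k]
  have h0 : ∑ n ∈ Finset.range k, ‖((n : ℂ) * I) ^ N * b n - ((n : ℂ) * I) ^ N * truncate b k n‖ = 0 :=
    Finset.sum_eq_zero fun n hn => by
      rw [truncate, if_pos (Finset.mem_range.mp hn), sub_self, norm_zero]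
  rw [h0, zero_add]
  refine lt_of_eq_of_lt (tsum_congr fun n => ?_) hk
  rw [truncate, if_neg (by omega), mul_zero, sub_zero]

/-- Sequences bounded by a power of `n`. -/
def PolynomialGrowth (H : ℕ → ℂ) : Prop := ∃ (C : ℝ) (K : ℕ), ∀ n : ℕ, ‖H n‖ ≤ C * ((n : ℝ) + 1) ^ K

/-- The duality between smooth vectors and functions of moderate growth, in terms of the Taylor
coefficients in the disk coordinates. -/
theorem dualitySmooth_eq_tsum {r : ℝ} (hr : 0 < r) {h f : ℂ → ℂ} {H b : ℕ → ℂ}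
    (hH : HasUpperExpansion r h H) (hHg : PolynomialGrowth H) (hf : HasRapidExpansion r f b) :
    dualitySmooth r h f = ∑' n, H n * (b n * dualWeight r n) := by
  obtain ⟨C, K, hC⟩ := hHg
  have hC0 : 0 ≤ C := by
    have := (norm_nonneg _).trans (hC 0)
    simpa using this
  have hwt : ∀ (a : ℕ → ℂ) (n : ℕ), ‖H n * (a n * dualWeight r n)‖ ≤
      C * (1 + 1 / r) * (‖a n‖ * ((n : ℝ) + 1) ^ (K + 1)) := by
    intro a n
    rw [norm_mul, norm_mul, Complex.norm_real, Real.norm_of_nonneg (dualWeight_pos hr n).le]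
    calc ‖H n‖ * (‖a n‖ * dualWeight r n)
        ≤ (C * ((n : ℝ) + 1) ^ K) * (‖a n‖ * ((1 + 1 / r) * (n + 1))) := by
          have h1 := hC n
          have h2 := dualWeight_le_mul hr n
          have h3 := (dualWeight_pos hr n).le
          gcongr
      _ = C * (1 + 1 / r) * (‖a n‖ * ((n : ℝ) + 1) ^ (K + 1)) := by ring
  have hsum : ∀ a : ℕ → ℂ, RapidDecay a → Summable fun n => H n * (a n * dualWeight r n) :=
    fun a ha => Summable.of_norm_bounded ((ha (K + 1)).mul_left (C * (1 + 1 / r))) (hwt a)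
  have hW : @nhdsWithin (ℂ → ℂ) (smoothTopology r) f {f | IsAnalyticVector r f} =
      @nhds (ℂ → ℂ) (smoothTopology r) f ⊓ Filter.principal {f | IsAnalyticVector r f} := rfl
  -- `extendFrom` is a `limUnder`; it is determined only if `f` is approximated by analytic vectors.
  have hne : (@nhdsWithin (ℂ → ℂ) (smoothTopology r) f {f | IsAnalyticVector r f}).NeBot := by
    have hA : ∀ᶠ k in Filter.atTop, truncatedVector r b k ∈ {f | IsAnalyticVector r f} :=
      Filter.Eventually.of_forall fun k => isAnalyticVector_truncatedVector r b k
    rw [hW]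
    exact (Filter.tendsto_inf.mpr ⟨tendsto_truncatedVector hf,
      Filter.tendsto_principal.mpr hA⟩).neBot
  have hlim : Filter.Tendsto (dualityAnalytic r h)
      (@nhdsWithin (ℂ → ℂ) (smoothTopology r) f {f | IsAnalyticVector r f})
      (𝓝 (∑' n, H n * (b n * dualWeight r n))) := by
    have hid : Filter.Tendsto (id : (ℂ → ℂ) → ℂ → ℂ)
        (@nhdsWithin (ℂ → ℂ) (smoothTopology r) f {f | IsAnalyticVector r f})
        (@nhds (ℂ → ℂ) (smoothTopology r) f) := by
      rw [hW]
      exact inf_le_left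
    rw [tendsto_nhds_smoothTopology_iff] at hid
    have hmem : ∀ᶠ g in @nhdsWithin (ℂ → ℂ) (smoothTopology r) f {f | IsAnalyticVector r f},
        IsAnalyticVector r g := by
      rw [hW]
      exact Filter.mem_inf_of_right (Filter.mem_principal_self _)
    rw [Metric.tendsto_nhds]
    intro ε hε
    set S : ℝ := ∑' n : ℕ, 1 / ((n : ℝ) + 1) ^ 2 with hS
    have hSs : Summable fun n : ℕ => 1 / ((n : ℝ) + 1) ^ 2 := by
      have := (summable_nat_add_iff (f := fun n : ℕ => 1 / (n : ℝ) ^ 2) 1).mpr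
        (Real.summable_one_div_nat_pow.mpr one_lt_two)
      simpa using this
    have hS0 : 0 ≤ S := tsum_nonneg fun n => by positivity
    set D : ℝ := C * (1 + 1 / r) * 2 ^ (K + 3) * 2 * S with hD
    have hD0 : 0 ≤ D := by positivity
    have hδ : 0 < ε / (D + 1) := by positivity
    set δ := ε / (D + 1) with hδd
    -- The order `K + 3` is `K` for the growth of `H`, one for the weight, and two so that `∑
    -- 1/(n+1)²` remains. Order `0` is also needed, since derivatives do not see the constant
    -- coefficient.
    have e0 := Metric.tendstoUniformly_iff.mp (hid 0) δ hδ
    have e1 := Metric.tendstoUniformly_iff.mp (hid (K + 3)) δ hδ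
    filter_upwards [hmem, e0, e1] with g hg hg0 hg1
    have hgr := hg.hasRapidExpansion
    rw [dualityAnalytic_eq_tsum hr hH hg, dist_eq_norm, ← (hsum _ hgr.1).tsum_sub (hsum _ hf.1)]
    have hsub := hf.1.sub hgr.1
    have hco : ∀ N : ℕ, (∀ θ, dist (iteratedDeriv N (boundaryValue r f) θ)
        (iteratedDeriv N (boundaryValue r (id g)) θ) < δ) →
        ∀ n : ℕ, ‖b n - diskCoeff r g n‖ * (n : ℝ) ^ N ≤ δ := by
      intro N hN n
      have h1 := norm_coeff_le_of_norm_trigSeries_le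
        (b := fun n => ((n : ℂ) * I) ^ N * b n - ((n : ℂ) * I) ^ N * diskCoeff r g n) (ε := δ)
        ((hf.1.deriv_iterate N).sub (hgr.1.deriv_iterate N)).summable_norm (fun θ => by
          have h2 := hN θ
          rw [id, hf.boundaryValue_eq, hgr.boundaryValue_eq, iteratedDeriv_trigSeries hf.1,
            iteratedDeriv_trigSeries hgr.1, dist_eq_norm,
            trigSeries_sub (hf.1.deriv_iterate N).summable_norm
              (hgr.1.deriv_iterate N).summable_norm] at h2
          exact h2.le) n
      rw [← mul_sub, norm_mul, norm_pow, norm_mul, Complex.norm_I, mul_one,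
        Complex.norm_natCast] at h1
      linarith
    have hterm : ∀ n : ℕ, ‖b n - diskCoeff r g n‖ * ((n : ℝ) + 1) ^ (K + 1) ≤
        2 ^ (K + 3) * 2 * δ * (1 / ((n : ℝ) + 1) ^ 2) := by
      intro n
      have h0 := hco 0 hg0 n
      have h1 := hco (K + 3) hg1 n
      rw [pow_zero, mul_one] at h0
      rw [mul_one_div, le_div_iff₀ (by positivity), mul_assoc, ← pow_add]
      have h2 : ((n : ℝ) + 1) ^ (K + 3) ≤ 2 ^ (K + 3) * (1 + (n : ℝ) ^ (K + 3)) := by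
        rcases Nat.eq_zero_or_pos n with rfl | hn
        · simp
          exact one_le_pow₀ one_le_two
        · have hn1 : (1 : ℝ) ≤ n := by exact_mod_cast hn
          calc ((n : ℝ) + 1) ^ (K + 3) ≤ (2 * n) ^ (K + 3) := by gcongr; linarith
            _ = 2 ^ (K + 3) * (n : ℝ) ^ (K + 3) := by rw [mul_pow]
            _ ≤ 2 ^ (K + 3) * (1 + (n : ℝ) ^ (K + 3)) := by gcongr; linarith
      calc ‖b n - diskCoeff r g n‖ * ((n : ℝ) + 1) ^ (K + 1 + 2)
          ≤ ‖b n - diskCoeff r g n‖ * (2 ^ (K + 3) * (1 + (n : ℝ) ^ (K + 3))) := by gcongr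
        _ = 2 ^ (K + 3) * (‖b n - diskCoeff r g n‖ +
              ‖b n - diskCoeff r g n‖ * (n : ℝ) ^ (K + 3)) := by ring
        _ ≤ 2 ^ (K + 3) * (δ + δ) := by gcongr
        _ = 2 ^ (K + 3) * 2 * δ := by ring
    have hb1 : ∀ n, ‖H n * (diskCoeff r g n * dualWeight r n) - H n * (b n * dualWeight r n)‖ ≤
        C * (1 + 1 / r) * (2 ^ (K + 3) * 2 * δ * (1 / ((n : ℝ) + 1) ^ 2)) := by
      intro n
      rw [norm_sub_rev, ← mul_sub, ← sub_mul]
      exact (hwt (fun n => b n - diskCoeff r g n) n).trans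
        (mul_le_mul_of_nonneg_left (hterm n) (by positivity))
    have hb2 := ((hSs.mul_left (2 ^ (K + 3) * 2 * δ)).mul_left (C * (1 + 1 / r)))
    calc ‖∑' n, (H n * (diskCoeff r g n * dualWeight r n) - H n * (b n * dualWeight r n))‖
        ≤ ∑' n : ℕ, C * (1 + 1 / r) * (2 ^ (K + 3) * 2 * δ * (1 / ((n : ℝ) + 1) ^ 2)) :=
          tsum_of_norm_bounded hb2.hasSum hb1
      _ = D * δ := by rw [tsum_mul_left, tsum_mul_left, hD, hS]; ring
      _ < (D + 1) * δ := by linarith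
      _ = ε := by rw [hδd]; field_simp
  rw [dualitySmooth]
  exact hlim.limUnder_eq

/-! ### Growth of entire forms -/

/-- Functions on the upper half-plane bounded by a power of `1 + 1 / Im z`. -/
def ModerateGrowth (h : ℂ → ℂ) : Prop :=
  ∃ (C : ℝ) (M : ℕ), 0 ≤ C ∧ ∀ z : ℂ, 0 < z.im → ‖h z‖ ≤ C * (1 + 1 / z.im) ^ M

/-- The function `|f(z)| (Im z)^{r/2}`. -/
def petNorm (r : ℝ) (f : ℂ → ℂ) (z : UpperHalfPlane) : ℝ := ‖f z‖ * z.im ^ (r / 2)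

/-- From `Im γz = Im z/|cz+d|²`, the power `y^{r/2}` cancels the factor `|cz+d|^r`. -/
lemma IsAutomorphicForm.petNorm_smul {r p : ℝ} {f : ℂ → ℂ} (hf : IsAutomorphicForm r p f)
    (γ : SL(2, ℤ)) (z : UpperHalfPlane) :
    petNorm r f (γ • z) = ‖etaMultiplier p γ‖ * petNorm r f z := by
  have hd : UpperHalfPlane.denom γ z ≠ 0 := UpperHalfPlane.denom_ne_zero _ _
  have hd' : (((γ 1 0 : ℤ) : ℂ) * z + ((γ 1 1 : ℤ) : ℂ)) = UpperHalfPlane.denom γ z := by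
    rw [ModularGroup.denom_apply]
  have hn : 0 < ‖UpperHalfPlane.denom γ z‖ := norm_pos_iff.mpr hd
  rw [petNorm, hf.transf γ z, ModularGroup.im_smul_eq_div_normSq, norm_mul, norm_mul, autFactor,
    hd', Complex.norm_cpow_real, Complex.normSq_eq_norm_sq,
    Real.div_rpow z.im_pos.le (by positivity), ← Real.rpow_natCast, ← Real.rpow_mul hn.le, petNorm]
  have : ((2 : ℕ) : ℝ) * (r / 2) = r := by push_cast; ring
  rw [this]
  have h3 : ‖UpperHalfPlane.denom γ z‖ ^ r ≠ 0 := (Real.rpow_pos_of_pos hn r).ne'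
  field_simp

/-- `S` and `ST` have finite order, and `1` is the only nonnegative real root of unity; `S` and `T`
generate the group. -/
lemma monoidHom_real_eq_one (χ : SL(2, ℤ) →* ℝ) (hχ : ∀ γ, 0 ≤ χ γ) : χ = 1 := by
  have hS4 : ModularGroup.S ^ 4 = 1 := by decide
  have hST : (ModularGroup.S * ModularGroup.T) ^ 6 = 1 := by decide
  have h1 : χ ModularGroup.S = 1 := by
    have := congrArg χ hS4
    rw [map_pow, map_one] at this
    exact (pow_eq_one_iff_of_nonneg (hχ _) (by norm_num)).mp this
  have h2 : χ ModularGroup.T = 1 := by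
    have := congrArg χ hST
    rw [map_pow, map_mul, map_one, h1, one_mul] at this
    exact (pow_eq_one_iff_of_nonneg (hχ _) (by norm_num)).mp this
  refine MonoidHom.eq_of_eqOn_dense SpecialLinearGroup.SL2Z_generators ?_
  rintro γ (rfl | rfl)
  · simpa using h1
  · simpa using h2

/-- It must be seen that `|v[p]| = 1`. Multiplicativity of `|v[p]|` is read off from `f` itself, by
cancelling its value at a point where it does not vanish; a zero form is trivial. -/
lemma IsAutomorphicForm.petNorm_invariant {r p : ℝ} {f : ℂ → ℂ} (hf : IsAutomorphicForm r p f)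
    (γ : SL(2, ℤ)) (z : UpperHalfPlane) : petNorm r f (γ • z) = petNorm r f z := by
  by_cases h0 : ∃ w, petNorm r f w ≠ 0
  · obtain ⟨w, hw⟩ := h0
    have hmul : ∀ γ δ : SL(2, ℤ), ‖etaMultiplier p (γ * δ)‖ =
        ‖etaMultiplier p γ‖ * ‖etaMultiplier p δ‖ := by
      intro γ δ
      apply mul_right_cancel₀ hw
      rw [← hf.petNorm_smul, mul_smul, hf.petNorm_smul, hf.petNorm_smul, mul_assoc]
    have hone : ‖etaMultiplier p 1‖ = 1 := by
      apply mul_right_cancel₀ hw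
      rw [← hf.petNorm_smul, one_smul, one_mul]
    have := monoidHom_real_eq_one
      { toFun := fun γ => ‖etaMultiplier p γ‖, map_one' := hone, map_mul' := hmul }
      fun γ => norm_nonneg (etaMultiplier p γ)
    have h1 : ‖etaMultiplier p γ‖ = 1 := congrArg (fun χ : SL(2, ℤ) →* ℝ => χ γ) this
    rw [hf.petNorm_smul, h1, one_mul]
  · push Not at h0
    rw [h0, h0]

/-- The invariant function `|f| y^{r/2}` is `O(y^{r/2})` at the cusp. Reduction to the fundamental
domain bounds it everywhere by a multiple of `max(y, 1/y)^{r/2}`. -/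
lemma IsEntireForm.moderateGrowth {r p : ℝ} (hr : 0 < r) {f : ℂ → ℂ} (hf : IsEntireForm r p f) :
    ModerateGrowth f := by
  have hc : Continuous (petNorm r f) := by
    have h1 : Continuous fun z : UpperHalfPlane => f z :=
      hf.holo.continuousOn.comp_continuous UpperHalfPlane.continuous_coe fun z => z.im_pos
    exact h1.norm.mul (UpperHalfPlane.continuous_im.rpow_const fun z => Or.inl z.im_ne_zero)
  have hO : petNorm r f =O[UpperHalfPlane.atImInfty] fun z => z.im ^ (r / 2) := by
    have h1 : (fun z : UpperHalfPlane => f z) =O[UpperHalfPlane.atImInfty]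
      (1 : UpperHalfPlane → ℝ) := hf.bounded
    have h2 := h1.norm_left.mul
      (Asymptotics.isBigO_refl (fun z : UpperHalfPlane => z.im ^ (r / 2)) UpperHalfPlane.atImInfty)
    simp only [Pi.one_apply, one_mul] at h2
    exact h2
  obtain ⟨C, hC⟩ := ModularGroup.exists_bound_of_invariant_of_isBigO hc (by positivity) hO
    hf.petNorm_invariant
  refine ⟨|C|, ⌈r⌉₊, abs_nonneg C, fun z hz => ?_⟩
  have h := hC ⟨z, hz⟩
  have e : (⟨z, hz⟩ : UpperHalfPlane).im = z.im := rfl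
  rw [Real.norm_of_nonneg (by unfold petNorm; positivity), petNorm, e] at h
  change ‖f z‖ * _ ≤ _ at h
  -- The form of this bound is chosen so that dividing by `y^{r/2}` leaves exactly `(1 + 1/y)^r`.
  have h1 : max z.im (1 / z.im) ≤ z.im * (1 + 1 / z.im) ^ 2 := by
    have e2 : z.im * (1 + 1 / z.im) ^ 2 = z.im + 2 + 1 / z.im := by field_simp; ring
    rw [e2]
    have := one_div_pos.mpr hz
    exact max_le (by linarith) (by linarith)
  have hy : 0 < z.im ^ (r / 2) := Real.rpow_pos_of_pos hz _
  have h2 : 0 < 1 / z.im := one_div_pos.mpr hz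
  have h3 : ‖f z‖ * z.im ^ (r / 2) ≤ (|C| * (1 + 1 / z.im) ^ r) * z.im ^ (r / 2) := by
    calc ‖f z‖ * z.im ^ (r / 2) ≤ C * max z.im (1 / z.im) ^ (r / 2) := h
      _ ≤ |C| * (z.im * (1 + 1 / z.im) ^ 2) ^ (r / 2) := by
          gcongr
          exact le_abs_self C
      _ = (|C| * (1 + 1 / z.im) ^ r) * z.im ^ (r / 2) := by
          rw [Real.mul_rpow hz.le (by positivity), ← Real.rpow_natCast,
            ← Real.rpow_mul (by positivity)]
          have : ((2 : ℕ) : ℝ) * (r / 2) = r := by push_cast; ring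
          rw [this]
          ring
  refine (le_of_mul_le_mul_right h3 hy).trans ?_
  gcongr
  rw [← Real.rpow_natCast]
  exact Real.rpow_le_rpow_of_exponent_le (by linarith) (Nat.le_ceil r)

/-! ### Expansions on the upper half-plane -/

lemma ofDisk_im {Z : ℂ} (hZ : 1 - Z ≠ 0) :
    (ofDisk Z).im = (1 - ‖Z‖ ^ 2) / ‖1 - Z‖ ^ 2 := by
  rw [← Complex.normSq_eq_norm_sq, ← Complex.normSq_eq_norm_sq, ofDisk, Complex.div_im,
    Complex.normSq_apply Z]
  have : Complex.normSq (1 - Z) ≠ 0 := by simpa using hZ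
  field_simp
  simp
  ring

lemma half_le_ofDisk_im {Z : ℂ} (hZ : Z ∈ Metric.ball (0 : ℂ) 1) :
    (1 - ‖Z‖) / 2 ≤ (ofDisk Z).im := by
  have h1 := one_sub_ne_zero hZ
  have h0 : 0 < ‖1 - Z‖ := norm_pos_iff.mpr h1
  rw [mem_ball_zero_iff] at hZ
  have h2 : ‖1 - Z‖ ≤ 1 + ‖Z‖ := by simpa using norm_sub_le (1 : ℂ) Z
  rw [ofDisk_im h1, div_le_div_iff₀ two_pos (by positivity)]
  have h3 : ‖1 - Z‖ ^ 2 ≤ (1 + ‖Z‖) ^ 2 := by gcongr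
  have h4 := norm_nonneg Z
  nlinarith [mul_le_mul_of_nonneg_left h3 (sub_nonneg.mpr hZ.le),
    mul_nonneg (sub_nonneg.mpr hZ.le) h4]

lemma I_add_ofDisk {Z : ℂ} (hZ : 1 - Z ≠ 0) : -I - ofDisk Z = -(2 * I / (1 - Z)) := by
  rw [ofDisk]; field_simp; ring

/-- Moderate growth in `Im z` becomes a bound by a power of `1/(1-|Z|)`, and Cauchy's estimates turn
this into polynomial growth of the Taylor coefficients. -/
lemma exists_upperExpansion {r : ℝ} (hr : 0 < r) {h : ℂ → ℂ}
    (hh : DifferentiableOn ℂ h {z : ℂ | 0 < z.im}) (hg : ModerateGrowth h) :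
    ∃ H, HasUpperExpansion r h H ∧ PolynomialGrowth H := by
  obtain ⟨C, M, hC0, hC⟩ := hg
  have him : ∀ Z ∈ Metric.ball (0 : ℂ) 1, 0 < (ofDisk Z).im := fun Z hZ => by
    refine lt_of_lt_of_le ?_ (half_le_ofDisk_im hZ)
    rw [mem_ball_zero_iff] at hZ
    linarith
  have hd : DifferentiableOn ℂ (upperModel r h) (Metric.ball 0 1) := by
    have hofd : DifferentiableOn ℂ ofDisk (Metric.ball 0 1) := by
      unfold ofDisk
      exact DifferentiableOn.div (by fun_prop) (by fun_prop) fun Z hZ => one_sub_ne_zero hZ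
    refine DifferentiableOn.mul ?_ (hh.comp hofd him)
    refine DifferentiableOn.cpow_const (hofd.const_sub _) fun Z hZ => ?_
    refine Or.inr ?_
    have := him Z hZ
    simp only [Complex.sub_im, Complex.neg_im, Complex.I_im]
    linarith
  refine ⟨fun n => (n.factorial : ℂ)⁻¹ * iteratedDeriv n (upperModel r h) 0, fun Z hZ => ?_, ?_⟩
  · have := Complex.hasSum_taylorSeries_on_ball hd hZ
    have e : (fun n : ℕ => (n.factorial : ℂ)⁻¹ * iteratedDeriv n (upperModel r h) 0 * Z ^ n) =
        fun n => (n.factorial : ℂ)⁻¹ • (Z - 0) ^ n • iteratedDeriv n (upperModel r h) 0 := by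
      ext n
      rw [smul_eq_mul, smul_eq_mul, sub_zero]
      ring
    rw [e]
    exact this
  · have hb : ∀ Z ∈ Metric.ball (0 : ℂ) 1, ‖upperModel r h Z‖ ≤
        C * (4 / (1 - ‖Z‖)) ^ (⌈r⌉₊ + M) := by
      intro Z hZ
      have h1 := one_sub_ne_zero hZ
      have h5 := half_le_ofDisk_im hZ
      have h6 := hC _ (him Z hZ)
      rw [mem_ball_zero_iff] at hZ
      have h2 : 1 - ‖Z‖ ≤ ‖1 - Z‖ := by simpa using norm_sub_norm_le (1 : ℂ) Z
      have h0 : 0 < 1 - ‖Z‖ := by linarith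
      have h7 := norm_nonneg Z
      rw [upperModel, norm_mul, Complex.norm_cpow_real, I_add_ofDisk h1, norm_neg, norm_div]
      have e : ‖(2 * I : ℂ)‖ = 2 := by simp
      rw [e]
      have h4 : 2 / ‖1 - Z‖ ≤ 4 / (1 - ‖Z‖) := by
        have : 0 < ‖1 - Z‖ := by linarith
        rw [div_le_div_iff₀ this h0]
        linarith
      have h41 : 1 ≤ 4 / (1 - ‖Z‖) := by
        rw [le_div_iff₀ h0]; linarith
      have h8 : 1 + 1 / (ofDisk Z).im ≤ 4 / (1 - ‖Z‖) := by
        have : 1 / (ofDisk Z).im ≤ 1 / ((1 - ‖Z‖) / 2) := one_div_le_one_div_of_le (by linarith) h5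
        have e2 : 1 / ((1 - ‖Z‖) / 2) = 2 / (1 - ‖Z‖) := by field_simp
        have e3 : 1 ≤ 2 / (1 - ‖Z‖) := by rw [le_div_iff₀ h0]; linarith
        have e4 : 4 / (1 - ‖Z‖) = 2 / (1 - ‖Z‖) + 2 / (1 - ‖Z‖) := by ring
        linarith
      have h9 : (2 / ‖1 - Z‖) ^ r ≤ (4 / (1 - ‖Z‖)) ^ ⌈r⌉₊ := by
        rw [← Real.rpow_natCast]
        exact (Real.rpow_le_rpow (by positivity) h4 hr.le).trans
          (Real.rpow_le_rpow_of_exponent_le h41 (Nat.le_ceil r))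
      have h10 : 0 < 1 / (ofDisk Z).im := one_div_pos.mpr (by linarith)
      calc (2 / ‖1 - Z‖) ^ r * ‖h (ofDisk Z)‖
          ≤ (4 / (1 - ‖Z‖)) ^ ⌈r⌉₊ * (C * (4 / (1 - ‖Z‖)) ^ M) := by
            refine mul_le_mul h9 (h6.trans ?_) (norm_nonneg _) (by positivity)
            gcongr
        _ = C * (4 / (1 - ‖Z‖)) ^ (⌈r⌉₊ + M) := by rw [pow_add]; ring
    set K := ⌈r⌉₊ + M with hK
    refine ⟨4 * (C * 8 ^ K), K, fun n => ?_⟩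
    -- At this radius `4/(1-ρ) = 8(n+1)` is linear in `n`, while Bernoulli gives `ρ^n ≥ 1/2`, so
    -- Cauchy's estimate loses only a constant.
    set ρ : ℝ := 1 - 1 / (2 * ((n : ℝ) + 1)) with hρ
    have hn : (0 : ℝ) < (n : ℝ) + 1 := by positivity
    have h21 : 1 / (2 * ((n : ℝ) + 1)) ≤ 1 / 2 :=
      one_div_le_one_div_of_le two_pos (by linarith [(Nat.cast_nonneg n : (0 : ℝ) ≤ n)])
    have h20 : 0 < 1 / (2 * ((n : ℝ) + 1)) := by positivity
    have hρ0 : 0 < ρ := by linarith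
    have hρ1 : ρ < 1 := by linarith
    have hcl : DiffContOnCl ℂ (upperModel r h) (Metric.ball 0 ρ) :=
      (hd.mono ((closure_mono (Metric.ball_subset_ball le_rfl)).trans
        (Metric.closure_ball_subset_closedBall.trans
          (Metric.closedBall_subset_ball hρ1)))).diffContOnCl
    have hder := Complex.norm_iteratedDeriv_le_of_forall_mem_sphere_norm_le n hρ0 hcl
      (C := C * (8 * ((n : ℝ) + 1)) ^ K) fun Z hZ => by
        have hZn : ‖Z‖ = ρ := by simpa using hZ
        have := hb Z (by rw [mem_ball_zero_iff, hZn]; exact hρ1)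
        rw [hZn] at this
        have e : 4 / (1 - ρ) = 8 * ((n : ℝ) + 1) := by
          rw [hρ]; field_simp; ring
        rwa [e] at this
    have hB := one_add_mul_le_pow (a := -(1 / (2 * ((n : ℝ) + 1)))) (by linarith) n
    have hpow : (1 / 2 : ℝ) ≤ ρ ^ n := by
      have e : 1 + -(1 / (2 * ((n : ℝ) + 1))) = ρ := by rw [hρ]; ring
      rw [e] at hB
      refine le_trans ?_ hB
      have : (n : ℝ) * (1 / (2 * ((n : ℝ) + 1))) ≤ 1 / 2 := by
        rw [mul_one_div, div_le_div_iff₀ (by positivity) two_pos]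
        linarith
      linarith
    have hf : (0 : ℝ) < n.factorial := by positivity
    rw [norm_mul, norm_inv, Complex.norm_natCast]
    calc (n.factorial : ℝ)⁻¹ * ‖iteratedDeriv n (upperModel r h) 0‖
        ≤ (n.factorial : ℝ)⁻¹ * (n.factorial * (C * (8 * ((n : ℝ) + 1)) ^ K) / ρ ^ n) := by gcongr
      _ = (C * (8 * ((n : ℝ) + 1)) ^ K) / ρ ^ n := by field_simp
      _ ≤ (C * (8 * ((n : ℝ) + 1)) ^ K) / (1 / 2) := by gcongr
      _ ≤ 4 * (C * 8 ^ K) * ((n : ℝ) + 1) ^ K := by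
          rw [mul_pow]
          have : 0 ≤ C * 8 ^ K * ((n : ℝ) + 1) ^ K := by positivity
          linarith

/-! ### The duality on integrals of the functions `(z - t)^{-r}` -/

lemma mul_cpow_of_arg {x y : ℂ} (hx : x ≠ 0) (hy : y ≠ 0)
    (h : x.arg + y.arg ∈ Set.Ioc (-π) π) (s : ℂ) : (x * y) ^ s = x ^ s * y ^ s := by
  rw [Complex.cpow_def_of_ne_zero (mul_ne_zero hx hy), Complex.cpow_def_of_ne_zero hx,
    Complex.cpow_def_of_ne_zero hy, Complex.log_mul hx hy h, ← Complex.exp_add, add_mul]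

lemma arg_mem_of_im_pos {x : ℂ} (hx : 0 < x.im) : 0 < x.arg ∧ x.arg < π := by
  refine ⟨lt_of_le_of_ne (Complex.arg_nonneg_iff.mpr hx.le) fun h => ?_,
    lt_of_le_of_ne (Complex.arg_le_pi x) fun h => ?_⟩
  · have := Complex.arg_eq_zero_iff.mp h.symm
    exact hx.ne' this.2
  · have := Complex.arg_eq_pi_iff.mp h
    exact hx.ne' this.2

lemma arg_mem_of_re_pos {x : ℂ} (hx : 0 < x.re) : -(π / 2) < x.arg ∧ x.arg < π / 2 :=
  abs_lt.mp (Complex.abs_arg_lt_pi_div_two_iff.mpr (Or.inl hx))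

lemma ne_zero_of_re_pos {x : ℂ} (hx : 0 < x.re) : x ≠ 0 := by
  rintro rfl; simp at hx

lemma ne_zero_of_im_pos {x : ℂ} (hx : 0 < x.im) : x ≠ 0 := by
  rintro rfl; simp at hx

/-- Both arguments lie in `(0, π)`, so their difference lies in `(-π, π)` and no branch is crossed.
-/
lemma div_cpow_of_im_pos {x y : ℂ} (hx : 0 < x.im) (hy : 0 < y.im) (s : ℂ) :
    (x / y) ^ s = x ^ s * y ^ (-s) := by
  have h1 := arg_mem_of_im_pos hx
  have h2 := arg_mem_of_im_pos hy
  have h3 : (y⁻¹).arg = -y.arg := by rw [Complex.arg_inv, if_neg h2.2.ne]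
  rw [div_eq_mul_inv, mul_cpow_of_arg (ne_zero_of_im_pos hx)
    (inv_ne_zero (ne_zero_of_im_pos hy)) (by rw [h3]; constructor <;> linarith),
    Complex.inv_cpow _ _ h2.2.ne, Complex.cpow_neg]

lemma cayleyInv_im_neg {x : ℂ} (hx : x ∈ Metric.ball (0 : ℂ) 1) : (cayleyInv x).im < 0 := by
  have h : cayleyInv x = -ofDisk x := by rw [cayleyInv, ofDisk]; ring
  have h2 := half_le_ofDisk_im hx
  rw [mem_ball_zero_iff] at hx
  rw [h, Complex.neg_im]
  linarith

lemma re_add_I_div {z : ℂ} (hz : 0 < z.im) : 0 < ((z + I) / (2 * I)).re := by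
  have : (z + I) / (2 * I) = -I * (z + I) / 2 := by
    field_simp
    linear_combination (z + I) * Complex.I_sq
  rw [this, ← Complex.ofReal_ofNat, Complex.div_ofReal_re]
  simp
  linarith

/-- The quotient `(z-t)/(i-t)` equals `((z+i)/(2i)) · (1 - xZ)`, and both factors lie in the right
half-plane, so principal powers are multiplicative here. The kernel `(z-t)^{-r}` thus becomes a
binomial series in `xZ`. -/
lemma kernel_disk (r : ℝ) {z x : ℂ} (hz : 0 < z.im) (hx : x ∈ Metric.ball (0 : ℂ) 1) :
    (I - cayleyInv x) ^ (r : ℂ) * (z - cayleyInv x) ^ (-r : ℂ) =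
      ((z + I) / (2 * I)) ^ (-r : ℂ) * (1 - x * toDisk z) ^ (-r : ℂ) := by
  have ht := cayleyInv_im_neg hx
  have h1 : 0 < (I - cayleyInv x).im := by simp; linarith
  have h2 : 0 < (z - cayleyInv x).im := by simp; linarith
  have hx1 := one_sub_ne_zero hx
  have hzI := add_I_ne_zero hz
  have h3 : (z - cayleyInv x) / (I - cayleyInv x) = (z + I) / (2 * I) * (1 - x * toDisk z) := by
    rw [I_sub_cayleyInv hx1, cayleyInv, toDisk]
    field_simp [Complex.I_ne_zero]
    ring
  have h4 : 0 < (1 - x * toDisk z).re := by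
    have h5 : ‖x * toDisk z‖ < 1 := by
      rw [norm_mul]
      have h6 := toDisk_norm_lt_one hz
      rw [mem_ball_zero_iff] at hx
      nlinarith [norm_nonneg x, norm_nonneg (toDisk z)]
    have := Complex.re_le_norm (x * toDisk z)
    rw [Complex.sub_re, Complex.one_re]
    linarith
  have h5 := re_add_I_div hz
  have h6 := arg_mem_of_re_pos h4
  have h7 := arg_mem_of_re_pos h5
  rw [← mul_cpow_of_arg (ne_zero_of_re_pos h5) (ne_zero_of_re_pos h4)
    (by constructor <;> linarith), ← h3, div_cpow_of_im_pos h2 h1, neg_neg, mul_comm]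

/-- Source of the constant `(-2i)^r`: `-i - z` is `-2i` times `(z+i)/(2i)`, whose argument lies in
`(-π/2, π/2)`, so the arguments add without wrapping. -/
lemma kernel_upper (r : ℝ) {z : ℂ} (hz : 0 < z.im) :
    ((z + I) / (2 * I)) ^ (-r : ℂ) * (-I - z) ^ (r : ℂ) = (-2 * I) ^ (r : ℂ) := by
  have h5 := re_add_I_div hz
  have h7 := arg_mem_of_re_pos h5
  have h8 : (-2 * I : ℂ).arg = -(π / 2) := by
    have : (-2 * I : ℂ) = ((2 : ℝ) : ℂ) * (-I) := by push_cast; ring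
    rw [this, Complex.arg_real_mul _ two_pos, Complex.arg_neg_I]
  have e : -I - z = (z + I) / (2 * I) * (-2 * I) := by
    field_simp; ring
  have h0 := ne_zero_of_re_pos h5
  rw [e, mul_cpow_of_arg h0 (by simp) (by rw [h8]; constructor <;> linarith), ← mul_assoc,
    Complex.cpow_neg, inv_mul_cancel₀, one_mul]
  rw [Complex.cpow_ne_zero_iff]
  exact Or.inl h0

/-- The binomial coefficients `(r)_n/n!` are the inverses of the duality weights; this makes
`(z-t)^{-r}` a reproducing kernel. -/
lemma hasSum_one_sub_cpow {r : ℝ} {x : ℂ} (hx : ‖x‖ < 1) :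
    HasSum (fun n => ((dualWeight r n)⁻¹ : ℝ) * x ^ n) ((1 - x) ^ (-r : ℂ)) := by
  have h := (Complex.one_div_one_sub_cpow_hasFPowerSeriesOnBall_zero (r : ℂ)).hasSum (y := x)
    (by rwa [mem_eball_zero_iff, ← ofReal_norm, ENNReal.ofReal_lt_one])
  have e : (fun n => (((dualWeight r n)⁻¹ : ℝ) : ℂ) * x ^ n) = fun n =>
      (FormalMultilinearSeries.ofScalars ℂ fun n : ℕ => Ring.choose ((r : ℂ) + n - 1) n) n
        fun _ => x := by
    ext n
    rw [FormalMultilinearSeries.ofScalars_apply_eq, smul_eq_mul]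
    congr 1
    have h1 : Ring.choose ((r : ℂ) + n - 1) n = Ring.multichoose (r : ℂ) n := by
      rw [Ring.choose]
      congr 1
      ring
    have h2 := Ring.factorial_nsmul_multichoose_eq_ascPochhammer (r : ℂ) n
    rw [Polynomial.ascPochhammer_smeval_eq_eval, nsmul_eq_mul] at h2
    have h3 : (ascPochhammer ℂ n).eval (r : ℂ) = (((ascPochhammer ℝ n).eval r : ℝ) : ℂ) := by
      rw [← ascPochhammer_map (algebraMap ℝ ℂ), Polynomial.eval_map_algebraMap]
      exact Polynomial.aeval_algebraMap_apply_eq_algebraMap_eval r _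
    have hn : (n.factorial : ℂ) ≠ 0 := by exact_mod_cast n.factorial_ne_zero
    rw [h1, dualWeight, inv_div]
    push_cast
    rw [← h3, ← h2]
    field_simp
  rw [e]
  simpa [Complex.cpow_neg] using h

/-- From `1 - |Z|² = 4 Im z/|z+i|²` and `1 - |Z|² ≤ 2(1 - |Z|)`. Points at bounded height approach
the boundary of the disk only as fast as `|z|⁻²`. -/
lemma toDisk_norm_le {z : ℂ} {δ : ℝ} (hδ : 0 < δ) (hz : δ ≤ z.im) :
    2 * δ / (1 + ‖z‖) ^ 2 ≤ 1 - ‖toDisk z‖ := by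
  have hz0 : 0 < z.im := hδ.trans_le hz
  have h1 := add_I_ne_zero hz0
  have h2 : ‖z + I‖ ≤ 1 + ‖z‖ := by
    have := norm_add_le z I
    rw [Complex.norm_I] at this
    linarith
  have h3 := toDisk_norm_lt_one hz0
  have h0 : 0 < ‖z + I‖ := norm_pos_iff.mpr h1
  have h4 : 1 - ‖toDisk z‖ ^ 2 = 4 * z.im / ‖z + I‖ ^ 2 := by
    rw [toDisk, norm_div, div_pow, eq_div_iff (by positivity), sub_mul, div_mul_cancel₀ _
      (by positivity), one_mul, ← Complex.normSq_eq_norm_sq, ← Complex.normSq_eq_norm_sq,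
      Complex.normSq_apply, Complex.normSq_apply]
    simp
    ring
  have h5 : 4 * δ / (1 + ‖z‖) ^ 2 ≤ 1 - ‖toDisk z‖ ^ 2 := by
    rw [h4]
    gcongr
  have h6 : 4 * δ / (1 + ‖z‖) ^ 2 = 2 * (2 * δ / (1 + ‖z‖) ^ 2) := by ring
  nlinarith [norm_nonneg (toDisk z)]

/-- For an exponent `m`, `(m+1) q^m ≤ ∑_{i ≤ m} q^i ≤ 1/(1-q) ≤ 1/s`. Taking `m = ⌊n/k⌋` and raising
to the `k`-th power gives decay of order `k` in `n`, at the cost of `s^{-k}`, which moments can pay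
for. -/
lemma pow_le_of_le_one_sub {q s : ℝ} (hq : 0 ≤ q) (hs : 0 < s) (hqs : s ≤ 1 - q) (n k : ℕ) :
    q ^ n ≤ (k / (s * ((n : ℝ) + 1))) ^ k := by
  rcases Nat.eq_zero_or_pos k with rfl | hk
  · simpa using pow_le_one₀ hq (by linarith)
  set m := n / k with hm
  have hmk : k * m ≤ n := Nat.mul_div_le n k
  have hkm : (n : ℝ) + 1 ≤ k * ((m : ℝ) + 1) := by
    have := Nat.lt_mul_div_succ n hk
    exact_mod_cast this
  have h1 : q ^ m * (s * ((m : ℝ) + 1)) ≤ 1 := by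
    have hg : (1 - q) * ∑ i ∈ Finset.range (m + 1), q ^ i = 1 - q ^ (m + 1) := mul_neg_geom_sum q _
    have hs2 : ((m : ℝ) + 1) * q ^ m ≤ ∑ i ∈ Finset.range (m + 1), q ^ i := by
      have : ∑ i ∈ Finset.range (m + 1), q ^ m ≤ ∑ i ∈ Finset.range (m + 1), q ^ i :=
        Finset.sum_le_sum fun i hi => pow_le_pow_of_le_one hq (by linarith)
          (by have := Finset.mem_range.mp hi; omega)
      simpa using this
    have h3 : 0 ≤ q ^ (m + 1) := by positivity
    calc q ^ m * (s * ((m : ℝ) + 1)) = s * (((m : ℝ) + 1) * q ^ m) := by ring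
      _ ≤ (1 - q) * ∑ i ∈ Finset.range (m + 1), q ^ i :=
          mul_le_mul hqs hs2 (by positivity) (by linarith)
      _ ≤ 1 := by linarith
  have hk0 : (0 : ℝ) < k := by exact_mod_cast hk
  have h2 : q ^ m ≤ k / (s * ((n : ℝ) + 1)) := by
    rw [le_div_iff₀ (by positivity)]
    have h3 : q ^ m * (s * ((n : ℝ) + 1)) ≤ q ^ m * (s * (k * ((m : ℝ) + 1))) := by gcongr
    nlinarith
  calc q ^ n ≤ q ^ (m * k) := pow_le_pow_of_le_one hq (by linarith) (by rwa [mul_comm])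
    _ = (q ^ m) ^ k := pow_mul q m k
    _ ≤ _ := by gcongr

open MeasureTheory in
/-- Integrals of the functions `(z - t)^{-r}` over families of points of the upper half-plane. -/
theorem dualitySmooth_integral {Ω : Type*} [MeasurableSpace Ω] {μ : Measure Ω} {r : ℝ} (hr : 0 < r)
    {ζ g : Ω → ℂ} (hζ : Measurable ζ) (hgm : AEStronglyMeasurable g μ) {δ : ℝ} (hδ : 0 < δ)
    (hIm : ∀ᵐ ω ∂μ, δ ≤ (ζ ω).im)
    (hint : ∀ k : ℕ, Integrable (fun ω => ‖g ω‖ * (1 + ‖ζ ω‖) ^ k) μ) {f : ℂ → ℂ}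
    (hf : ∀ t : ℂ, t.im < 0 → f t = ∫ ω, g ω * (ζ ω - t) ^ (-r : ℂ) ∂μ) {h : ℂ → ℂ}
    (hh : DifferentiableOn ℂ h {z : ℂ | 0 < z.im}) (hg : ModerateGrowth h) :
    dualitySmooth r h f = (-2 * I) ^ (r : ℂ) * ∫ ω, g ω * h (ζ ω) ∂μ := by
  set Z : Ω → ℂ := fun ω => toDisk (ζ ω) with hZ
  set e : Ω → ℂ := fun ω => ((ζ ω + I) / (2 * I)) ^ (-r : ℂ) with he
  have hZm : Measurable Z := by
    rw [hZ]; unfold toDisk; fun_prop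
  have hem : Measurable e := by fun_prop
  have hZ1 : ∀ᵐ ω ∂μ, ‖Z ω‖ < 1 := by
    filter_upwards [hIm] with ω hω
    exact toDisk_norm_lt_one (hδ.trans_le hω)
  have hle : ∀ᵐ ω ∂μ, ‖e ω‖ ≤ 2 ^ r := by
    filter_upwards [hIm] with ω hω
    have h1 : 1 ≤ ‖ζ ω + I‖ := by
      have h2 := Complex.abs_im_le_norm (ζ ω + I)
      simp only [Complex.add_im, Complex.I_im] at h2
      rw [abs_of_pos (by linarith)] at h2
      linarith
    have h3 : ‖(2 * I : ℂ)‖ = 2 := by simp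
    rw [he, ← Complex.ofReal_neg, Complex.norm_cpow_real, norm_div, h3, Real.rpow_neg (by positivity),
      ← Real.inv_rpow (by positivity), inv_div]
    refine Real.rpow_le_rpow (by positivity) ?_ hr.le
    exact div_le_self two_pos.le h1
  have hgi : Integrable (fun ω => ‖g ω‖) μ := by simpa using hint 0
  have hE_int : ∀ n, Integrable (fun ω => ‖g ω * e ω * Z ω ^ n‖) μ := by
    intro n
    refine (hgi.mul_const (2 ^ r)).mono'
      ((hgm.mul hem.aestronglyMeasurable).mul (hZm.pow_const n).aestronglyMeasurable).norm ?_
    filter_upwards [hZ1, hle] with ω h1 h2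
    rw [norm_norm, norm_mul, norm_mul, norm_pow]
    have h3 : ‖Z ω‖ ^ n ≤ 1 := pow_le_one₀ (norm_nonneg _) h1.le
    calc ‖g ω‖ * ‖e ω‖ * ‖Z ω‖ ^ n ≤ ‖g ω‖ * 2 ^ r * 1 := by gcongr
      _ = _ := mul_one _
  have hE_sum : ∀ k : ℕ, Summable fun n : ℕ =>
      (∫ ω, ‖g ω * e ω * Z ω ^ n‖ ∂μ) * ((n : ℝ) + 1) ^ k := by
    intro k
    -- A moment of order `2j` of `1 + ‖ζ‖` buys a factor `(n+1)^{-j}`: `k` powers are wanted, and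
    -- two more for summability.
    set j := k + 2 with hj
    set A : ℝ := (j / (2 * δ)) ^ j * 2 ^ r * ∫ ω, ‖g ω‖ * (1 + ‖ζ ω‖) ^ (2 * j) ∂μ with hA
    have hSs : Summable fun n : ℕ => 1 / ((n : ℝ) + 1) ^ 2 := by
      have := (summable_nat_add_iff (f := fun n : ℕ => 1 / (n : ℝ) ^ 2) 1).mpr
        (Real.summable_one_div_nat_pow.mpr one_lt_two)
      simpa using this
    refine Summable.of_nonneg_of_le (fun n => by positivity) (fun n => ?_) (hSs.mul_left A)
    have hn : (0 : ℝ) < (n : ℝ) + 1 := by positivity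
    have hEn : ∫ ω, ‖g ω * e ω * Z ω ^ n‖ ∂μ ≤ A / ((n : ℝ) + 1) ^ j := by
      rw [hA, ← integral_const_mul, ← integral_div]
      refine integral_mono_ae (hE_int n) (((hint (2 * j)).const_mul _).div_const _) ?_
      filter_upwards [hIm, hle] with ω h1 h2
      have h3 := toDisk_norm_le hδ h1
      have h4 := pow_le_of_le_one_sub (norm_nonneg (Z ω)) (by positivity) h3 n j
      rw [norm_mul, norm_mul, norm_pow]
      calc ‖g ω‖ * ‖e ω‖ * ‖Z ω‖ ^ n
          ≤ ‖g ω‖ * 2 ^ r * (j / (2 * δ / (1 + ‖ζ ω‖) ^ 2 * ((n : ℝ) + 1))) ^ j := by gcongr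
        _ = (j / (2 * δ)) ^ j * 2 ^ r * (‖g ω‖ * (1 + ‖ζ ω‖) ^ (2 * j)) / ((n : ℝ) + 1) ^ j := by
          have e1 : (j : ℝ) / (2 * δ / (1 + ‖ζ ω‖) ^ 2 * ((n : ℝ) + 1)) =
              j / (2 * δ) * (1 + ‖ζ ω‖) ^ 2 / ((n : ℝ) + 1) := by field_simp
          rw [e1, div_pow, mul_pow, pow_mul]
          ring
    calc (∫ ω, ‖g ω * e ω * Z ω ^ n‖ ∂μ) * ((n : ℝ) + 1) ^ k
        ≤ A / ((n : ℝ) + 1) ^ j * ((n : ℝ) + 1) ^ k := by gcongr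
      _ = A * (1 / ((n : ℝ) + 1) ^ 2) := by rw [hj, pow_add]; field_simp
  have hE_int' : ∀ n, Integrable (fun ω => g ω * e ω * Z ω ^ n) μ := fun n =>
    (integrable_norm_iff ((hgm.mul hem.aestronglyMeasurable).mul
      (hZm.pow_const n).aestronglyMeasurable)).mp (hE_int n)
  set d : ℕ → ℂ := fun n => ∫ ω, g ω * e ω * Z ω ^ n ∂μ with hd
  have hd_le : ∀ n, ‖d n‖ ≤ ∫ ω, ‖g ω * e ω * Z ω ^ n‖ ∂μ := fun n => norm_integral_le_integral_norm _
  have hw_le := inv_dualWeight_le hr (Nat.le_ceil r)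
  have hw_norm : ∀ n, ‖(((dualWeight r n)⁻¹ : ℝ) : ℂ)‖ = (dualWeight r n)⁻¹ := fun n => by
    rw [Complex.norm_real, Real.norm_of_nonneg (inv_pos.mpr (dualWeight_pos hr n)).le]
  -- Expanding `(1 - xZ)^{-r}` under the integral gives the Taylor coefficients of `f⁻`; rapid decay
  -- comes from the moment bounds.
  have hfe : HasRapidExpansion r f fun n => ((dualWeight r n)⁻¹ : ℝ) * d n := by
    refine ⟨fun k => ?_, fun x hx => ?_⟩
    · refine Summable.of_nonneg_of_le (fun n => by positivity) (fun n => ?_) (hE_sum (⌈r⌉₊ + k))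
      rw [norm_mul, hw_norm]
      calc (dualWeight r n)⁻¹ * ‖d n‖ * ((n : ℝ) + 1) ^ k
          ≤ ((n : ℝ) + 1) ^ ⌈r⌉₊ * (∫ ω, ‖g ω * e ω * Z ω ^ n‖ ∂μ) * ((n : ℝ) + 1) ^ k := by
            have := hd_le n
            have := hw_le n
            gcongr
        _ = _ := by rw [pow_add]; ring
    · have hx1 : ‖x‖ < 1 := by simpa using hx
      have hs := hasSum_integral_of_summable_integral_norm (μ := μ)
        (F := fun (n : ℕ) ω => ((dualWeight r n)⁻¹ : ℝ) * x ^ n * (g ω * e ω * Z ω ^ n))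
        (fun n => (hE_int' n).const_mul _) (by
          refine Summable.of_nonneg_of_le (fun n => by positivity) (fun n => ?_) (hE_sum ⌈r⌉₊)
          simp only [norm_mul (_ * x ^ _), norm_mul _ (x ^ _), hw_norm]
          rw [integral_const_mul]
          have h1 := hw_le n
          have h2 : ‖x ^ n‖ ≤ 1 := by
            rw [norm_pow]; exact pow_le_one₀ (norm_nonneg _) hx1.le
          have h3 : 0 ≤ ∫ ω, ‖g ω * e ω * Z ω ^ n‖ ∂μ := integral_nonneg fun _ => norm_nonneg _
          calc (dualWeight r n)⁻¹ * ‖x ^ n‖ * ∫ ω, ‖g ω * e ω * Z ω ^ n‖ ∂μ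
              ≤ ((n : ℝ) + 1) ^ ⌈r⌉₊ * 1 * ∫ ω, ‖g ω * e ω * Z ω ^ n‖ ∂μ := by gcongr
            _ = _ := by ring)
      have e1 : (fun n : ℕ => ∫ ω, ((dualWeight r n)⁻¹ : ℝ) * x ^ n * (g ω * e ω * Z ω ^ n) ∂μ) =
          fun n => ((dualWeight r n)⁻¹ : ℝ) * d n * x ^ n := by
        ext n
        rw [integral_const_mul, hd]
        ring
      have e2 : ∫ ω, ∑' n : ℕ, ((dualWeight r n)⁻¹ : ℝ) * x ^ n * (g ω * e ω * Z ω ^ n) ∂μ =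
          diskModel r f x := by
        rw [diskModel, hf _ (cayleyInv_im_neg hx), ← integral_const_mul]
        refine integral_congr_ae ?_
        filter_upwards [hIm, hZ1] with ω h1 h2
        have h3 : ‖x * Z ω‖ < 1 := by
          rw [norm_mul]
          nlinarith [norm_nonneg x, norm_nonneg (Z ω)]
        have h4 := ((hasSum_one_sub_cpow (r := r) h3).mul_left (g ω * e ω)).tsum_eq
        have h5 := kernel_disk r (hδ.trans_le h1) hx
        calc ∑' n : ℕ, (((dualWeight r n)⁻¹ : ℝ) : ℂ) * x ^ n * (g ω * e ω * Z ω ^ n)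
            = ∑' n : ℕ, g ω * e ω * ((((dualWeight r n)⁻¹ : ℝ) : ℂ) * (x * Z ω) ^ n) := by
              refine tsum_congr fun n => ?_
              rw [mul_pow]; ring
          _ = g ω * (e ω * (1 - x * Z ω) ^ (-r : ℂ)) := by rw [h4]; ring
          _ = _ := by rw [← h5]; ring
      rw [e1, e2] at hs
      exact hs
  obtain ⟨H, hH, hHg⟩ := exists_upperExpansion hr hh hg
  rw [dualitySmooth_eq_tsum hr hH hHg hfe]
  obtain ⟨C, K, hC⟩ := hHg
  have hs := hasSum_integral_of_summable_integral_norm (μ := μ)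
    (F := fun (n : ℕ) ω => H n * (g ω * e ω * Z ω ^ n))
    (fun n => (hE_int' n).const_mul _) (by
      refine Summable.of_nonneg_of_le (fun n => by positivity) (fun n => ?_) ((hE_sum K).mul_left C)
      simp only [norm_mul (H _)]
      rw [integral_const_mul]
      have h1 := hC n
      have h3 : 0 ≤ ∫ ω, ‖g ω * e ω * Z ω ^ n‖ ∂μ := integral_nonneg fun _ => norm_nonneg _
      calc ‖H n‖ * ∫ ω, ‖g ω * e ω * Z ω ^ n‖ ∂μ
          ≤ C * ((n : ℝ) + 1) ^ K * ∫ ω, ‖g ω * e ω * Z ω ^ n‖ ∂μ := by gcongr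
        _ = _ := by ring)
  -- The weights cancel here; the remaining series `∑ H_n Z^n` resums to `h⁺` at `ζ ω`.
  have e1 : (fun n : ℕ => ∫ ω, H n * (g ω * e ω * Z ω ^ n) ∂μ) =
      fun n => H n * ((((dualWeight r n)⁻¹ : ℝ) : ℂ) * d n * dualWeight r n) := by
    ext n
    have : (dualWeight r n : ℂ) ≠ 0 := by exact_mod_cast (dualWeight_pos hr n).ne'
    rw [integral_const_mul, hd]
    push_cast
    field_simp
  rw [e1] at hs
  rw [hs.tsum_eq, ← integral_const_mul]
  refine integral_congr_ae ?_
  filter_upwards [hIm, hZ1] with ω h1 h2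
  have hω := hδ.trans_le h1
  have h3 := ((hH (Z ω) (by simpa using h2)).mul_left (g ω * e ω)).tsum_eq
  have h4 := kernel_upper r hω
  rw [upperModel, ofDisk_toDisk (add_I_ne_zero hω)] at h3
  calc ∑' n : ℕ, H n * (g ω * e ω * Z ω ^ n) = ∑' n : ℕ, g ω * e ω * (H n * Z ω ^ n) :=
        tsum_congr fun n => by ring
    _ = _ := by rw [h3, ← h4]; ring

/-! ### The Feynman parametrization -/

/-- The beta density `u^{β - 1} (1 - u)^{α - 1}`, without normalization. -/
def betaWeight (α β u : ℝ) : ℝ := u ^ (β - 1) * (1 - u) ^ (α - 1)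

lemma ofReal_betaWeight (α β : ℝ) {u : ℝ} (hu : u ∈ Set.Icc (0 : ℝ) 1) :
    ((betaWeight α β u : ℝ) : ℂ) =
      (u : ℂ) ^ ((β : ℂ) - 1) * (1 - (u : ℂ)) ^ ((α : ℂ) - 1) := by
  rw [betaWeight]
  push_cast
  rw [Complex.ofReal_cpow hu.1, Complex.ofReal_cpow (sub_nonneg.mpr hu.2)]
  push_cast
  rfl

lemma intervalIntegrable_betaWeight {α β : ℝ} (hα : 0 < α) (hβ : 0 < β) :
    IntervalIntegrable (betaWeight α β) MeasureTheory.volume 0 1 := by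
  have h := Complex.betaIntegral_convergent (u := β) (v := α) (by simpa) (by simpa)
  have h2 : IntervalIntegrable (fun u => ((betaWeight α β u : ℝ) : ℂ)) MeasureTheory.volume 0 1 := by
    refine h.congr ?_
    intro u hu
    rw [Set.uIoc_of_le zero_le_one] at hu
    exact (ofReal_betaWeight α β ⟨hu.1.le, hu.2⟩).symm
  rw [intervalIntegrable_iff] at h2 ⊢
  exact h2.re

lemma integral_betaWeight {α β : ℝ} (hα : 0 < α) (hβ : 0 < β) :
    ∫ u in (0 : ℝ)..1, betaWeight α β u = ProbabilityTheory.beta α β := by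
  have h : ((∫ u in (0 : ℝ)..1, betaWeight α β u : ℝ) : ℂ) = Complex.betaIntegral β α := by
    rw [← intervalIntegral.integral_ofReal, Complex.betaIntegral]
    refine intervalIntegral.integral_congr fun u hu => ?_
    rw [Set.uIcc_of_le zero_le_one] at hu
    exact ofReal_betaWeight α β hu
  rw [Complex.betaIntegral_eq_Gamma_mul_div _ _ (by simpa) (by simpa)] at h
  rw [ProbabilityTheory.beta]
  apply Complex.ofReal_injective
  rw [h]
  push_cast
  rw [← Complex.Gamma_ofReal, ← Complex.Gamma_ofReal, ← Complex.Gamma_ofReal]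
  push_cast
  rw [add_comm (β : ℂ), mul_comm (Complex.Gamma β)]

lemma Gamma_add_nat {a : ℝ} (ha : 0 < a) (k : ℕ) :
    Real.Gamma (a + k) = Real.Gamma a * (ascPochhammer ℝ k).eval a := by
  induction k with
  | zero => simp
  | succ k ih =>
    have h : a + k ≠ 0 := by positivity
    rw [ascPochhammer_succ_eval, ← mul_assoc, ← ih, Nat.cast_succ, ← add_assoc,
      Real.Gamma_add_one h, mul_comm]

/-- By `Γ(a+k) = Γ(a)(a)_k`. This is Feynman's formula coefficient by coefficient: the left side
arises from expanding `((1-u)a + ub)^n` under the beta integral, the right side from the product of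
two binomial series. -/
lemma beta_add_nat {α β : ℝ} (hα : 0 < α) (hβ : 0 < β) (k l : ℕ) :
    (dualWeight (α + β) (k + l))⁻¹ * (((k + l).choose k : ℝ) * ProbabilityTheory.beta (α + k) (β + l)) =
      ProbabilityTheory.beta α β * ((dualWeight α k)⁻¹ * (dualWeight β l)⁻¹) := by
  have e : α + k + (β + l) = α + β + ((k + l : ℕ) : ℝ) := by push_cast; ring
  have hch : (((k + l).choose k : ℕ) : ℝ) = (k + l).factorial / (k.factorial * l.factorial) := by
    have := Nat.add_choose_mul_factorial_mul_factorial k l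
    rw [← Nat.choose_symm_add] at this
    have h2 : (((k + l).choose k : ℕ) : ℝ) * k.factorial * l.factorial = (k + l).factorial := by
      exact_mod_cast this
    rw [← h2]
    field_simp
  rw [ProbabilityTheory.beta, ProbabilityTheory.beta, e, Gamma_add_nat hα, Gamma_add_nat hβ,
    Gamma_add_nat (by positivity), hch, dualWeight, dualWeight, dualWeight]
  have h1 := (ascPochhammer_pos (k + l) (α + β) (by positivity)).ne'
  have h2 := (Real.Gamma_pos_of_pos (add_pos hα hβ)).ne'
  have h3 : ((k + l).factorial : ℝ) ≠ 0 := by positivity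
  field_simp

lemma rpow_add_nat_sub_one {x a : ℝ} (hx : 0 ≤ x) (ha : 0 < a) (l : ℕ) :
    x ^ (a + l - 1) = x ^ (a - 1) * x ^ l := by
  rcases Nat.eq_zero_or_pos l with rfl | hl
  · simp
  · have hl1 : (1 : ℝ) ≤ l := by exact_mod_cast hl
    rw [← Real.rpow_natCast, ← Real.rpow_add' hx (by linarith)]
    congr 1
    ring

lemma betaWeight_add_nat {α β : ℝ} (hα : 0 < α) (hβ : 0 < β) (k l : ℕ) {u : ℝ}
    (hu : u ∈ Set.Icc (0 : ℝ) 1) :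
    betaWeight (α + k) (β + l) u = betaWeight α β u * ((1 - u) ^ k * u ^ l) := by
  rw [betaWeight, betaWeight, rpow_add_nat_sub_one hu.1 hβ,
    rpow_add_nat_sub_one (sub_nonneg.mpr hu.2) hα]
  ring

lemma integral_betaWeight_mul_pow {α β : ℝ} (hα : 0 < α) (hβ : 0 < β) (a b : ℂ) (n : ℕ) :
    ∫ u in (0 : ℝ)..1, (betaWeight α β u : ℂ) * ((1 - u) * a + u * b) ^ n =
      ∑ p ∈ Finset.HasAntidiagonal.antidiagonal n, ((n.choose p.1 : ℝ) *
        ProbabilityTheory.beta (α + p.1) (β + p.2) : ℝ) * (a ^ p.1 * b ^ p.2) := by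
  have h1 : ∀ u ∈ Set.uIcc (0 : ℝ) 1, (betaWeight α β u : ℂ) * ((1 - u) * a + u * b) ^ n =
      ∑ p ∈ Finset.HasAntidiagonal.antidiagonal n, ((n.choose p.1 : ℂ) * (a ^ p.1 * b ^ p.2)) *
        (betaWeight (α + p.1) (β + p.2) u : ℂ) := by
    intro u hu
    rw [Set.uIcc_of_le zero_le_one] at hu
    rw [Commute.add_pow' (Commute.all _ _), Finset.mul_sum]
    refine Finset.sum_congr rfl fun p _ => ?_
    rw [betaWeight_add_nat hα hβ _ _ hu, nsmul_eq_mul, mul_pow, mul_pow]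
    push_cast
    ring
  rw [intervalIntegral.integral_congr h1, intervalIntegral.integral_finsetSum]
  · refine Finset.sum_congr rfl fun p _ => ?_
    rw [intervalIntegral.integral_const_mul, intervalIntegral.integral_ofReal,
      integral_betaWeight (by positivity) (by positivity)]
    push_cast
    ring
  · intro p _
    have h := intervalIntegrable_betaWeight (α := α + p.1) (β := β + p.2) (by positivity)
      (by positivity)
    have h2 : IntervalIntegrable (fun u => ((betaWeight (α + p.1) (β + p.2) u : ℝ) : ℂ))
      MeasureTheory.volume 0 1 := ⟨h.1.ofReal, h.2.ofReal⟩
    exact h2.const_mul _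

/-- The Feynman parametrization in the unit disk. -/
lemma feynman_disk {α β : ℝ} (hα : 0 < α) (hβ : 0 < β) {a b : ℂ} (ha : ‖a‖ < 1) (hb : ‖b‖ < 1) :
    ProbabilityTheory.beta α β * ((1 - a) ^ (-α : ℂ) * (1 - b) ^ (-β : ℂ)) =
      ∫ u in (0 : ℝ)..1, (betaWeight α β u : ℂ) *
        (1 - ((1 - u) * a + u * b)) ^ (-(α + β : ℝ) : ℂ) := by
  have hαβ : 0 < α + β := by positivity
  set q := max ‖a‖ ‖b‖ with hq
  have hq0 : 0 ≤ q := le_max_of_le_left (norm_nonneg _)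
  have hq1 : q < 1 := max_lt ha hb
  have hw : ∀ n, 0 < (dualWeight (α + β) n)⁻¹ := fun n => inv_pos.mpr (dualWeight_pos hαβ n)
  have hqs : Summable fun n => (dualWeight (α + β) n)⁻¹ * q ^ n := by
    have := (hasSum_one_sub_cpow (r := α + β) (x := (q : ℂ)) (by
      rwa [Complex.norm_real, Real.norm_of_nonneg hq0])).summable.norm
    refine this.congr fun n => ?_
    rw [norm_mul, norm_pow, Complex.norm_real, Complex.norm_real, Real.norm_of_nonneg hq0,
      Real.norm_of_nonneg (hw n).le]
  have hnorm : ∀ u ∈ Set.Icc (0 : ℝ) 1, ‖(1 - u) * a + u * b‖ ≤ q := by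
    intro u hu
    refine (norm_add_le _ _).trans ?_
    have h1 : ‖(1 - u : ℂ)‖ = 1 - u := by
      rw [← Complex.ofReal_one, ← Complex.ofReal_sub, Complex.norm_real,
        Real.norm_of_nonneg (sub_nonneg.mpr hu.2)]
    rw [norm_mul, norm_mul, h1, Complex.norm_real, Real.norm_of_nonneg hu.1]
    have h2 : ‖a‖ ≤ q := le_max_left _ _
    have h3 : ‖b‖ ≤ q := le_max_right _ _
    nlinarith [hu.1, hu.2, mul_le_mul_of_nonneg_left h2 (sub_nonneg.mpr hu.2),
      mul_le_mul_of_nonneg_left h3 hu.1]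
  -- By convexity `(1-u)a + ub` stays in the disk of radius `q < 1`, so the binomial series may be
  -- integrated termwise; the result is a Cauchy product.
  have hs := intervalIntegral.hasSum_integral_of_dominated_convergence
    (μ := MeasureTheory.volume) (a := 0) (b := 1)
    (F := fun (n : ℕ) (u : ℝ) => ((dualWeight (α + β) n)⁻¹ : ℝ) *
      ((betaWeight α β u : ℂ) * ((1 - u) * a + u * b) ^ n))
    (f := fun u : ℝ => (betaWeight α β u : ℂ) *
        (1 - ((1 - u) * a + u * b)) ^ (-(α + β : ℝ) : ℂ))
    (fun n u => (dualWeight (α + β) n)⁻¹ * q ^ n * ‖betaWeight α β u‖) ?_ ?_ ?_ ?_ ?_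
  · have ht : ∀ n : ℕ, ∫ u in (0 : ℝ)..1, (((dualWeight (α + β) n)⁻¹ : ℝ) : ℂ) *
      ((betaWeight α β u : ℂ) * ((1 - u) * a + u * b) ^ n) = ProbabilityTheory.beta α β *
        ∑ p ∈ Finset.HasAntidiagonal.antidiagonal n, (((dualWeight α p.1)⁻¹ : ℝ) * a ^ p.1) *
          (((dualWeight β p.2)⁻¹ : ℝ) * b ^ p.2) := by
      intro n
      rw [intervalIntegral.integral_const_mul, integral_betaWeight_mul_pow hα hβ, Finset.mul_sum,
        Finset.mul_sum]
      refine Finset.sum_congr rfl fun p hp => ?_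
      obtain rfl := Finset.HasAntidiagonal.mem_antidiagonal.mp hp
      rw [← mul_assoc, ← Complex.ofReal_mul, beta_add_nat hα hβ]
      push_cast
      ring
    simp only [ht] at hs
    rw [← hs.tsum_eq, tsum_mul_left]
    congr 1
    have h1 := hasSum_one_sub_cpow (r := α) ha
    have h2 := hasSum_one_sub_cpow (r := β) hb
    rw [← h1.tsum_eq, ← h2.tsum_eq]
    exact tsum_mul_tsum_eq_tsum_sum_antidiagonal_of_summable_norm h1.summable.norm h2.summable.norm
  · intro n
    have h1 : MeasureTheory.AEStronglyMeasurable (fun u : ℝ => (betaWeight α β u : ℂ))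
        (MeasureTheory.volume.restrict (Set.uIoc 0 1)) :=
      (intervalIntegrable_iff.mp (intervalIntegrable_betaWeight hα hβ)).ofReal.aestronglyMeasurable
    refine (h1.mul ?_).const_mul _
    apply Continuous.aestronglyMeasurable
    fun_prop
  · refine fun n => Filter.Eventually.of_forall fun u hu => ?_
    rw [Set.uIoc_of_le zero_le_one] at hu
    have h1 := hnorm u ⟨hu.1.le, hu.2⟩
    rw [norm_mul, norm_mul, norm_pow, Complex.norm_real, Complex.norm_real,
      Real.norm_of_nonneg (hw n).le]
    calc (dualWeight (α + β) n)⁻¹ * (‖betaWeight α β u‖ * ‖(1 - u) * a + u * b‖ ^ n)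
        ≤ (dualWeight (α + β) n)⁻¹ * (‖betaWeight α β u‖ * q ^ n) := by
          have := (hw n).le
          gcongr
      _ = _ := by ring
  · exact Filter.Eventually.of_forall fun u _ => hqs.mul_right _
  · simp only [tsum_mul_right]
    exact (intervalIntegrable_betaWeight hα hβ).norm.const_mul _
  · refine Filter.Eventually.of_forall fun u hu => ?_
    rw [Set.uIoc_of_le zero_le_one] at hu
    have h1 := hnorm u ⟨hu.1.le, hu.2⟩
    have h2 := (hasSum_one_sub_cpow (r := α + β) (h1.trans_lt hq1)).mul_left (betaWeight α β u : ℂ)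
    simpa only [mul_left_comm] using h2

/-- The Feynman parametrization in the upper half-plane. -/
lemma feynman {α β : ℝ} (hα : 0 < α) (hβ : 0 < β) {A B : ℂ} (hA : 0 < A.im) (hB : 0 < B.im) :
    ProbabilityTheory.beta α β * (A ^ (-α : ℂ) * B ^ (-β : ℂ)) =
      ∫ u in (0 : ℝ)..1, (betaWeight α β u : ℂ) *
        ((1 - u) * A + u * B) ^ (-(α + β : ℝ) : ℂ) := by
  -- The disk `|D - iN| < N` is `|D|² < 2N Im D`; these disks exhaust the upper half-plane as `N`
  -- grows. Rescaling by `iN` reduces to the disk version.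
  have key : ∀ D : ℂ, 0 < D.im → ∀ N : ℝ, ‖D‖ ^ 2 / (2 * D.im) < N → ‖1 - D / (I * N)‖ < 1 := by
    intro D hD N hN
    have hN0 : 0 < N := lt_of_le_of_lt (by positivity) hN
    rw [div_lt_iff₀ (by positivity)] at hN
    have hNc : (N : ℂ) ≠ 0 := by exact_mod_cast hN0.ne'
    have e : 1 - D / (I * N) = (I * N - D) / (I * N) := by field_simp
    have e2 : ‖(I * N : ℂ)‖ = N := by
      rw [norm_mul, Complex.norm_I, one_mul, Complex.norm_real, Real.norm_of_nonneg hN0.le]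
    rw [e, norm_div, e2, div_lt_one hN0, ← sq_lt_sq₀ (norm_nonneg _) hN0.le,
      ← Complex.normSq_eq_norm_sq, Complex.normSq_apply]
    rw [← Complex.normSq_eq_norm_sq, Complex.normSq_apply] at hN
    simp
    nlinarith
  obtain ⟨N, hN⟩ := exists_gt (max (‖A‖ ^ 2 / (2 * A.im)) (‖B‖ ^ 2 / (2 * B.im)))
  have ha := key A hA N ((le_max_left _ _).trans_lt hN)
  have hb := key B hB N ((le_max_right _ _).trans_lt hN)
  have hN0 : 0 < N := lt_of_le_of_lt (by positivity) ((le_max_left _ _).trans_lt hN)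
  have hNc : (N : ℂ) ≠ 0 := by exact_mod_cast hN0.ne'
  have hIN : (I * N : ℂ) ≠ 0 := mul_ne_zero Complex.I_ne_zero hNc
  have harg : (I * N : ℂ).arg = π / 2 := by
    rw [mul_comm, Complex.arg_real_mul _ hN0, Complex.arg_I]
  have hsplit : ∀ (w s : ℂ), ‖w‖ < 1 → (I * N * (1 - w)) ^ s = (I * N) ^ s * (1 - w) ^ s := by
    intro w s hw
    have h4 : 0 < (1 - w).re := by
      have := Complex.re_le_norm w
      rw [Complex.sub_re, Complex.one_re]
      linarith
    have h6 := arg_mem_of_re_pos h4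
    exact mul_cpow_of_arg hIN (ne_zero_of_re_pos h4) (by rw [harg]; constructor <;> linarith) s
  set a := 1 - A / (I * N) with had
  set b := 1 - B / (I * N) with hbd
  have eA : A = I * N * (1 - a) := by rw [had]; field_simp; ring
  have eB : B = I * N * (1 - b) := by rw [hbd]; field_simp; ring
  have hd := feynman_disk hα hβ ha hb
  have hR : ∀ u ∈ Set.uIcc (0 : ℝ) 1, (betaWeight α β u : ℂ) *
        ((1 - u) * A + u * B) ^ (-(α + β : ℝ) : ℂ) = (I * N) ^ (-(α + β : ℝ) : ℂ) *
        ((betaWeight α β u : ℂ) * (1 - ((1 - u) * a + u * b)) ^ (-(α + β : ℝ) : ℂ)) := by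
    intro u hu
    rw [Set.uIcc_of_le zero_le_one] at hu
    have e : (1 - u) * A + u * B = I * N * (1 - ((1 - u) * a + u * b)) := by rw [eA, eB]; ring
    have h1 : ‖(1 - u) * a + u * b‖ < 1 := by
      refine (norm_add_le _ _).trans_lt ?_
      have h1 : ‖(1 - u : ℂ)‖ = 1 - u := by
        rw [← Complex.ofReal_one, ← Complex.ofReal_sub, Complex.norm_real,
          Real.norm_of_nonneg (sub_nonneg.mpr hu.2)]
      rw [norm_mul, norm_mul, h1, Complex.norm_real, Real.norm_of_nonneg hu.1]
      rcases hu.1.eq_or_lt with h | h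
      · rw [← h]; simpa using ha
      · nlinarith [hu.2, mul_le_mul_of_nonneg_left ha.le (sub_nonneg.mpr hu.2),
          mul_lt_mul_of_pos_left hb h]
    rw [e, hsplit _ _ h1]
    ring
  rw [intervalIntegral.integral_congr hR, intervalIntegral.integral_const_mul, ← hd, eA, eB,
    hsplit _ _ ha, hsplit _ _ hb]
  have e3 : (-(α + β : ℝ) : ℂ) = (-α : ℂ) + (-β : ℂ) := by push_cast; ring
  rw [e3, Complex.cpow_add _ _ hIN]
  ring

/-! ### Fourier expansions -/

/-- The exponential `e^{2π i μ z}`. -/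
def expTwoPi (μ : ℝ) (z : ℂ) : ℂ := Complex.exp (2 * π * I * μ * z)

lemma norm_expTwoPi (μ : ℝ) (z : ℂ) : ‖expTwoPi μ z‖ = Real.exp (-(2 * π * μ * z.im)) := by
  rw [expTwoPi, Complex.norm_exp]
  congr 1
  simp [Complex.mul_re, Complex.mul_im]

/-- The frequency of the `m`-th term of a Fourier expansion. -/
def freq (p : ℝ) (m : ℕ) : ℝ := (12 * m + p) / 12

lemma HasFourierExpansion.hasSum {p : ℝ} {f : ℂ → ℂ} {a : ℕ → ℂ} (h : HasFourierExpansion p f a)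
    {z : ℂ} (hz : 0 < z.im) : HasSum (fun m => a m * expTwoPi (freq p m) z) (f z) := by
  have e : (fun m => a m * expTwoPi (freq p m) z) =
      fun m : ℕ => a m * Complex.exp (2 * π * I * ((m : ℂ) + (p : ℂ) / 12) * z) := by
    ext m
    rw [expTwoPi, freq]
    push_cast
    congr 3
    field_simp
  rw [e]
  exact h z hz

lemma HasFourierExpansion.summable {p : ℝ} {f : ℂ → ℂ} {a : ℕ → ℂ} (h : HasFourierExpansion p f a)
    {y : ℝ} (hy : 0 < y) : Summable fun m => ‖a m‖ * Real.exp (-(2 * π * freq p m * y)) := by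
  have := (h.hasSum (z := I * y) (by simpa)).summable.norm
  simpa only [norm_mul, norm_expTwoPi, Complex.mul_im, Complex.I_re, Complex.I_im,
    Complex.ofReal_re, Complex.ofReal_im, zero_mul, one_mul, zero_add] using this

/-- After multiplication by `e^{2πμ_m y}` the `m`-th term is constant and later ones tend to `0`,
dominated by their values at `y = 1`. Growth conditions at the cusp thereby become vanishing of
coefficients. -/
lemma HasFourierExpansion.tendsto_leading {p : ℝ} {f : ℂ → ℂ} {a : ℕ → ℂ}
    (h : HasFourierExpansion p f a) {m : ℕ} (hm : ∀ j < m, a j = 0) :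
    Filter.Tendsto (fun y : ℝ => f (I * y) * Real.exp (2 * π * freq p m * y)) Filter.atTop
      (𝓝 (a m)) := by
  have hlim : Filter.Tendsto (fun y : ℝ => ∑' j, a j * (Real.exp (-(2 * π * ((j : ℝ) - m) * y)) : ℂ))
      Filter.atTop (𝓝 (∑' j, if j = m then a m else 0)) := by
    refine tendsto_tsum_of_dominated_convergence
      (bound := fun j => ‖a j‖ * Real.exp (-(2 * π * ((j : ℝ) - m)))) ?_ (fun j => ?_) ?_
    · refine ((h.summable one_pos).mul_right (Real.exp (2 * π * freq p m))).congr fun j => ?_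
      rw [mul_assoc, ← Real.exp_add]
      congr 2
      rw [freq, freq]
      ring
    · split_ifs with hj
      · subst hj
        simp
      · rcases lt_or_gt_of_ne hj with hj | hj
        · simp [hm j hj]
        · have hjm : (0 : ℝ) < (j : ℝ) - m := by
            have : (m : ℝ) < j := by exact_mod_cast hj
            linarith
          have h1 : Filter.Tendsto (fun y : ℝ => Real.exp (-(2 * π * ((j : ℝ) - m) * y)))
              Filter.atTop (𝓝 0) :=
            Real.tendsto_exp_neg_atTop_nhds_zero.comp
              (Filter.tendsto_id.const_mul_atTop (by positivity))
          have h2 := ((Complex.continuous_ofReal.tendsto 0).comp h1).const_mul (a j)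
          simpa using h2
    · filter_upwards [Filter.eventually_ge_atTop 1] with y hy j
      rw [norm_mul, Complex.norm_real, Real.norm_of_nonneg (Real.exp_pos _).le]
      rcases lt_or_ge j m with hj | hj
      · simp [hm j hj]
      · have hjm : (0 : ℝ) ≤ (j : ℝ) - m := by
          have : (m : ℝ) ≤ j := by exact_mod_cast hj
          linarith
        have hpi := Real.pi_pos
        have h3 : 2 * π * ((j : ℝ) - m) ≤ 2 * π * ((j : ℝ) - m) * y :=
          le_mul_of_one_le_right (by positivity) hy
        gcongr
  rw [tsum_ite_eq] at hlim
  refine hlim.congr' ?_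
  filter_upwards [Filter.eventually_gt_atTop 0] with y hy
  rw [← (h.hasSum (z := I * y) (by simpa)).tsum_eq, ← tsum_mul_right]
  refine tsum_congr fun j => ?_
  rw [mul_assoc (a j), expTwoPi, Complex.ofReal_exp, Complex.ofReal_exp, ← Complex.exp_add]
  congr 2
  rw [freq, freq]
  push_cast
  linear_combination (-(2 * π * ((12 * (j : ℂ) + p) / 12) * y)) * Complex.I_sq

lemma HasFourierExpansion.coeff_eq_zero {p : ℝ} {f : ℂ → ℂ} {a : ℕ → ℂ}
    (h : HasFourierExpansion p f a) (m : ℕ)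
    (hf : ∀ j ≤ m, Filter.Tendsto (fun y : ℝ => f (I * y) * Real.exp (2 * π * freq p j * y))
      Filter.atTop (𝓝 0)) : a m = 0 := by
  induction m using Nat.strong_induction_on with
  | _ m ih =>
    have h0 : ∀ j < m, a j = 0 := fun j hj => ih j hj fun i hi => hf i (hi.trans hj.le)
    exact tendsto_nhds_unique (h.tendsto_leading h0) (hf m le_rfl)

lemma freq_mono (p : ℝ) {j m : ℕ} (h : j ≤ m) : freq p j ≤ freq p m := by
  rw [freq, freq]
  have : (j : ℝ) ≤ m := by exact_mod_cast h
  gcongr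

lemma IsEntireForm.freq_nonneg {r p : ℝ} {f : ℂ → ℂ} {a : ℕ → ℂ} (hf : IsEntireForm r p f)
    (h : HasFourierExpansion p f a) {m : ℕ} (hm : a m ≠ 0) : 0 ≤ freq p m := by
  by_contra! hneg
  apply hm
  refine h.coeff_eq_zero m fun j hj => ?_
  have hj0 : freq p j < 0 := (freq_mono p hj).trans_lt hneg
  obtain ⟨M, A, hMA⟩ := UpperHalfPlane.isBoundedAtImInfty_iff.mp hf.bounded
  have h1 : Filter.Tendsto (fun y : ℝ => M * Real.exp (-((-(2 * π * freq p j)) * y)))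
      Filter.atTop (𝓝 0) := by
    have := (Real.tendsto_exp_neg_atTop_nhds_zero.comp
      (Filter.tendsto_id.const_mul_atTop (r := -(2 * π * freq p j))
        (by have := Real.pi_pos; nlinarith))).const_mul M
    simpa using this
  refine squeeze_zero_norm' ?_ h1
  filter_upwards [Filter.eventually_gt_atTop 0, Filter.eventually_ge_atTop A] with y hy hyA
  have h2 := hMA ⟨I * y, by simpa⟩ (by
    change A ≤ (I * (y : ℂ)).im
    simpa)
  change ‖f (I * y)‖ ≤ M at h2
  rw [norm_mul, Complex.norm_real, Real.norm_of_nonneg (Real.exp_pos _).le]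
  have e : -(-(2 * π * freq p j) * y) = 2 * π * freq p j * y := by ring
  rw [e]
  gcongr

lemma IsCuspForm.freq_pos {r p : ℝ} {f : ℂ → ℂ} {a : ℕ → ℂ} (hf : IsCuspForm r p f)
    (h : HasFourierExpansion p f a) {m : ℕ} (hm : a m ≠ 0) : 0 < freq p m := by
  by_contra! hneg
  apply hm
  refine h.coeff_eq_zero m fun j hj => ?_
  have hj0 : freq p j ≤ 0 := (freq_mono p hj).trans hneg
  obtain ⟨C, hC⟩ := (hf.decay 1).bound
  obtain ⟨A, hA⟩ := (UpperHalfPlane.atImInfty_mem _).mp hC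
  have h1 : Filter.Tendsto (fun y : ℝ => C * y⁻¹) Filter.atTop (𝓝 0) := by
    simpa using tendsto_inv_atTop_zero.const_mul C
  refine squeeze_zero_norm' ?_ h1
  filter_upwards [Filter.eventually_gt_atTop 0, Filter.eventually_ge_atTop A] with y hy hyA
  have h2 := hA ⟨I * y, by simpa⟩ (by
    change A ≤ (I * (y : ℂ)).im
    simpa)
  have e : (⟨I * y, by simpa⟩ : UpperHalfPlane).im = y := by
    change (I * (y : ℂ)).im = y
    simp
  simp only [Set.mem_ofPred_eq, e, Real.rpow_neg_one, norm_inv, Real.norm_of_nonneg hy.le] at h2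
  change ‖f (I * y)‖ ≤ _ at h2
  rw [norm_mul, Complex.norm_real, Real.norm_of_nonneg (Real.exp_pos _).le]
  have h3 : Real.exp (2 * π * freq p j * y) ≤ 1 := by
    rw [Real.exp_le_one_iff]
    have := Real.pi_pos
    exact mul_nonpos_of_nonpos_of_nonneg (mul_nonpos_of_nonneg_of_nonpos (by positivity) hj0) hy.le
  calc ‖f (I * y)‖ * Real.exp (2 * π * freq p j * y) ≤ ‖f (I * y)‖ * 1 := by gcongr
    _ ≤ C * y⁻¹ := by rw [mul_one]; exact h2

/-- The frequencies increase in steps of one, so the positive ones have a least element. This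
uniform gap makes the decay of a cusp form exponential. -/
lemma exists_pos_le_freq {p : ℝ} {a : ℕ → ℂ} (h : ∀ m, a m ≠ 0 → 0 < freq p m) :
    ∃ ε > 0, ∀ m, a m ≠ 0 → ε ≤ freq p m := by
  classical
  by_cases hex : ∃ m, 0 < freq p m
  · refine ⟨_, Nat.find_spec hex, fun m hm => freq_mono p (Nat.find_min' hex (h m hm))⟩
  · exact ⟨1, one_pos, fun m hm => absurd ⟨m, h m hm⟩ hex⟩

/-! ### The function `Ψ` -/

lemma psiIntegrand_eq (r₁ r₂ μ₁ μ₂ μ₃ u : ℝ) : psiIntegrand r₁ r₂ μ₁ μ₂ μ₃ u =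
    betaWeight (2 - r₁) (2 - r₂) u * ((Real.exp (-π * (2 - √3) * μ₃ * u) / (μ₂ + μ₃ * u)) *
      Real.sinc (π * (μ₁ + (1 - u) * μ₃))) := by
  rw [psiIntegrand, betaWeight]
  have e1 : 2 - r₂ - 1 = 1 - r₂ := by ring
  have e2 : 2 - r₁ - 1 = 1 - r₁ := by ring
  rw [e1, e2, mul_assoc]

lemma intervalIntegrable_psiIntegrand {r₁ r₂ μ₁ μ₂ μ₃ : ℝ} (hr₁ : r₁ < 2) (hr₂ : r₂ < 2)
    (hμ₂ : 0 < μ₂) (hμ₃ : 0 ≤ μ₃) :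
    IntervalIntegrable (psiIntegrand r₁ r₂ μ₁ μ₂ μ₃) MeasureTheory.volume 0 1 := by
  have e : psiIntegrand r₁ r₂ μ₁ μ₂ μ₃ = fun u => betaWeight (2 - r₁) (2 - r₂) u *
      ((Real.exp (-π * (2 - √3) * μ₃ * u) / (μ₂ + μ₃ * u)) *
      Real.sinc (π * (μ₁ + (1 - u) * μ₃))) := funext (psiIntegrand_eq r₁ r₂ μ₁ μ₂ μ₃)
  rw [e]
  refine (intervalIntegrable_betaWeight (by linarith) (by linarith)).mul_continuousOn ?_
  refine ContinuousOn.mul (ContinuousOn.div (by fun_prop) (by fun_prop) fun u hu => ?_)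
    (Real.continuous_sinc.comp (by fun_prop)).continuousOn
  rw [Set.uIcc_of_le zero_le_one] at hu
  have := mul_nonneg hμ₃ hu.1
  positivity

lemma psiIntegrand'_mul {r₁ r₂ μ₁ μ₂ μ₃ v : ℝ} (hμ₃ : 0 < μ₃) (hv : v ∈ Set.Icc (0 : ℝ) 1) :
    psiIntegrand' r₁ r₂ μ₁ μ₂ μ₃ (μ₃ * v) =
      μ₃ ^ (2 - r₁ - r₂) * psiIntegrand r₁ r₂ μ₁ μ₂ μ₃ v := by
  have e1 : μ₃ - μ₃ * v = μ₃ * (1 - v) := by ring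
  have e2 : 2 - r₁ - r₂ = (1 - r₂) + (1 - r₁) := by ring
  have e3 : μ₁ + μ₃ - μ₃ * v = μ₁ + (1 - v) * μ₃ := by ring
  rw [psiIntegrand', psiIntegrand, e1, Real.mul_rpow hμ₃.le hv.1,
    Real.mul_rpow hμ₃.le (sub_nonneg.mpr hv.2), e2, Real.rpow_add hμ₃, e3, ← mul_assoc (_ * _) μ₃ v]
  ring

lemma intervalIntegrable_psiIntegrand' {r₁ r₂ μ₁ μ₂ μ₃ : ℝ} (hr₁ : r₁ < 2) (hr₂ : r₂ < 2)
    (hμ₂ : 0 < μ₂) (hμ₃ : 0 < μ₃) :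
    IntervalIntegrable (psiIntegrand' r₁ r₂ μ₁ μ₂ μ₃) MeasureTheory.volume 0 μ₃ := by
  have h := ((intervalIntegrable_psiIntegrand (μ₁ := μ₁) hr₁ hr₂ hμ₂ hμ₃.le).const_mul
    (μ₃ ^ (2 - r₁ - r₂))).comp_mul_left (c := μ₃⁻¹)
  have e : (0 : ℝ) / μ₃⁻¹ = 0 ∧ (1 : ℝ) / μ₃⁻¹ = μ₃ := by simp
  rw [e.1, e.2] at h
  refine h.congr fun u hu => ?_
  rw [Set.uIoc_of_le hμ₃.le] at hu
  have h1 : μ₃ * (μ₃⁻¹ * u) = u := by field_simp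
  rw [← psiIntegrand'_mul hμ₃ ⟨by have := hu.1; positivity, by
    rw [inv_mul_le_iff₀ hμ₃, mul_one]; exact hu.2⟩, h1]

lemma integral_psiIntegrand' {r₁ r₂ μ₁ μ₂ μ₃ : ℝ} (hμ₃ : 0 < μ₃) :
    ∫ u in (0 : ℝ)..μ₃, psiIntegrand' r₁ r₂ μ₁ μ₂ μ₃ u =
      μ₃ ^ (3 - r₁ - r₂) * ∫ u in (0 : ℝ)..1, psiIntegrand r₁ r₂ μ₁ μ₂ μ₃ u := by
  have h := intervalIntegral.mul_integral_comp_mul_left (a := 0) (b := 1)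
    (f := psiIntegrand' r₁ r₂ μ₁ μ₂ μ₃) μ₃
  rw [mul_zero, mul_one] at h
  rw [← h, ← intervalIntegral.integral_const_mul, ← intervalIntegral.integral_const_mul]
  refine intervalIntegral.integral_congr fun v hv => ?_
  rw [Set.uIcc_of_le zero_le_one] at hv
  rw [psiIntegrand'_mul hμ₃ hv, ← mul_assoc]
  congr 1
  have e : 3 - r₁ - r₂ = 1 + (2 - r₁ - r₂) := by ring
  rw [e, Real.rpow_add hμ₃, Real.rpow_one]

/-- The substitution `u ↦ μ₃u` produces `μ₃^{3-r₁-r₂}`, which `μ₃^{1-r₃}` cancels because the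
weights sum to `4`. -/
lemma psi_eq_integral_psiIntegrand' {r₁ r₂ r₃ μ₁ μ₂ μ₃ : ℝ} (hr : r₁ + r₂ + r₃ = 4)
    (hμ₃ : 0 < μ₃) : psi r₁ r₂ μ₁ μ₂ μ₃ =
        -((Real.exp (-2 * π * μ₂ - π * √3 * (μ₁ + μ₃)) : ℝ) : ℂ) / (2 * π * I) *
          ((μ₃ ^ (1 - r₃) : ℝ) : ℂ) *
          ((∫ u in (0 : ℝ)..μ₃, psiIntegrand' r₁ r₂ μ₁ μ₂ μ₃ u : ℝ) : ℂ) := by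
  rw [psi, integral_psiIntegrand' hμ₃, mul_assoc _ ((μ₃ ^ (1 - r₃) : ℝ) : ℂ), ← Complex.ofReal_mul,
    ← mul_assoc (μ₃ ^ (1 - r₃)), ← Real.rpow_add hμ₃]
  have e : 1 - r₃ + (3 - r₁ - r₂) = 0 := by linarith
  rw [e, Real.rpow_zero, one_mul]

/-! ### The trilinear form as a triple integral -/

open MeasureTheory

lemma rho_eq : rho = 1 / 2 + (√3 / 2 : ℝ) * I := by
  have h : (π : ℂ) * I / 3 = ((π / 3 : ℝ) : ℂ) * I := by push_cast; ring
  rw [rho, h, Complex.exp_mul_I, ← Complex.ofReal_cos, ← Complex.ofReal_sin, Real.cos_pi_div_three,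
    Real.sin_pi_div_three]
  push_cast
  ring

/-- The point with parameter `s` on the segment from `ρ - 1` to `ρ`. -/
def horPoint (s : ℝ) : ℂ := ((s - 1 / 2 : ℝ) : ℂ) + (√3 / 2 : ℝ) * I

lemma horPoint_im (s : ℝ) : (horPoint s).im = √3 / 2 := by
  simp [horPoint]

lemma horPoint_eq (s : ℝ) : rho - 1 + s * (rho - (rho - 1)) = horPoint s := by
  rw [horPoint, rho_eq]
  push_cast
  ring

lemma norm_horPoint_le {s : ℝ} (hs : s ∈ Set.Icc (0 : ℝ) 1) : ‖horPoint s‖ ≤ 2 := by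
  refine (norm_add_le _ _).trans ?_
  rw [norm_mul, Complex.norm_I, mul_one, Complex.norm_real, Complex.norm_real,
    Real.norm_of_nonneg (by positivity : 0 ≤ √3 / 2), Real.norm_eq_abs]
  have h1 : |s - 1 / 2| ≤ 1 / 2 := abs_le.mpr ⟨by linarith [hs.1], by linarith [hs.2]⟩
  have h2 : √3 ≤ 2 := by
    rw [Real.sqrt_le_left (by norm_num)]; norm_num
  linarith

lemma continuous_horPoint : Continuous horPoint := by unfold horPoint; fun_prop

/-- The measure on the parameters `(u, (s, y))`, with `u, s` in `(0, 1]` and `y > 1`. -/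
def paramMeasure : Measure (ℝ × (ℝ × ℝ)) :=
  (volume.restrict (Set.Ioc 0 1)).prod
    ((volume.restrict (Set.Ioc 0 1)).prod (volume.restrict (Set.Ioi 1)))

/-- The point `(1 - u) z₁ + u z₂`, with `z₁` on the horizontal segment and `z₂ = i y`. -/
def paramPoint (ω : ℝ × (ℝ × ℝ)) : ℂ := (1 - ω.1) * horPoint ω.2.1 + ω.1 * (I * ω.2.2)

instance : SFinite paramMeasure := by unfold paramMeasure; infer_instance

lemma measurable_paramPoint : Measurable paramPoint := by
  have := continuous_horPoint
  unfold paramPoint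
  fun_prop

lemma ae_paramMeasure : ∀ᵐ ω ∂paramMeasure,
    ω.1 ∈ Set.Ioc (0 : ℝ) 1 ∧ ω.2.1 ∈ Set.Ioc (0 : ℝ) 1 ∧ ω.2.2 ∈ Set.Ioi (1 : ℝ) := by
  have h : paramMeasure = volume.restrict (Set.Ioc (0 : ℝ) 1 ×ˢ (Set.Ioc (0 : ℝ) 1 ×ˢ Set.Ioi 1)) := by
    rw [paramMeasure, Measure.prod_restrict, Measure.prod_restrict]
    rfl
  rw [h]
  filter_upwards [ae_restrict_mem (by measurability)] with ω hω
  exact hω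

lemma le_paramPoint_im {ω : ℝ × (ℝ × ℝ)} (h1 : ω.1 ∈ Set.Ioc (0 : ℝ) 1) (h3 : 1 < ω.2.2) :
    √3 / 2 ≤ (paramPoint ω).im := by
  have h2 : √3 ≤ 2 := by
    rw [Real.sqrt_le_left (by norm_num)]; norm_num
  have e : (paramPoint ω).im = (1 - ω.1) * (√3 / 2) + ω.1 * ω.2.2 := by
    rw [← horPoint_im ω.2.1]
    simp [paramPoint]
  rw [e]
  nlinarith [h1.1, h1.2]

/-- Moments of the point are controlled by powers of `y` alone, which the exponential decay of `f₂`
absorbs. -/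
lemma norm_paramPoint_le {ω : ℝ × (ℝ × ℝ)} (h1 : ω.1 ∈ Set.Ioc (0 : ℝ) 1)
    (h2 : ω.2.1 ∈ Set.Ioc (0 : ℝ) 1) (h3 : 1 < ω.2.2) : 1 + ‖paramPoint ω‖ ≤ 4 * ω.2.2 := by
  have h4 := norm_horPoint_le ⟨h2.1.le, h2.2⟩
  have h5 : ‖(1 - ω.1 : ℂ)‖ = 1 - ω.1 := by
    rw [← Complex.ofReal_one, ← Complex.ofReal_sub, Complex.norm_real,
      Real.norm_of_nonneg (sub_nonneg.mpr h1.2)]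
  have h6 := norm_add_le ((1 - ω.1 : ℂ) * horPoint ω.2.1) (ω.1 * (I * ω.2.2))
  rw [norm_mul, norm_mul, norm_mul, h5, Complex.norm_I, one_mul, Complex.norm_real,
    Complex.norm_real, Real.norm_of_nonneg h1.1.le, Real.norm_of_nonneg (by linarith)] at h6
  rw [paramPoint]
  nlinarith [h1.1, h1.2, mul_le_mul_of_nonneg_left h4 (sub_nonneg.mpr h1.2)]

/-- The density of the triple integral. -/
def paramDensity (r₁ r₂ : ℝ) (f₁ f₂ : ℂ → ℂ) (ω : ℝ × (ℝ × ℝ)) : ℂ :=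
  ((ProbabilityTheory.beta (2 - r₁) (2 - r₂))⁻¹ : ℝ) * betaWeight (2 - r₁) (2 - r₂) ω.1 *
    (f₁ (horPoint ω.2.1) * (f₂ (I * ω.2.2) * I))

lemma norm_coeff_mul_expTwoPi_le {p ε : ℝ} {a : ℕ → ℂ} (hε : ∀ m, a m ≠ 0 → ε ≤ freq p m) {y : ℝ}
    (hy : 1 ≤ y) (m : ℕ) :
    ‖a m * expTwoPi (freq p m) (I * y)‖ ≤
      ‖a m‖ * Real.exp (-(2 * π * freq p m * 1)) * Real.exp (-(2 * π * ε) * (y - 1)) := by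
  by_cases ha : a m = 0
  · simp [ha]
  · rw [norm_mul, norm_expTwoPi, mul_assoc ‖a m‖, ← Real.exp_add]
    have := hε m ha
    have hpi := Real.pi_pos
    have e : (I * (y : ℂ)).im = y := by simp
    rw [e]
    gcongr
    nlinarith [mul_nonneg (mul_nonneg hpi.le (sub_nonneg.mpr this)) (sub_nonneg.mpr hy)]

lemma HasFourierExpansion.exp_decay {p ε : ℝ} {f : ℂ → ℂ} {a : ℕ → ℂ}
    (h : HasFourierExpansion p f a) (hε : ∀ m, a m ≠ 0 → ε ≤ freq p m) :
    ∃ C, 0 ≤ C ∧ ∀ y : ℝ, 1 ≤ y → ‖f (I * y)‖ ≤ C * Real.exp (-(2 * π * ε) * (y - 1)) := by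
  refine ⟨∑' m, ‖a m‖ * Real.exp (-(2 * π * freq p m * 1)), tsum_nonneg fun m => by positivity,
    fun y hy => ?_⟩
  rw [← (h.hasSum (z := I * y) (by simpa using (by linarith : 0 < y))).tsum_eq, ← tsum_mul_right]
  exact tsum_of_norm_bounded ((h.summable one_pos).mul_right _).hasSum (norm_coeff_mul_expTwoPi_le hε hy)

lemma integrable_pow_mul_exp (k : ℕ) {c : ℝ} (hc : 0 < c) :
    Integrable (fun y : ℝ => y ^ k * Real.exp (-c * (y - 1))) (volume.restrict (Set.Ioi 1)) := by
  have h := (integrableOn_rpow_mul_exp_neg_mul_rpow (s := k) (p := 1) (b := c)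
    (by have : (0 : ℝ) ≤ k := by positivity
        linarith) one_pos hc).mono_set (Set.Ioi_subset_Ioi zero_le_one)
  refine (h.mul_const (Real.exp c)).congr ?_
  filter_upwards with y
  rw [Real.rpow_natCast, Real.rpow_one, mul_assoc, ← Real.exp_add]
  congr 2
  ring

lemma continuous_comp_horPoint {f : ℂ → ℂ} (hf : ContinuousOn f {z : ℂ | 0 < z.im}) :
    Continuous fun s => f (horPoint s) :=
  hf.comp_continuous continuous_horPoint fun s => by
    rw [Set.mem_ofPred_eq, horPoint_im]
    positivity

lemma aestronglyMeasurable_vertical {f : ℂ → ℂ} (hf : ContinuousOn f {z : ℂ | 0 < z.im}) :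
    AEStronglyMeasurable (fun y : ℝ => f (I * y)) (volume.restrict (Set.Ioi 1)) := by
  refine ContinuousOn.aestronglyMeasurable (hf.comp (by fun_prop) fun y hy => ?_) measurableSet_Ioi
  have : (1 : ℝ) < y := hy
  simp
  linarith

lemma integrable_betaWeight {α β : ℝ} (hα : 0 < α) (hβ : 0 < β) :
    Integrable (betaWeight α β) (volume.restrict (Set.Ioc 0 1)) :=
  (intervalIntegrable_iff_integrableOn_Ioc_of_le zero_le_one).mp (intervalIntegrable_betaWeight hα hβ)

lemma integrable_paramDensity {r₁ r₂ : ℝ} (hr₁ : r₁ < 2) (hr₂ : r₂ < 2) {f₁ f₂ : ℂ → ℂ}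
    (hf₁ : ContinuousOn f₁ {z : ℂ | 0 < z.im}) (hf₂ : ContinuousOn f₂ {z : ℂ | 0 < z.im})
    {C c : ℝ} (hC : 0 ≤ C) (hc : 0 < c)
    (hd : ∀ y : ℝ, 1 ≤ y → ‖f₂ (I * y)‖ ≤ C * Real.exp (-c * (y - 1))) :
    AEStronglyMeasurable (paramDensity r₁ r₂ f₁ f₂) paramMeasure ∧ ∀ k : ℕ,
      Integrable (fun ω => ‖paramDensity r₁ r₂ f₁ f₂ ω‖ * (1 + ‖paramPoint ω‖) ^ k) paramMeasure := by
  have hw := integrable_betaWeight (sub_pos.mpr hr₁) (sub_pos.mpr hr₂)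
  have h1 := continuous_comp_horPoint hf₁
  have h1i : Integrable (fun s => ‖f₁ (horPoint s)‖) (volume.restrict (Set.Ioc (0 : ℝ) 1)) :=
    (h1.norm.integrableOn_Icc (a := 0) (b := 1)).mono_set Set.Ioc_subset_Icc_self
  have hm : AEStronglyMeasurable (paramDensity r₁ r₂ f₁ f₂) paramMeasure := by
    refine AEStronglyMeasurable.mul ?_ ?_
    · exact ((hw.ofReal (𝕜 := ℂ)).aestronglyMeasurable.const_mul _).comp_fst
    · exact ((h1.aestronglyMeasurable.comp_fst).mul
        ((aestronglyMeasurable_vertical hf₂).mul_const I).comp_snd).comp_snd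
  refine ⟨hm, fun k => ?_⟩
  have hB : Integrable (fun ω : ℝ × (ℝ × ℝ) =>
      (‖(ProbabilityTheory.beta (2 - r₁) (2 - r₂))⁻¹‖ * ‖betaWeight (2 - r₁) (2 - r₂) ω.1‖) *
      (‖f₁ (horPoint ω.2.1)‖ * (C * 4 ^ k * (ω.2.2 ^ k * Real.exp (-c * (ω.2.2 - 1))))))
      paramMeasure :=
    (hw.norm.const_mul _).mul_prod (h1i.mul_prod ((integrable_pow_mul_exp k hc).const_mul _))
  refine hB.mono' (hm.norm.mul
    ((measurable_paramPoint.norm.const_add 1).pow_const k).aestronglyMeasurable) ?_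
  filter_upwards [ae_paramMeasure] with ω hω
  have h3 := norm_paramPoint_le hω.1 hω.2.1 hω.2.2
  have h4 := hd ω.2.2 (le_of_lt hω.2.2)
  have h5 : 0 < ω.2.2 := one_pos.trans hω.2.2
  rw [Real.norm_of_nonneg (by positivity), paramDensity, norm_mul, norm_mul, norm_mul, norm_mul,
    Complex.norm_I, mul_one, Complex.norm_real, Complex.norm_real]
  calc ‖(ProbabilityTheory.beta (2 - r₁) (2 - r₂))⁻¹‖ * ‖betaWeight (2 - r₁) (2 - r₂) ω.1‖ *
        (‖f₁ (horPoint ω.2.1)‖ * ‖f₂ (I * ω.2.2)‖) * (1 + ‖paramPoint ω‖) ^ k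
      ≤ ‖(ProbabilityTheory.beta (2 - r₁) (2 - r₂))⁻¹‖ * ‖betaWeight (2 - r₁) (2 - r₂) ω.1‖ *
        (‖f₁ (horPoint ω.2.1)‖ * (C * Real.exp (-c * (ω.2.2 - 1)))) * (4 * ω.2.2) ^ k := by
        gcongr
    _ = _ := by rw [mul_pow]; ring

/-- The `u`-integral, done first, is Feynman's formula with `A = z₁ - t` and `B = z₂ - t`. What
remains is a product of a function of `s` and a function of `y`, the two Eichler integrals. -/
lemma cupRep_eq_integral {r₁ r₂ r₃ : ℝ} (hr₁ : r₁ < 2) (hr₂ : r₂ < 2)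
    (hr : r₁ + r₂ + r₃ = 4) {f₁ f₂ : ℂ → ℂ}
    (hm : AEStronglyMeasurable (paramDensity r₁ r₂ f₁ f₂) paramMeasure)
    (hint : Integrable (fun ω => ‖paramDensity r₁ r₂ f₁ f₂ ω‖) paramMeasure) {t : ℂ} (ht : t.im < 0) :
    cupRep r₁ r₂ f₁ f₂ t =
      ∫ ω, paramDensity r₁ r₂ f₁ f₂ ω * (paramPoint ω - t) ^ (-r₃ : ℂ) ∂paramMeasure := by
  have hα := sub_pos.mpr hr₁
  have hβ := sub_pos.mpr hr₂
  have hI : Integrable (fun ω => paramDensity r₁ r₂ f₁ f₂ ω * (paramPoint ω - t) ^ (-r₃ : ℂ))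
      paramMeasure := by
    refine (hint.mul_const ((√3 / 2) ^ (-r₃))).mono' (hm.mul
      ((measurable_paramPoint.sub_const t).pow_const _).aestronglyMeasurable) ?_
    filter_upwards [ae_paramMeasure] with ω hω
    have h3 := le_paramPoint_im hω.1 hω.2.2
    have h4 : √3 / 2 ≤ ‖paramPoint ω - t‖ := by
      have := (le_abs_self _).trans (Complex.abs_im_le_norm (paramPoint ω - t))
      rw [Complex.sub_im] at this
      linarith
    rw [norm_mul, ← Complex.ofReal_neg, Complex.norm_cpow_real]
    refine mul_le_mul_of_nonneg_left ?_ (norm_nonneg _)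
    exact Real.rpow_le_rpow_of_nonpos (by positivity) h4 (by linarith)
  have hI' := hI
  unfold paramMeasure at hI'
  rw [paramMeasure, integral_prod_symm _ hI']
  have hin : ∀ᵐ q ∂((volume.restrict (Set.Ioc (0 : ℝ) 1)).prod (volume.restrict (Set.Ioi (1 : ℝ)))),
      (∫ u, paramDensity r₁ r₂ f₁ f₂ (u, q) * (paramPoint (u, q) - t) ^ (-r₃ : ℂ)
        ∂(volume.restrict (Set.Ioc (0 : ℝ) 1))) =
      (f₁ (horPoint q.1) * (horPoint q.1 - t) ^ ((r₁ - 2 : ℝ) : ℂ)) *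
        (f₂ (I * q.2) * (I * q.2 - t) ^ ((r₂ - 2 : ℝ) : ℂ) * I) := by
    have hae : ∀ᵐ q ∂((volume.restrict (Set.Ioc (0 : ℝ) 1)).prod
        (volume.restrict (Set.Ioi (1 : ℝ)))), (1 : ℝ) < q.2 := by
      rw [Measure.prod_restrict]
      filter_upwards [ae_restrict_mem (by measurability)] with q hq
      exact hq.2
    filter_upwards [hae] with q hq
    have hA : 0 < (horPoint q.1 - t).im := by
      rw [Complex.sub_im, horPoint_im]
      have : 0 ≤ √3 / 2 := by positivity
      linarith
    have hB : 0 < (I * q.2 - t).im := by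
      simp
      linarith
    have hF := feynman hα hβ hA hB
    have e1 : ∀ u : ℝ, paramDensity r₁ r₂ f₁ f₂ (u, q) * (paramPoint (u, q) - t) ^ (-r₃ : ℂ) =
        (((ProbabilityTheory.beta (2 - r₁) (2 - r₂))⁻¹ : ℝ) *
          (f₁ (horPoint q.1) * (f₂ (I * q.2) * I))) * ((betaWeight (2 - r₁) (2 - r₂) u : ℂ) *
        ((1 - u) * (horPoint q.1 - t) + u * (I * q.2 - t)) ^
          (-(2 - r₁ + (2 - r₂) : ℝ) : ℂ)) := by
      intro u
      have e2 : paramPoint (u, q) - t = (1 - u) * (horPoint q.1 - t) + u * (I * q.2 - t) := by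
        rw [paramPoint]; ring
      -- The weight condition makes the two exponents add up to that of the reproducing kernel in
      -- weight `r₃`.
      have e3 : r₃ = 2 - r₁ + (2 - r₂) := by linarith
      rw [e2, paramDensity, e3]
      ring
    have hb := (ProbabilityTheory.beta_pos hα hβ).ne'
    have hb' : (ProbabilityTheory.beta (2 - r₁) (2 - r₂) : ℂ) ≠ 0 := by exact_mod_cast hb
    simp only [e1]
    rw [integral_const_mul, ← intervalIntegral.integral_of_le zero_le_one, ← hF]
    have e4 : (-((2 - r₁ : ℝ) : ℂ)) = ((r₁ - 2 : ℝ) : ℂ) := by push_cast; ring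
    have e5 : (-((2 - r₂ : ℝ) : ℂ)) = ((r₂ - 2 : ℝ) : ℂ) := by push_cast; ring
    rw [e4, e5]
    push_cast
    field_simp
  rw [integral_congr_ae hin, integral_prod_mul (μ := volume.restrict (Set.Ioc (0 : ℝ) 1))
    (ν := volume.restrict (Set.Ioi (1 : ℝ)))
    (fun s : ℝ => f₁ (horPoint s) * (horPoint s - t) ^ ((r₁ - 2 : ℝ) : ℂ))
    (fun y : ℝ => f₂ (I * y) * (I * y - t) ^ ((r₂ - 2 : ℝ) : ℂ) * I), cupRep, eichler, eichlerCusp,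
    intervalIntegral.integral_of_le zero_le_one]
  simp only [horPoint_eq]
  simp only [sub_sub_cancel, mul_one]

/-- The trilinear form is the integral of `f₁(z₁) f₂(z₂) f₃((1 - u) z₁ + u z₂)`. -/
theorem trilinearForm_eq_integral {r₁ r₂ r₃ : ℝ} (hr₁ : r₁ < 2) (hr₂ : r₂ < 2) (hr₃ : 0 < r₃)
    (hr : r₁ + r₂ + r₃ = 4) {f₁ f₂ f₃ : ℂ → ℂ}
    (hf₁ : ContinuousOn f₁ {z : ℂ | 0 < z.im}) (hf₂ : ContinuousOn f₂ {z : ℂ | 0 < z.im})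
    {C c : ℝ} (hC : 0 ≤ C) (hc : 0 < c)
    (hd : ∀ y : ℝ, 1 ≤ y → ‖f₂ (I * y)‖ ≤ C * Real.exp (-c * (y - 1)))
    (hf₃ : DifferentiableOn ℂ f₃ {z : ℂ | 0 < z.im}) (hg₃ : ModerateGrowth f₃) :
    trilinearForm r₁ r₂ r₃ f₁ f₂ f₃ = (-2 * I) ^ (r₃ : ℂ) *
      ∫ ω, paramDensity r₁ r₂ f₁ f₂ ω * f₃ (paramPoint ω) ∂paramMeasure := by
  obtain ⟨hm, hint⟩ := integrable_paramDensity hr₁ hr₂ hf₁ hf₂ hC hc hd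
  refine dualitySmooth_integral hr₃ measurable_paramPoint hm (δ := √3 / 2) (by positivity) ?_ hint
    (fun t ht => cupRep_eq_integral hr₁ hr₂ hr hm (by simpa using hint 0) ht) hf₃ hg₃
  filter_upwards [ae_paramMeasure] with ω hω
  exact le_paramPoint_im hω.1 hω.2.2

open MeasureTheory

/-! ### Termwise integration -/

lemma expTwoPi_add (μ ν : ℝ) (z : ℂ) : expTwoPi (μ + ν) z = expTwoPi μ z * expTwoPi ν z := by
  rw [expTwoPi, expTwoPi, expTwoPi, ← Complex.exp_add]
  congr 1
  push_cast
  ring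

lemma continuous_expTwoPi (μ : ℝ) : Continuous (expTwoPi μ) := by unfold expTwoPi; fun_prop

/-- The segment has length one, is centred on the imaginary axis and lies at height `√3/2`: the
height gives the exponential, the symmetric integral gives `sinc`. -/
lemma integral_expTwoPi_horPoint (ν : ℝ) :
    ∫ s in Set.Ioc (0 : ℝ) 1, expTwoPi ν (horPoint s) =
      ((Real.exp (-(π * √3 * ν)) * Real.sinc (π * ν) : ℝ) : ℂ) := by
  rw [← intervalIntegral.integral_of_le zero_le_one]
  set c : ℂ := 2 * π * I * ν with hc
  have e : ∀ s : ℝ, expTwoPi ν (horPoint s) =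
      (Real.exp (-(π * √3 * ν)) : ℂ) * Complex.exp (-(c / 2)) * Complex.exp (c * s) := by
    intro s
    rw [expTwoPi, horPoint, Complex.ofReal_exp, ← Complex.exp_add, ← Complex.exp_add]
    congr 1
    rw [hc]
    push_cast
    linear_combination (π * √3 * ν : ℂ) * Complex.I_sq
  simp only [e]
  rw [intervalIntegral.integral_const_mul]
  by_cases hν : ν = 0
  · simp [hc, hν]
  · have hpi : (π : ℂ) ≠ 0 := by exact_mod_cast Real.pi_ne_zero
    have hνc : (ν : ℂ) ≠ 0 := by exact_mod_cast hν
    have hc0 : c ≠ 0 := by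
      rw [hc]
      simp [hν, Complex.I_ne_zero]
    rw [integral_exp_mul_complex hc0, Real.sinc_of_ne_zero (mul_ne_zero Real.pi_ne_zero hν)]
    have h1 : Complex.exp (-(c / 2)) * (Complex.exp (c * (1 : ℝ)) - Complex.exp (c * (0 : ℝ))) =
        2 * I * Complex.sin (π * ν) := by
      rw [Complex.sin, mul_sub, ← Complex.exp_add, ← Complex.exp_add]
      have e1 : -(c / 2) + c * (1 : ℝ) = π * ν * I := by rw [hc]; push_cast; ring
      have e2 : -(c / 2) + c * (0 : ℝ) = -(π * ν) * I := by rw [hc]; push_cast; ring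
      rw [e1, e2]
      linear_combination (-(Complex.exp (-(π * ν) * I) - Complex.exp (π * ν * I))) * Complex.I_sq
    rw [mul_assoc, ← mul_div_assoc, h1, hc]
    push_cast
    field_simp [Complex.I_ne_zero]

lemma integral_expTwoPi_vertical {κ : ℝ} (hκ : 0 < κ) :
    ∫ y in Set.Ioi (1 : ℝ), expTwoPi κ (I * y) =
      ((Real.exp (-(2 * π * κ)) / (2 * π * κ) : ℝ) : ℂ) := by
  have hpi := Real.pi_pos
  have e : ∀ y : ℝ, expTwoPi κ (I * y) = Complex.exp (((-(2 * π * κ) : ℝ) : ℂ) * y) := by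
    intro y
    rw [expTwoPi]
    congr 1
    push_cast
    linear_combination (2 * π * κ * y : ℂ) * Complex.I_sq
  simp only [e]
  rw [integral_exp_mul_complex_Ioi (by
    rw [Complex.ofReal_re]
    have : 0 < 2 * π * κ := by positivity
    linarith)]
  push_cast
  rw [mul_one, div_neg, neg_div, neg_neg]

/-- The contribution of the frequencies `μ₁, μ₂, μ₃` to the integrand of the triple integral. -/
def paramTerm (r₁ r₂ μ₁ μ₂ μ₃ : ℝ) (ω : ℝ × (ℝ × ℝ)) : ℂ :=
  betaWeight (2 - r₁) (2 - r₂) ω.1 * ((expTwoPi μ₁ (horPoint ω.2.1) * (expTwoPi μ₂ (I * ω.2.2) * I)) *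
    expTwoPi μ₃ (paramPoint ω))

/-- As `paramPoint` is a convex combination, the third exponential splits between `z₁` and `z₂` and
only shifts their frequencies, so the variables `s` and `y` separate. -/
lemma paramTerm_eq (r₁ r₂ μ₁ μ₂ μ₃ u s y : ℝ) : paramTerm r₁ r₂ μ₁ μ₂ μ₃ (u, (s, y)) =
    betaWeight (2 - r₁) (2 - r₂) u * I * (expTwoPi (μ₁ + (1 - u) * μ₃) (horPoint s) *
      expTwoPi (μ₂ + μ₃ * u) (I * y)) := by
  have e : expTwoPi μ₃ (paramPoint (u, (s, y))) =
      expTwoPi ((1 - u) * μ₃) (horPoint s) * expTwoPi (μ₃ * u) (I * y) := by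
    rw [paramPoint, expTwoPi, expTwoPi, expTwoPi, ← Complex.exp_add]
    congr 1
    push_cast
    ring
  rw [paramTerm, e, expTwoPi_add, expTwoPi_add]
  ring

/-- The factor `i` from `dz₂ = i dy`, divided by `2π`, is the `-1/(2πi)` of `Ψ`. Collecting the
`u`-dependence of the horizontal and vertical exponentials leaves `e^{-π(2-√3)μ₃u}`. -/
lemma integral_paramTerm {r₁ r₂ μ₁ μ₂ μ₃ : ℝ} (hμ₂ : 0 < μ₂) (hμ₃ : 0 ≤ μ₃)
    (hint : Integrable (paramTerm r₁ r₂ μ₁ μ₂ μ₃) paramMeasure) :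
    ∫ ω, paramTerm r₁ r₂ μ₁ μ₂ μ₃ ω ∂paramMeasure = psi r₁ r₂ μ₁ μ₂ μ₃ := by
  unfold paramMeasure at hint
  rw [paramMeasure, integral_prod _ hint, psi, ← intervalIntegral.integral_ofReal,
    ← intervalIntegral.integral_const_mul, intervalIntegral.integral_of_le zero_le_one]
  refine setIntegral_congr_fun measurableSet_Ioc fun u hu => ?_
  have hκ : 0 < μ₂ + μ₃ * u := by
    have := mul_nonneg hμ₃ hu.1.le
    linarith
  have e : ∀ q : ℝ × ℝ, paramTerm r₁ r₂ μ₁ μ₂ μ₃ (u, q) = betaWeight (2 - r₁) (2 - r₂) u * I *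
      (expTwoPi (μ₁ + (1 - u) * μ₃) (horPoint q.1) * expTwoPi (μ₂ + μ₃ * u) (I * q.2)) := fun q =>
    paramTerm_eq r₁ r₂ μ₁ μ₂ μ₃ u q.1 q.2
  simp only [e]
  rw [integral_const_mul, integral_prod_mul (μ := volume.restrict (Set.Ioc (0 : ℝ) 1))
    (ν := volume.restrict (Set.Ioi (1 : ℝ)))
    (fun s : ℝ => expTwoPi (μ₁ + (1 - u) * μ₃) (horPoint s))
    (fun y : ℝ => expTwoPi (μ₂ + μ₃ * u) (I * y)), integral_expTwoPi_horPoint,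
    integral_expTwoPi_vertical hκ, psiIntegrand_eq]
  have hexp : Real.exp (-(π * √3 * (μ₁ + (1 - u) * μ₃))) * Real.exp (-(2 * π * (μ₂ + μ₃ * u))) =
      Real.exp (-2 * π * μ₂ - π * √3 * (μ₁ + μ₃)) * Real.exp (-π * (2 - √3) * μ₃ * u) := by
    rw [← Real.exp_add, ← Real.exp_add]
    congr 1
    ring
  have hκc : (μ₂ : ℂ) + μ₃ * u ≠ 0 := by exact_mod_cast hκ.ne'
  have hpi : (π : ℂ) ≠ 0 := by exact_mod_cast Real.pi_ne_zero
  have hexp' : (Real.exp (-(π * √3 * (μ₁ + (1 - u) * μ₃))) : ℂ) *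
      (Real.exp (-(2 * π * (μ₂ + μ₃ * u))) : ℂ) =
      (Real.exp (-2 * π * μ₂ - π * √3 * (μ₁ + μ₃)) : ℂ) *
      (Real.exp (-π * (2 - √3) * μ₃ * u) : ℂ) := by exact_mod_cast hexp
  simp only [Complex.ofReal_mul (betaWeight _ _ _), Complex.ofReal_mul (Real.exp _),
    Complex.ofReal_div, Complex.ofReal_mul (_ / _)]
  calc _ = (betaWeight (2 - r₁) (2 - r₂) u : ℂ) * I *
        ((Real.exp (-(π * √3 * (μ₁ + (1 - u) * μ₃))) : ℂ) *
          (Real.exp (-(2 * π * (μ₂ + μ₃ * u))) : ℂ)) *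
        (Real.sinc (π * (μ₁ + (1 - u) * μ₃)) : ℂ) / ((2 * π * (μ₂ + μ₃ * u) : ℝ) : ℂ) := by ring
    _ = _ := by
      rw [hexp']
      push_cast
      field_simp [Complex.I_ne_zero]
      linear_combination (betaWeight (2 - r₁) (2 - r₂) u : ℂ) *
        (Real.sinc (π * (μ₁ + (1 - u) * μ₃)) : ℂ) * Complex.I_sq

lemma measurable_expTwoPi (μ : ℝ) : Measurable (expTwoPi μ) := (continuous_expTwoPi μ).measurable

lemma aestronglyMeasurable_paramTerm {r₁ r₂ : ℝ} (hr₁ : r₁ < 2) (hr₂ : r₂ < 2) (μ₁ μ₂ μ₃ : ℝ) :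
    AEStronglyMeasurable (paramTerm r₁ r₂ μ₁ μ₂ μ₃) paramMeasure := by
  have hw := integrable_betaWeight (sub_pos.mpr hr₁) (sub_pos.mpr hr₂)
  refine AEStronglyMeasurable.mul (hw.ofReal (𝕜 := ℂ)).aestronglyMeasurable.comp_fst ?_
  apply Measurable.aestronglyMeasurable
  have h1 := measurable_expTwoPi
  have h2 := continuous_horPoint.measurable
  have h3 := measurable_paramPoint
  fun_prop

/-- The triple integral of `f₁(z₁) f₂(z₂) f₃((1 - u) z₁ + u z₂)` in terms of Fourier coefficients. -/
theorem hasSum_integral_paramDensity {r₁ r₂ p₁ p₂ p₃ : ℝ} (hr₁ : r₁ < 2) (hr₂ : r₂ < 2)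
    {f₁ f₂ f₃ : ℂ → ℂ} {a₁ a₂ a₃ : ℕ → ℂ} (h₁ : HasFourierExpansion p₁ f₁ a₁)
    (h₂ : HasFourierExpansion p₂ f₂ a₂) (h₃ : HasFourierExpansion p₃ f₃ a₃)
    {ε : ℝ} (hε : 0 < ε) (ha₂ : ∀ m, a₂ m ≠ 0 → ε ≤ freq p₂ m)
    (ha₃ : ∀ m, a₃ m ≠ 0 → 0 ≤ freq p₃ m) :
    HasSum (fun m : ℕ × ℕ × ℕ => a₁ m.1 * a₂ m.2.1 * a₃ m.2.2 *
      psi r₁ r₂ (freq p₁ m.1) (freq p₂ m.2.1) (freq p₃ m.2.2))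
      (ProbabilityTheory.beta (2 - r₁) (2 - r₂) *
        ∫ ω, paramDensity r₁ r₂ f₁ f₂ ω * f₃ (paramPoint ω) ∂paramMeasure) := by
  have hpi := Real.pi_pos
  have h3pos : 0 < √3 / 2 := by positivity
  set T : ℕ × ℕ × ℕ → ℝ × (ℝ × ℝ) → ℂ := fun m ω => a₁ m.1 * a₂ m.2.1 * a₃ m.2.2 *
    paramTerm r₁ r₂ (freq p₁ m.1) (freq p₂ m.2.1) (freq p₃ m.2.2) ω with hT
  -- Product of the absolute Fourier series at heights `√3/2`, `1` and `√3/2`. The first is the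
  -- exact height of `z₁`; the other two are lower bounds, usable because the relevant frequencies
  -- are nonnegative.
  set X : ℕ × ℕ × ℕ → ℝ := fun m => (‖a₁ m.1‖ * Real.exp (-(2 * π * freq p₁ m.1 * (√3 / 2)))) *
    ((‖a₂ m.2.1‖ * Real.exp (-(2 * π * freq p₂ m.2.1 * 1))) *
      (‖a₃ m.2.2‖ * Real.exp (-(2 * π * freq p₃ m.2.2 * (√3 / 2))))) with hX
  have hXs : Summable X :=
    (h₁.summable h3pos).mul_of_nonneg ((h₂.summable one_pos).mul_of_nonneg (h₃.summable h3pos)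
      (fun _ => by positivity) (fun _ => by positivity)) (fun _ => by positivity)
      (fun _ => by positivity)
  set G : ℝ × (ℝ × ℝ) → ℝ := fun ω => ‖betaWeight (2 - r₁) (2 - r₂) ω.1‖ *
    (1 * (ω.2.2 ^ 0 * Real.exp (-(2 * π * ε) * (ω.2.2 - 1)))) with hG
  have hGi : Integrable G paramMeasure :=
    (integrable_betaWeight (sub_pos.mpr hr₁) (sub_pos.mpr hr₂)).norm.mul_prod
      ((integrable_const (1 : ℝ)).mul_prod (integrable_pow_mul_exp 0 (by positivity)))
  have hle : ∀ m, ∀ᵐ ω ∂paramMeasure, ‖T m ω‖ ≤ X m * G ω := by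
    intro m
    filter_upwards [ae_paramMeasure] with ω hω
    have hy : 1 ≤ ω.2.2 := le_of_lt hω.2.2
    have hA := norm_coeff_mul_expTwoPi_le ha₂ hy m.2.1
    have hB : ‖a₃ m.2.2 * expTwoPi (freq p₃ m.2.2) (paramPoint ω)‖ ≤
        ‖a₃ m.2.2‖ * Real.exp (-(2 * π * freq p₃ m.2.2 * (√3 / 2))) := by
      by_cases ha : a₃ m.2.2 = 0
      · simp [ha]
      · have h5 := ha₃ _ ha
        have h6 := le_paramPoint_im hω.1 hω.2.2
        rw [norm_mul, norm_expTwoPi]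
        gcongr
    have hC : ‖a₁ m.1 * expTwoPi (freq p₁ m.1) (horPoint ω.2.1)‖ =
        ‖a₁ m.1‖ * Real.exp (-(2 * π * freq p₁ m.1 * (√3 / 2))) := by
      rw [norm_mul, norm_expTwoPi, horPoint_im]
    calc ‖T m ω‖ = ‖betaWeight (2 - r₁) (2 - r₂) ω.1‖ *
          (‖a₁ m.1 * expTwoPi (freq p₁ m.1) (horPoint ω.2.1)‖ *
          (‖a₂ m.2.1 * expTwoPi (freq p₂ m.2.1) (I * ω.2.2)‖ *
          ‖a₃ m.2.2 * expTwoPi (freq p₃ m.2.2) (paramPoint ω)‖)) := by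
          simp only [hT, paramTerm, norm_mul, Complex.norm_I, mul_one, Complex.norm_real]
          ring
      _ ≤ ‖betaWeight (2 - r₁) (2 - r₂) ω.1‖ *
          ((‖a₁ m.1‖ * Real.exp (-(2 * π * freq p₁ m.1 * (√3 / 2)))) *
          ((‖a₂ m.2.1‖ * Real.exp (-(2 * π * freq p₂ m.2.1 * 1)) *
            Real.exp (-(2 * π * ε) * (ω.2.2 - 1))) *
          (‖a₃ m.2.2‖ * Real.exp (-(2 * π * freq p₃ m.2.2 * (√3 / 2)))))) := by
          rw [hC]
          gcongr
      _ = X m * G ω := by rw [hX, hG]; ring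
  have hTm : ∀ m, AEStronglyMeasurable (T m) paramMeasure := fun m =>
    (aestronglyMeasurable_paramTerm hr₁ hr₂ _ _ _).const_mul _
  have hTi : ∀ m, Integrable (T m) paramMeasure := fun m =>
    (hGi.const_mul (X m)).mono' (hTm m) (hle m)
  have hs := hasSum_integral_of_summable_integral_norm hTi (by
    refine Summable.of_nonneg_of_le (fun m => integral_nonneg fun _ => norm_nonneg _) (fun m => ?_)
      (hXs.mul_right (∫ ω, G ω ∂paramMeasure))
    rw [← integral_const_mul]
    exact integral_mono_ae (hTi m).norm (hGi.const_mul _) (hle m))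
  have e1 : (fun m => ∫ ω, T m ω ∂paramMeasure) = fun m : ℕ × ℕ × ℕ =>
      a₁ m.1 * a₂ m.2.1 * a₃ m.2.2 *
        psi r₁ r₂ (freq p₁ m.1) (freq p₂ m.2.1) (freq p₃ m.2.2) := by
    ext m
    -- Only nonzero coefficients guarantee `μ₂ > 0` and `μ₃ ≥ 0`, the range in which the integral is
    -- `Ψ`; other terms vanish whatever value `psi` takes.
    by_cases h0 : a₁ m.1 * a₂ m.2.1 * a₃ m.2.2 = 0
    · simp [hT, h0]
    · have h0' : (a₁ m.1 ≠ 0 ∧ a₂ m.2.1 ≠ 0) ∧ a₃ m.2.2 ≠ 0 := by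
        simpa [not_or] using h0
      have hi : Integrable (paramTerm r₁ r₂ (freq p₁ m.1) (freq p₂ m.2.1) (freq p₃ m.2.2))
          paramMeasure :=
        (integrable_const_mul_iff (IsUnit.mk0 _ h0) _).mp (hTi m)
      rw [hT, integral_const_mul, integral_paramTerm (hε.trans_le (ha₂ _ h0'.1.2))
        (ha₃ _ h0'.2) hi]
  have e2 : ∫ ω, ∑' m, T m ω ∂paramMeasure = ProbabilityTheory.beta (2 - r₁) (2 - r₂) *
      ∫ ω, paramDensity r₁ r₂ f₁ f₂ ω * f₃ (paramPoint ω) ∂paramMeasure := by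
    rw [← integral_const_mul]
    refine integral_congr_ae ?_
    filter_upwards [ae_paramMeasure] with ω hω
    have hb := (ProbabilityTheory.beta_pos (sub_pos.mpr hr₁) (sub_pos.mpr hr₂)).ne'
    have hb' : (ProbabilityTheory.beta (2 - r₁) (2 - r₂) : ℂ) ≠ 0 := by exact_mod_cast hb
    have hz₁ := h₁.hasSum (z := horPoint ω.2.1) (by rw [horPoint_im]; exact h3pos)
    have hz₂ := h₂.hasSum (z := I * ω.2.2) (by
      have : (1 : ℝ) < ω.2.2 := hω.2.2
      simp
      linarith)
    have hz₃ := h₃.hasSum (z := paramPoint ω) (h3pos.trans_le (le_paramPoint_im hω.1 hω.2.2))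
    have h23 := hasSum_mul_of_summable_norm hz₂.summable.norm hz₃.summable.norm
    have h123 := hasSum_mul_of_summable_norm hz₁.summable.norm h23.summable.norm
    rw [h23.tsum_eq, hz₁.tsum_eq, hz₂.tsum_eq, hz₃.tsum_eq] at h123
    have h4 := (h123.mul_left ((betaWeight (2 - r₁) (2 - r₂) ω.1 : ℂ) * I)).tsum_eq
    calc ∑' m, T m ω = ∑' m : ℕ × ℕ × ℕ, (betaWeight (2 - r₁) (2 - r₂) ω.1 : ℂ) * I *
          (a₁ m.1 * expTwoPi (freq p₁ m.1) (horPoint ω.2.1) *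
            (a₂ m.2.1 * expTwoPi (freq p₂ m.2.1) (I * ω.2.2) *
              (a₃ m.2.2 * expTwoPi (freq p₃ m.2.2) (paramPoint ω)))) := by
          refine tsum_congr fun m => ?_
          simp only [hT, paramTerm]
          ring
      _ = _ := by
          rw [h4, paramDensity]
          push_cast
          field_simp
  rw [e1, e2] at hs
  exact hs

end CupProduct

end

/-! ### Assembly of the proposition -/

theorem mainTheorem4 (r₁ r₂ r₃ p₁ p₂ p₃ : ℝ)
    (hr₁ : r₁ < 2) (hr₂ : 0 < r₂) (hr₂' : r₂ < 2) (hr₃ : 0 < r₃) (hr : r₁ + r₂ + r₃ = 4)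
    (hp₁ : ∃ k : ℤ, p₁ - r₁ = 2 * k) (hp₂ : ∃ k : ℤ, p₂ - r₂ = 2 * k)
    (hp₃ : ∃ k : ℤ, p₃ - r₃ = 2 * k) (hp : p₁ + p₂ + p₃ = 0) :
    -- the expression of the trilinear form by Fourier coefficients
    (∀ (f₁ f₂ f₃ : ℂ → ℂ) (a₁ a₂ a₃ : ℕ → ℂ),
      CupProduct.IsAutomorphicForm r₁ p₁ f₁ →
      CupProduct.IsCuspForm r₂ p₂ f₂ →
      CupProduct.IsEntireForm r₃ p₃ f₃ →
      CupProduct.HasFourierExpansion p₁ f₁ a₁ →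
      CupProduct.HasFourierExpansion p₂ f₂ a₂ →
      CupProduct.HasFourierExpansion p₃ f₃ a₃ →
      Summable (fun m : ℕ × ℕ × ℕ => a₁ m.1 * a₂ m.2.1 * a₃ m.2.2 *
        CupProduct.psi r₁ r₂ ((12 * m.1 + p₁) / 12) ((12 * m.2.1 + p₂) / 12)
          ((12 * m.2.2 + p₃) / 12)) ∧
      CupProduct.trilinearForm r₁ r₂ r₃ f₁ f₂ f₃ =
        (-2 * I) ^ (r₃ : ℂ) / ((ProbabilityTheory.beta (2 - r₁) (2 - r₂) : ℝ) : ℂ) *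
          ∑' m : ℕ × ℕ × ℕ, a₁ m.1 * a₂ m.2.1 * a₃ m.2.2 *
            CupProduct.psi r₁ r₂ ((12 * m.1 + p₁) / 12) ((12 * m.2.1 + p₂) / 12)
              ((12 * m.2.2 + p₃) / 12)) ∧
    -- the integral that defines `Ψ` converges
    (∀ μ₁ μ₂ μ₃ : ℝ, 0 < μ₂ → 0 ≤ μ₃ →
      IntervalIntegrable (CupProduct.psiIntegrand r₁ r₂ μ₁ μ₂ μ₃) MeasureTheory.volume 0 1) ∧
    -- the second expression for `Ψ`
    (∀ μ₁ μ₂ μ₃ : ℝ, 0 < μ₂ → 0 < μ₃ →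
      IntervalIntegrable (CupProduct.psiIntegrand' r₁ r₂ μ₁ μ₂ μ₃) MeasureTheory.volume 0 μ₃ ∧
      CupProduct.psi r₁ r₂ μ₁ μ₂ μ₃ =
        -((Real.exp (-2 * π * μ₂ - π * √3 * (μ₁ + μ₃)) : ℝ) : ℂ) / (2 * π * I) *
          ((μ₃ ^ (1 - r₃) : ℝ) : ℂ) *
          ((∫ u in (0 : ℝ)..μ₃, CupProduct.psiIntegrand' r₁ r₂ μ₁ μ₂ μ₃ u : ℝ) : ℂ)) := by
  refine ⟨fun f₁ f₂ f₃ a₁ a₂ a₃ hf₁ hf₂ hf₃ h₁ h₂ h₃ => ?_, fun μ₁ μ₂ μ₃ hμ₂ hμ₃ =>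
    CupProduct.intervalIntegrable_psiIntegrand hr₁ hr₂' hμ₂ hμ₃, fun μ₁ μ₂ μ₃ hμ₂ hμ₃ =>
    ⟨CupProduct.intervalIntegrable_psiIntegrand' hr₁ hr₂' hμ₂ hμ₃,
      CupProduct.psi_eq_integral_psiIntegrand' hr hμ₃⟩⟩
  -- The cusp condition enters through this gap `ε`, used for the exponential decay of `f₂` and for
  -- termwise integration.
  obtain ⟨ε, hε, ha₂⟩ := CupProduct.exists_pos_le_freq fun m hm => hf₂.freq_pos h₂ hm
  have hs := CupProduct.hasSum_integral_paramDensity hr₁ hr₂' h₁ h₂ h₃ hε ha₂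
    fun m hm => hf₃.freq_nonneg h₃ hm
  obtain ⟨C, hC, hd⟩ := h₂.exp_decay ha₂
  have hT := CupProduct.trilinearForm_eq_integral hr₁ hr₂' hr₃ hr hf₁.holo.continuousOn
    hf₂.holo.continuousOn hC (by positivity) hd hf₃.holo (hf₃.moderateGrowth hr₃)
  have hb : ((ProbabilityTheory.beta (2 - r₁) (2 - r₂) : ℝ) : ℂ) ≠ 0 := by
    exact_mod_cast (ProbabilityTheory.beta_pos (sub_pos.mpr hr₁) (sub_pos.mpr hr₂')).ne'
  refine ⟨hs.summable, ?_⟩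
  rw [hT]
  refine Eq.trans ?_ (congrArg (_ * ·) hs.tsum_eq.symm)
  rw [div_mul_eq_mul_div, mul_left_comm, mul_div_cancel_left₀ _ hb]
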